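/- **Proposition 3.1.** Let $n\ge 2$ and let $Y$ be a random vector of $\mathbb R^n$ with independent, integrable components, mean $f=\mathbb E(Y)$ and noise $\xi=Y-f$. Assume that for some $\sigma>0$ and $c\ge 0$, $$\log\mathbb E\big[e^{\lambda\xi_i}\big]\le\frac{\lambda^2\sigma^2}{2(1-|\lambda|c)}\qquad\text{for all }\lambda\in(-1/c,1/c),\ i=1,\dots,n$$ (with $1/0=+\infty$). All partitions considered below are partitions of $\{1,\dots,n\}$ whose elements consist of consecutive integers. For such a partition $m$, let $|m|$ be its number of elements, let $S_m\subset\mathbb R^n$ be the space of vectors whose coordinates are constant on each element of $m$, and let $\hat f_m=\Pi_{S_m}Y$, where $\Pi_{S_m}$ is the orthogonal projection onto $S_m$. Let $\mathfrak m$ be such a partition and $\mathcal M$ a nonempty collection of such partitions with $S_m\subset S_{\mathfrak m}$ for all $m\in\mathcal M$. Let $\Delta_m\ge 0$ for $m\in\mathcal M$, $\Sigma=\sum_{m\in\mathcal M}e^{-\Delta_m}$ and $\kappa=18$. Let $a,b>0$ and assume $|I|\ge a^2\log^2(n)$ for all $I\in\mathfrak m$. Let $K>1$ and let $\mathrm{pen}:\mathcal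 M\to\mathbb R_+$ satisfy $$\mathrm{pen}(m)\ge K\kappa^2\Big(\sigma^2+2c\,\frac{(\sigma+c)(b+2)}{a\kappa}\Big)\big(|m|+\Delta_m\big)\qquad\text{for all } m\in\mathcal M.$$ Let $\hat m$ be any (measurable) random index with values in $\mathcal M$ minimizing $m\mapsto |Y-\hat f_m|_2^2+\mathrm{pen}(m)$ over $\mathcal M$. Then all the risks below are finite and $$\mathbb E\big(|f-\hat f_{\hat m}|_2^2\big)\le C(K)\Big[\inf_{m\in\mathcal M}\Big(\mathbb E\big(|f-\hat f_m|_2^2\big)+\mathrm{pen}(m)\Big)+R\Big],$$ where $$C(K)=\frac{K(K^2+K-1)}{(K-1)^3},\qquad R=\kappa^2\Big(\sigma^2+2c\,\frac{(c+\sigma)(b+2)}{a\kappa}\Big)\Sigma+2\,\frac{(c+\sigma)^2(b+2)^2}{a^2n^b}.$$ -/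

import Mathlib

open MeasureTheory ProbabilityTheory

noncomputable section

namespace Histogram

/-- Partitions (into nonempty cells) of the index set of `ℝⁿ`. -/
abbrev Part (n : ℕ) : Type := Finpartition (Finset.univ : Finset (Fin n))

/-- Every cell of the partition consists of consecutive integers. -/
def Consecutive {n : ℕ} (m : Part n) : Prop :=
  ∀ I ∈ m.parts, (I : Set (Fin n)).OrdConnected

/-- The model `S_m`: vectors of `ℝⁿ` whose coordinates are constant on each cell of `m`. -/
def model {n : ℕ} (m : Part n) : Submodule ℝ (EuclideanSpace ℝ (Fin n)) where
  carrier := {v | ∀ I ∈ m.parts, ∀ i ∈ I, ∀ j ∈ I, v i = v j}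
  add_mem' := by
    intro v w hv hw I hI i hi j hj
    simp [hv I hI i hi j hj, hw I hI i hi j hj]
  zero_mem' := by
    intro I _ i _ j _
    simp
  smul_mem' := by
    intro t v hv I hI i hi j hj
    simp [hv I hI i hi j hj]

/-- The least-squares estimator on the model `S_m`: the orthogonal projection of the data
`y` onto `S_m`. -/
def estimator {n : ℕ} (m : Part n) (y : EuclideanSpace ℝ (Fin n)) :
    EuclideanSpace ℝ (Fin n) :=
  (model m).starProjection y

/-- The penalized least-squares criterion. -/
def crit {n : ℕ} (pen : Part n → ℝ) (y : EuclideanSpace ℝ (Fin n)) (m : Part n) : ℝ :=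
  ‖y - estimator m y‖ ^ 2 + pen m

/-- `log E exp(lX) ≤ l²σ² / (2(1 - |l|c))` for all `l ∈ (-1/c, 1/c)`, with `1/0 = +∞`;
finiteness of the exponential moment is part of the condition. -/
def ExpMomentBound {Ω : Type*} [MeasurableSpace Ω] (P : Measure Ω) (X : Ω → ℝ) (σ c : ℝ) :
    Prop :=
  ∀ l : ℝ, |l| * c < 1 →
    Integrable (fun ω => Real.exp (l * X ω)) P ∧
      Real.log (∫ ω, Real.exp (l * X ω) ∂P) ≤ l ^ 2 * σ ^ 2 / (2 * (1 - |l| * c))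

/-- The numerical constant `κ`. -/
def kappa : ℝ := 18

/-- The constant `C(K)`. -/
def oracleConst (K : ℝ) : ℝ := K * (K ^ 2 + K - 1) / (K - 1) ^ 3

/-- The factor `κ² (σ² + 2c(σ+c)(b+2)/(aκ))`. -/
def penFactor (σ c a b : ℝ) : ℝ :=
  kappa ^ 2 * (σ ^ 2 + 2 * c * ((σ + c) * (b + 2) / (a * kappa)))

/-- The remainder `R`, for the weights `Δ_m`, `m ∈ M`. -/
def remainder {n : ℕ} (M : Finset (Part n)) (Δ : Part n → ℝ) (σ c a b : ℝ) : ℝ :=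
  penFactor σ c a b * ∑ m ∈ M, Real.exp (-Δ m)
    + 2 * ((c + σ) ^ 2 * (b + 2) ^ 2 / (a ^ 2 * (n : ℝ) ^ b))

end Histogram

end

/-! Write ξ for the noise, Π_m for the projection onto S_m, V for `penFactor` and ε = 1 - 1/C(K).
Expanding the criterion at the selected m̂ and at a fixed m gives, in `loss_le_of_crit_le`, that the
loss of m̂ divided by C(K) is at most the loss of m plus pen(m), plus the centred variable 2⟨f - Π_m
f, ξ⟩, plus any Z dominating 2|Π_m' ξ|² - 2⟨f - Π_m' f, ξ⟩ - ε|f - Π_m' f|² - pen(m') for all m' at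
once. So everything reduces to finding such a Z with mean at most VΣ, which is
`IndepNoise.exists_excess_of_penalty`.

On the event where every cell average of ξ over 𝔪 is at most u = (σ+c)(b+2)/a, sub-gamma block sums
behave like Gaussian ones with variance proxy σ² + cu, and V ≥ 36(σ² + cu). Off this event |Π_𝔪 ξ|²
dominates every term, and its mean there is at most V/10 (`IndepNoise.lintegral_bad_le_penFactor`);
since |m| ≥ 1, a constant multiple of V can be taken from the penalty. The variance terms use 9/20
V(|m| + Δ_m), through the exponential moments of the truncated χ²-type variables.

The linear terms keep ε(K - 9/20)V(|m| + Δ_m) after scaling by ε, and the mean of their excess is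
multiplied by 1/ε ≤ K. For K ≤ 1000 a union bound with weights e^{-Δ_m} is enough. For large K this
factor is unbounded while the coefficient of Σ is fixed, so a dominating variable of nonpositive
mean is required; in return the budget is close to 4V per cell. If log n ≤ 32, a union bound over
the at most n² intervals provides it. If log n ≥ 32, the maximal inequality
`IndepNoise.segmentation_bound` does, with a price per segment that does not depend on n.

That inequality compares every segmentation t with one segmentation g minimizing squared bias plus
b₀ per label. A segment of t is an end of a g-cell, some full g-cells and a beginning of a g-cell.
Full cells cost a projected-noise energy proportional to the number q of labels. The two end pieces
are controlled by line-crossing inequalities (`prefix_crossing`), which are free of the block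
length. The correction due to the mean of the residual r = h - Π_g h is controlled over dyadic
windows, and a maximal-function estimate (`sum_localSize_pow_four_le`) bounds the total over all
windows by |r|². All these expectations are paid by a quarter of the optimal cost |r|² + b₀q, which
t cannot undercut except by b₀ per label of its own. -/

noncomputable section
namespace Histogram

/-- Sub-gamma exponential moments, with variance factor `v` and scale `c`. -/
def SubGamma {Ω : Type*} [MeasurableSpace Ω] (P : Measure Ω) (X : Ω → ℝ) (v c : ℝ) : Prop :=
  ∀ l : ℝ, |l| * c < 1 →
    ∫⁻ ω, ENNReal.ofReal (Real.exp (l * X ω)) ∂P ≤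
      ENNReal.ofReal (Real.exp (l ^ 2 * v / (2 * (1 - |l| * c))))

/-! ### Moments and tails of one sub-gamma variable -/

section SingleVariable

variable {Ω : Type*} [MeasurableSpace Ω] {P : Measure Ω} {X : Ω → ℝ} {v c : ℝ}

lemma SubGamma.smul (h : SubGamma P X v c) (a : ℝ) :
    SubGamma P (fun ω => a * X ω) (a ^ 2 * v) (|a| * c) := by
  intro l hl
  have := h (l * a) (by rw [abs_mul, mul_assoc]; exact hl)
  rw [abs_mul, mul_assoc |l|] at this
  convert this using 4
  · ring_nf
  · ring_nf

lemma SubGamma.chernoff (h : SubGamma P X v c) (hX : Measurable X) {l : ℝ} (hl : |l| * c < 1)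
    (t : ℝ) :
    P {ω | t ≤ l * X ω} ≤
      ENNReal.ofReal (Real.exp (l ^ 2 * v / (2 * (1 - |l| * c)) - t)) := by
  have hm : Measurable fun ω => ENNReal.ofReal (Real.exp (l * X ω)) := by fun_prop
  have h1 := mul_meas_ge_le_lintegral hm (μ := P) (ENNReal.ofReal (Real.exp t))
  have h2 : {ω | t ≤ l * X ω} ⊆
      {ω | ENNReal.ofReal (Real.exp t) ≤ ENNReal.ofReal (Real.exp (l * X ω))} := by
    intro ω hω
    exact ENNReal.ofReal_le_ofReal (Real.exp_le_exp.2 hω)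
  have h3 : ENNReal.ofReal (Real.exp t) * P {ω | t ≤ l * X ω} ≤
      ENNReal.ofReal (Real.exp (l ^ 2 * v / (2 * (1 - |l| * c)))) :=
    (mul_le_mul_right (measure_mono h2) _).trans (h1.trans (h l hl))
  have h4 : ENNReal.ofReal (Real.exp (-t)) * (ENNReal.ofReal (Real.exp t)
      * P {ω | t ≤ l * X ω}) = P {ω | t ≤ l * X ω} := by
    rw [← mul_assoc, ← ENNReal.ofReal_mul (Real.exp_pos _).le, ← Real.exp_add]
    simp
  rw [← h4]
  refine (mul_le_mul_right h3 _).trans ?_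
  rw [← ENNReal.ofReal_mul (Real.exp_pos _).le, ← Real.exp_add]
  ring_nf
  exact le_rfl

lemma SubGamma.chernoff_abs (h : SubGamma P X v c) (hX : Measurable X) {l : ℝ} (hl0 : 0 ≤ l)
    (hl : l * c < 1) (s : ℝ) :
    P {ω | s ≤ |X ω|} ≤
      ENNReal.ofReal (2 * Real.exp (l ^ 2 * v / (2 * (1 - l * c)) - l * s)) := by
  have h1 := h.chernoff hX (l := l) (by rwa [abs_of_nonneg hl0]) (l * s)
  have h2 := h.chernoff hX (l := -l) (by rwa [abs_neg, abs_of_nonneg hl0]) (l * s)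
  rw [abs_neg, neg_sq] at h2
  rw [abs_of_nonneg hl0] at h1 h2
  have hsub : {ω | s ≤ |X ω|} ⊆ {ω | l * s ≤ l * X ω} ∪ {ω | l * s ≤ -l * X ω} := by
    intro ω hω
    rcases le_abs.1 (show s ≤ |X ω| from hω) with h | h
    · left; exact mul_le_mul_of_nonneg_left h hl0
    · right
      show l * s ≤ -l * X ω
      nlinarith
  refine (measure_mono hsub).trans ((measure_union_le _ _).trans ((add_le_add h1 h2).trans ?_))
  rw [← ENNReal.ofReal_add (Real.exp_pos _).le (Real.exp_pos _).le, ← two_mul]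

lemma SubGamma.bernstein (h : SubGamma P X v c) (hX : Measurable X) (hv : 0 < v) (hc : 0 ≤ c)
    {s : ℝ} (hs : 0 ≤ s) :
    P {ω | s ≤ |X ω|} ≤ ENNReal.ofReal (2 * Real.exp (-(s ^ 2 / (2 * (v + c * s))))) := by
  have hd : 0 < v + c * s := by positivity
  have h1 : 1 - s / (v + c * s) * c = v / (v + c * s) := by field_simp; ring
  -- This tilt makes 1 - lc equal to v / (v + cs), so the Chernoff exponent is exactly -s² / (2(v +
  -- cs)).
  have := h.chernoff_abs hX (l := s / (v + c * s)) (by positivity)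
    (by
      have : 0 < v / (v + c * s) := by positivity
      linarith) s
  refine this.trans (le_of_eq ?_)
  rw [h1]
  congr 3
  field_simp
  ring

/-- The right side is 2 cosh x = 2 + 4 sinh²(x/2), and sinh y ≥ y for y ≥ 0. -/
lemma sq_le_exp_add_exp_neg (x : ℝ) : x ^ 2 + 2 ≤ Real.exp x + Real.exp (-x) := by
  wlog hx : 0 ≤ x generalizing x
  · have := this (-x) (by linarith)
    rw [neg_sq, neg_neg] at this
    linarith
  have h := Real.cosh_eq x
  have h2 : x / 2 ≤ Real.sinh (x / 2) := Real.self_le_sinh_iff.2 (by linarith)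
  have h3 : Real.cosh x = Real.cosh (x / 2) ^ 2 + Real.sinh (x / 2) ^ 2 := by
    rw [← Real.cosh_two_mul]; ring_nf
  have h4 := Real.cosh_sq (x / 2)
  nlinarith

/-- A second-order comparison at the origin: adding the bounds at l and -l gives l²·E X² + 2 ≤ 2
exp(l²v / (2(1 - lc))), and letting l decrease to 0 leaves the variance factor. Centring is not
needed because the odd terms cancel. -/
lemma SubGamma.lintegral_sq_le [IsProbabilityMeasure P] (h : SubGamma P X v c)
    (hX : Measurable X) (hc : 0 ≤ c) :
    ∫⁻ ω, ENNReal.ofReal (X ω ^ 2) ∂P ≤ ENNReal.ofReal v := by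
  set A := ∫⁻ ω, ENNReal.ofReal (X ω ^ 2) ∂P with hA
  have key : ∀ l : ℝ, 0 < l → l * c < 1 →
      ENNReal.ofReal (l ^ 2) * A + 2 ≤
        ENNReal.ofReal (2 * Real.exp (l ^ 2 * v / (2 * (1 - l * c)))) := by
    intro l hl hlc
    have e1 : ENNReal.ofReal (l ^ 2) * A + 2
        = ∫⁻ ω, ENNReal.ofReal ((l * X ω) ^ 2 + 2) ∂P := by
      have : ∀ ω, ENNReal.ofReal ((l * X ω) ^ 2 + 2)
          = ENNReal.ofReal (l ^ 2) * ENNReal.ofReal (X ω ^ 2) + 2 := by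
        intro ω
        rw [ENNReal.ofReal_add (by positivity) (by norm_num), mul_pow,
          ENNReal.ofReal_mul (by positivity)]
        norm_num
      simp_rw [this]
      rw [lintegral_add_right _ measurable_const, lintegral_const_mul _ (by fun_prop)]
      simp [hA]
    rw [e1]
    have e2 : ∀ ω, ENNReal.ofReal ((l * X ω) ^ 2 + 2) ≤
        ENNReal.ofReal (Real.exp (l * X ω)) + ENNReal.ofReal (Real.exp (-l * X ω)) := by
      intro ω
      rw [← ENNReal.ofReal_add (Real.exp_pos _).le (Real.exp_pos _).le, neg_mul]
      exact ENNReal.ofReal_le_ofReal (sq_le_exp_add_exp_neg _)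
    refine (lintegral_mono e2).trans ?_
    rw [lintegral_add_left (by fun_prop)]
    have h1 := h l (by rwa [abs_of_pos hl])
    have h2 := h (-l) (by rwa [abs_neg, abs_of_pos hl])
    rw [abs_neg, neg_sq] at h2
    rw [abs_of_pos hl] at h1 h2
    refine (add_le_add h1 h2).trans (le_of_eq ?_)
    rw [← ENNReal.ofReal_add (Real.exp_pos _).le (Real.exp_pos _).le, ← two_mul]
  -- A single admissible l already forces finiteness, so that the limit can be taken among real
  -- numbers; l = 1/(2(c+1)) also covers c = 0.
  have hfin : A ≠ ⊤ := by
    intro hAt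
    have h0 : 0 < 1 / (2 * (c + 1)) := by positivity
    have := key (1 / (2 * (c + 1))) h0 (by rw [div_mul_eq_mul_div, div_lt_one (by positivity)]; linarith)
    have hne : ENNReal.ofReal ((1 / (2 * (c + 1))) ^ 2) ≠ 0 :=
      (ENNReal.ofReal_pos.2 (by positivity)).ne'
    rw [hAt, ENNReal.mul_top hne, top_add, top_le_iff] at this
    exact ENNReal.ofReal_ne_top this
  obtain ⟨B, hB0, hB⟩ : ∃ B : ℝ, 0 ≤ B ∧ A = ENNReal.ofReal B :=
    ⟨A.toReal, ENNReal.toReal_nonneg, (ENNReal.ofReal_toReal hfin).symm⟩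
  have key2 : ∀ l : ℝ, 0 < l → l * c < 1 →
      l ^ 2 * B + 2 ≤ 2 * Real.exp (l ^ 2 * v / (2 * (1 - l * c))) := by
    intro l hl hlc
    have := key l hl hlc
    rw [hB, ← ENNReal.ofReal_mul (by positivity)] at this
    have h2 : (2 : ENNReal) = ENNReal.ofReal 2 := by norm_num
    rw [h2, ← ENNReal.ofReal_add (by positivity) (by norm_num),
      ENNReal.ofReal_le_ofReal_iff (by positivity)] at this
    exact this
  rw [hB]
  apply ENNReal.ofReal_le_ofReal
  have hlim : Filter.Tendsto (fun l : ℝ => v / (1 - l * c) * Real.exp (l ^ 2 * v / (2 * (1 - l * c))))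
      (nhdsWithin 0 (Set.Ioi 0)) (nhds v) := by
    have : ContinuousAt (fun l : ℝ => v / (1 - l * c) * Real.exp (l ^ 2 * v / (2 * (1 - l * c)))) 0 := by
      have h1 : ContinuousAt (fun l : ℝ => 1 - l * c) 0 := by fun_prop
      refine ContinuousAt.mul (continuousAt_const.div h1 (by simp)) ?_
      refine ContinuousAt.rexp (ContinuousAt.div (by fun_prop) (by fun_prop) (by simp))
    have h2 := this.tendsto
    simp only [zero_mul, sub_zero, div_one, ne_eq, OfNat.ofNat_ne_zero, not_false_eq_true, zero_pow,
      zero_div, Real.exp_zero, mul_one] at h2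
    exact h2.mono_left nhdsWithin_le_nhds
  refine ge_of_tendsto hlim ?_
  have hsm : ∀ᶠ l : ℝ in nhdsWithin 0 (Set.Ioi 0), l * c < 1 := by
    have : ContinuousAt (fun l : ℝ => l * c) 0 := by fun_prop
    have h3 := this.tendsto.eventually (gt_mem_nhds (show (0 : ℝ) * c < 1 by simp))
    exact h3.filter_mono nhdsWithin_le_nhds
  filter_upwards [hsm, self_mem_nhdsWithin] with l hl hl0
  have hl0 : 0 < l := hl0
  have := key2 l hl0 hl
  set y := l ^ 2 * v / (2 * (1 - l * c)) with hy
  have hd : 0 < 1 - l * c := by linarith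
  have hexp : Real.exp y - 1 ≤ y * Real.exp y := by
    have := Real.add_one_le_exp (-y)
    have h4 : Real.exp (-y) * Real.exp y = 1 := by rw [← Real.exp_add]; simp
    nlinarith [Real.exp_pos y]
  have h5 : l ^ 2 * B ≤ l ^ 2 * (v / (1 - l * c) * Real.exp y) := by
    have : 2 * (y * Real.exp y) = l ^ 2 * (v / (1 - l * c) * Real.exp y) := by
      rw [hy]; field_simp
    linarith
  exact le_of_mul_le_mul_left h5 (by positivity)

/-- Truncated second moment. -/
lemma SubGamma.lintegral_sq_indicator_le (h : SubGamma P X v c)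
    (hX : Measurable X) {l y : ℝ} (hl : l * c < 1) (hy : 0 < y) (hly : 2 ≤ l * y) :
    ∫⁻ ω in {ω | y ≤ |X ω|}, ENNReal.ofReal (X ω ^ 2) ∂P ≤
      ENNReal.ofReal (2 * y ^ 2 * Real.exp (l ^ 2 * v / (2 * (1 - l * c)) - l * y)) := by
  have hl0 : 0 < l := by
    by_contra hcon
    nlinarith [mul_nonneg (neg_nonneg.2 (not_lt.1 hcon)) hy.le]
  have hms : MeasurableSet {ω | y ≤ |X ω|} := measurableSet_le measurable_const (by fun_prop)
  have pt : ∀ ω ∈ {ω | y ≤ |X ω|}, ENNReal.ofReal (X ω ^ 2) ≤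
      ENNReal.ofReal (y ^ 2 * Real.exp (-(l * y))) *
        (ENNReal.ofReal (Real.exp (l * X ω)) + ENNReal.ofReal (Real.exp (-l * X ω))) := by
    intro ω hω
    have hω : y ≤ |X ω| := hω
    rw [← ENNReal.ofReal_add (Real.exp_pos _).le (Real.exp_pos _).le,
      ← ENNReal.ofReal_mul (by positivity)]
    apply ENNReal.ofReal_le_ofReal
    -- On |X| ≥ y, squaring z ≤ e^{z-1} at z = |X|/y bounds X² by y² exp(2(|X|/y - 1)), and 2/y ≤ l
    -- turns the exponent into l|X| - ly.
    have h1 : |X ω| / y ≤ Real.exp (|X ω| / y - 1) := by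
      have := Real.add_one_le_exp (|X ω| / y - 1); linarith
    have h2 : (|X ω| / y) ^ 2 ≤ Real.exp (2 * (|X ω| / y - 1)) := by
      calc (|X ω| / y) ^ 2 ≤ (Real.exp (|X ω| / y - 1)) ^ 2 := by gcongr
        _ = _ := by rw [← Real.exp_nat_mul]; norm_num
    have h3 : 2 * (|X ω| / y - 1) ≤ l * |X ω| - l * y := by
      have : 2 * (|X ω| / y - 1) = (2 / y) * (|X ω| - y) := by field_simp
      rw [this, ← mul_sub]
      exact mul_le_mul_of_nonneg_right ((div_le_iff₀ hy).2 hly) (by linarith)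
    have h4 : Real.exp (l * |X ω|) ≤ Real.exp (l * X ω) + Real.exp (-l * X ω) := by
      rcases abs_cases (X ω) with ⟨h, _⟩ | ⟨h, _⟩
      · rw [h]; linarith [Real.exp_pos (-l * X ω)]
      · rw [h, mul_neg, ← neg_mul]; linarith [Real.exp_pos (l * X ω)]
    calc X ω ^ 2 = y ^ 2 * (|X ω| / y) ^ 2 := by rw [div_pow, sq_abs]; field_simp
      _ ≤ y ^ 2 * Real.exp (l * |X ω| - l * y) := by
          gcongr; exact h2.trans (Real.exp_le_exp.2 h3)
      _ = y ^ 2 * Real.exp (-(l * y)) * Real.exp (l * |X ω|) := by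
          rw [mul_assoc, ← Real.exp_add]; ring_nf
      _ ≤ _ := by gcongr
  refine (setLIntegral_mono' hms pt).trans ((setLIntegral_le_lintegral _ _).trans ?_)
  rw [lintegral_const_mul _ (by fun_prop), lintegral_add_left (by fun_prop)]
  have h1 := h l (by rwa [abs_of_pos hl0])
  have h2 := h (-l) (by rwa [abs_neg, abs_of_pos hl0])
  rw [abs_neg, neg_sq] at h2
  rw [abs_of_pos hl0] at h1 h2
  refine (mul_le_mul_right (add_le_add h1 h2) _).trans (le_of_eq ?_)
  rw [← ENNReal.ofReal_add (Real.exp_pos _).le (Real.exp_pos _).le,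
    ← ENNReal.ofReal_mul (by positivity), sub_eq_add_neg (_ / _) (l * y), Real.exp_add]
  congr 1
  ring

/-- Integrated exponential tail. -/
lemma lintegral_ofReal_le_of_tail {Z : Ω → ℝ} (hZ : Measurable Z) {C l : ℝ} (hC : 0 ≤ C)
    (hl : 0 < l)
    (h : ∀ y : ℝ, 0 < y → P {ω | y ≤ Z ω} ≤ ENNReal.ofReal (C * Real.exp (-(l * y)))) :
    ∫⁻ ω, ENNReal.ofReal (Z ω) ∂P ≤ ENNReal.ofReal (C / l) := by
  have h0 : ∫⁻ ω, ENNReal.ofReal (Z ω) ∂P = ∫⁻ ω, ENNReal.ofReal (max (Z ω) 0) ∂P := by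
    refine lintegral_congr fun ω => ?_
    rcases le_total (Z ω) 0 with h | h
    · rw [max_eq_right h, ENNReal.ofReal_of_nonpos h, ENNReal.ofReal_zero]
    · rw [max_eq_left h]
  rw [h0, lintegral_eq_lintegral_meas_le P (f := fun ω => max (Z ω) 0)
    (Filter.Eventually.of_forall fun ω => le_max_right _ _) (by fun_prop)]
  have h1 : ∀ t ∈ Set.Ioi (0 : ℝ), P {a | t ≤ max (Z a) 0} ≤
      ENNReal.ofReal (C * Real.exp (-(l * t))) := by
    intro t ht
    have ht : 0 < t := ht
    have : {a | t ≤ max (Z a) 0} = {a | t ≤ Z a} := by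
      ext a; simp [not_le.2 ht]
    rw [this]; exact h t ht
  refine (setLIntegral_mono' measurableSet_Ioi h1).trans ?_
  rw [← ofReal_integral_eq_lintegral_ofReal]
  · apply ENNReal.ofReal_le_ofReal
    rw [integral_const_mul]
    have : ∫ x in Set.Ioi (0 : ℝ), Real.exp (-(l * x)) = 1 / l := by
      have := integral_exp_mul_Ioi (a := -l) (by linarith) 0
      simp only [neg_mul] at this
      rw [this]; simp
    rw [this]; apply le_of_eq; ring
  · have := (integrableOn_exp_mul_Ioi (a := -l) (by linarith) 0)
    simp only [neg_mul] at this
    exact this.const_mul C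
  · exact Filter.Eventually.of_forall fun t => by positivity

/-- Exponential moment of the truncated square. -/
lemma SubGamma.lintegral_exp_sq_indicator_le [IsProbabilityMeasure P] (h : SubGamma P X v c)
    (hX : Measurable X) (hv : 0 < v) (hc : 0 ≤ c) {s₀ W : ℝ} (hW : v + c * s₀ ≤ W)
    (hs₀ : 0 ≤ s₀) :
    ∫⁻ ω in {ω | |X ω| ≤ s₀}, ENNReal.ofReal (Real.exp (X ω ^ 2 / (4 * W))) ∂P ≤ 3 := by
  have hW0 : 0 < W := by nlinarith [mul_nonneg hc hs₀]
  have hms : MeasurableSet {ω | |X ω| ≤ s₀} := measurableSet_le (by fun_prop) measurable_const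
  set Z : Ω → ℝ := {ω | |X ω| ≤ s₀}.indicator (fun ω => Real.exp (X ω ^ 2 / (4 * W)) - 1) with hZ
  have hZm : Measurable Z := Measurable.indicator (by fun_prop) hms
  have tail : ∀ t : ℝ, 0 < t → P {ω | t ≤ Z ω} ≤ ENNReal.ofReal (2 * (1 / (1 + t) ^ 2)) := by
    intro t ht
    -- The value of |X| at which exp(X²/(4W)) - 1 equals t. If s ≤ s₀, the Bernstein exponent
    -- s²/(2(v + cs)) is at least s²/(2W) = 2 log(1 + t), so the tail is 2/(1 + t)², with integral
    -- 2. If s > s₀, the truncation empties the event.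
    set s := Real.sqrt (4 * W * Real.log (1 + t)) with hs
    have hlog : 0 ≤ Real.log (1 + t) := Real.log_nonneg (by linarith)
    have hs2 : s ^ 2 = 4 * W * Real.log (1 + t) := Real.sq_sqrt (by positivity)
    by_cases hss : s ≤ s₀
    · have hsub : {ω | t ≤ Z ω} ⊆ {ω | s ≤ |X ω|} := by
        intro ω hω
        have hω : t ≤ Z ω := hω
        by_cases hin : |X ω| ≤ s₀
        · have hz : Z ω = Real.exp (X ω ^ 2 / (4 * W)) - 1 := by
            rw [hZ, Set.indicator_of_mem]; exact hin
          rw [hz] at hω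
          have h1 : Real.log (1 + t) ≤ X ω ^ 2 / (4 * W) := by
            rw [Real.log_le_iff_le_exp (by linarith)]; linarith
          rw [le_div_iff₀ (by positivity)] at h1
          apply Real.sqrt_le_iff.2
          refine ⟨abs_nonneg _, ?_⟩
          rw [sq_abs]; linarith
        · have hz : Z ω = 0 := by
            rw [hZ, Set.indicator_of_notMem]; exact hin
          linarith
      refine (measure_mono hsub).trans ((h.bernstein hX hv hc (Real.sqrt_nonneg _)).trans ?_)
      apply ENNReal.ofReal_le_ofReal
      gcongr
      have hrw : 1 / (1 + t) ^ 2 = Real.exp (-(2 * Real.log (1 + t))) := by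
        rw [Real.exp_neg, two_mul, Real.exp_add, Real.exp_log (by linarith), one_div, pow_two]
      rw [hrw]
      apply Real.exp_le_exp.2
      have hd : 0 < v + c * s := by positivity
      have : 2 * Real.log (1 + t) ≤ s ^ 2 / (2 * (v + c * s)) := by
        rw [le_div_iff₀ (by positivity), hs2]
        have : v + c * s ≤ W := by nlinarith
        nlinarith
      exact neg_le_neg this
    · have : {ω | t ≤ Z ω} = ∅ := by
        ext ω
        simp only [Set.mem_ofPred_eq, Set.mem_empty_iff_false, iff_false, not_le]
        by_cases hin : |X ω| ≤ s₀
        · have hz : Z ω = Real.exp (X ω ^ 2 / (4 * W)) - 1 := by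
            rw [hZ, Set.indicator_of_mem]; exact hin
          rw [hz]
          have h1 : X ω ^ 2 / (4 * W) < Real.log (1 + t) := by
            rw [div_lt_iff₀ (by positivity)]
            have : X ω ^ 2 < s ^ 2 := by
              rw [← sq_abs]; gcongr; linarith
            linarith
          have := (Real.lt_log_iff_exp_lt (by linarith)).1 h1
          linarith
        · have hz : Z ω = 0 := by
            rw [hZ, Set.indicator_of_notMem]; exact hin
          linarith
      rw [this]; simp
  have hZ0 : ∀ ω, 0 ≤ Z ω := by
    intro ω
    apply Set.indicator_nonneg
    intro ω _
    have := Real.one_le_exp (show 0 ≤ X ω ^ 2 / (4 * W) by positivity)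
    linarith
  have hint : ∫⁻ ω, ENNReal.ofReal (Z ω) ∂P ≤ 2 := by
    rw [lintegral_eq_lintegral_meas_le P (Filter.Eventually.of_forall hZ0) hZm.aemeasurable]
    refine (setLIntegral_mono' measurableSet_Ioi (fun t ht => tail t ht)).trans ?_
    have hder : ∀ t ∈ Set.Ici (0 : ℝ), HasDerivAt (fun t : ℝ => -(1 + t)⁻¹) (1 / (1 + t) ^ 2) t := by
      intro t ht
      have ht : (0 : ℝ) ≤ t := ht
      have h1 : HasDerivAt (fun t : ℝ => 1 + t) 1 t := (hasDerivAt_id t).const_add 1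
      have h2 := (h1.inv (by positivity)).neg
      rwa [neg_div, neg_neg] at h2
    have hlim : Filter.Tendsto (fun t : ℝ => -(1 + t)⁻¹) Filter.atTop (nhds 0) := by
      have := (tendsto_inv_atTop_zero.comp
        (Filter.tendsto_atTop_add_const_left Filter.atTop (1 : ℝ) Filter.tendsto_id)).neg
      simpa using this
    have hI : IntegrableOn (fun t : ℝ => 1 / (1 + t) ^ 2) (Set.Ioi 0) :=
      integrableOn_Ioi_deriv_of_nonneg' hder (fun t _ => by positivity) hlim
    have hV : ∫ t in Set.Ioi (0 : ℝ), 1 / (1 + t) ^ 2 = 1 := by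
      rw [integral_Ioi_of_hasDerivAt_of_nonneg' hder (fun t _ => by positivity) hlim]
      norm_num
    rw [← ofReal_integral_eq_lintegral_ofReal (hI.const_mul 2), integral_const_mul, hV]
    · norm_num
    · filter_upwards [self_mem_ae_restrict measurableSet_Ioi] with t ht
      have : (0 : ℝ) < t := ht
      show (0 : ℝ) ≤ 2 * (1 / (1 + t) ^ 2)
      positivity
  have hpt : ∀ ω, ({ω | |X ω| ≤ s₀}.indicator
      (fun ω => ENNReal.ofReal (Real.exp (X ω ^ 2 / (4 * W)))) ω) ≤ ENNReal.ofReal (Z ω) + 1 := by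
    intro ω
    by_cases hin : ω ∈ {ω | |X ω| ≤ s₀}
    · rw [Set.indicator_of_mem hin, hZ, Set.indicator_of_mem hin,
        ← ENNReal.ofReal_one, ← ENNReal.ofReal_add _ zero_le_one]
      · simp
      · have := Real.one_le_exp (show 0 ≤ X ω ^ 2 / (4 * W) by positivity)
        linarith
    · rw [Set.indicator_of_notMem hin]; exact zero_le
  rw [← lintegral_indicator hms]
  refine (lintegral_mono hpt).trans ?_
  rw [lintegral_add_right _ measurable_const]
  simp only [lintegral_const, measure_univ, mul_one]
  calc _ ≤ (2 : ENNReal) + 1 := by gcongr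
    _ = 3 := by norm_num

/-- Exponential moment of a truncated linear-quadratic form. -/
lemma SubGamma.lintegral_exp_quad_indicator_le [IsProbabilityMeasure P] {σ u w : ℝ}
    (h : SubGamma P X (σ ^ 2 * w) c) (hσ : 0 < σ) (hc : 0 ≤ c) (hu : 0 ≤ u) (hw : 0 ≤ w)
    (hX : Measurable X) (g : ℝ) :
    ∫⁻ ω in {ω | |X ω| ≤ u * w}, ENNReal.ofReal
      (Real.exp ((1 / (2 * σ ^ 2 + 2 * c * u)) * (2 * g * X ω - g ^ 2 * w))) ∂P ≤ 1 := by
  set l := 1 / (2 * σ ^ 2 + 2 * c * u) with hl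
  have hden : 0 < 2 * σ ^ 2 + 2 * c * u := by positivity
  have hl0 : 0 < l := by positivity
  have hms : MeasurableSet {ω | |X ω| ≤ u * w} := measurableSet_le (by fun_prop) measurable_const
  -- the tilt used for the estimate
  obtain ⟨τ, hτg, hτu⟩ : ∃ τ : ℝ, |τ| ≤ u ∧ ∀ x : ℝ, |x| ≤ u * w →
      2 * g * x - g ^ 2 * w ≤ 2 * τ * x - τ ^ 2 * w := by
    -- τ is g clamped to [-u, u]. The concave function τ ↦ 2τx - τ²w is maximal at x/w, which lies
    -- in that interval when |x| ≤ uw, so clamping can only increase it.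
    rcases le_total |g| u with hg | hg
    · exact ⟨g, hg, fun x _ => le_rfl⟩
    · rcases le_total 0 g with hg0 | hg0
      · rw [abs_of_nonneg hg0] at hg
        refine ⟨u, by rw [abs_of_nonneg hu], fun x hx => ?_⟩
        have := (abs_le.1 hx).2
        nlinarith [mul_nonneg (sub_nonneg.2 hg) (sub_nonneg.2 this),
          mul_nonneg (mul_nonneg (sub_nonneg.2 hg) (sub_nonneg.2 hg)) hw]
      · rw [abs_of_nonpos hg0] at hg
        refine ⟨-u, by rw [abs_neg, abs_of_nonneg hu], fun x hx => ?_⟩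
        have := (abs_le.1 hx).1
        nlinarith [mul_nonneg (sub_nonneg.2 hg) (by linarith : 0 ≤ u * w + x),
          mul_nonneg (mul_nonneg (sub_nonneg.2 hg) (sub_nonneg.2 hg)) hw]
  -- This identity dictates the choice of l: the tilt 2lτ with |τ| ≤ u is admissible, and its
  -- log-Laplace bound is at most lτ²w, which the quadratic term cancels.
  have hlc : 1 - 2 * l * u * c = 2 * l * σ ^ 2 := by
    rw [hl]; field_simp; ring
  have habs : |2 * l * τ| = 2 * l * |τ| := by
    rw [abs_mul, abs_of_pos (by positivity)]
  have h1 : 2 * l * σ ^ 2 ≤ 1 - |2 * l * τ| * c := by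
    rw [← hlc, habs]
    have : 2 * l * |τ| * c ≤ 2 * l * u * c := by gcongr
    linarith
  have hpos : 0 < 2 * l * σ ^ 2 := by positivity
  have hmain := h (2 * l * τ) (by linarith)
  have h2 : (2 * l * τ) ^ 2 * (σ ^ 2 * w) / (2 * (1 - |2 * l * τ| * c)) ≤ l * τ ^ 2 * w := by
    rw [div_le_iff₀ (by linarith)]
    have : 0 ≤ l * τ ^ 2 * w := by positivity
    nlinarith
  have hpt : ∀ ω ∈ {ω | |X ω| ≤ u * w}, ENNReal.ofReal
      (Real.exp (l * (2 * g * X ω - g ^ 2 * w))) ≤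
      ENNReal.ofReal (Real.exp (-(l * τ ^ 2 * w))) *
        ENNReal.ofReal (Real.exp (2 * l * τ * X ω)) := by
    intro ω hω
    rw [← ENNReal.ofReal_mul (Real.exp_pos _).le, ← Real.exp_add]
    apply ENNReal.ofReal_le_ofReal (Real.exp_le_exp.2 _)
    have := mul_le_mul_of_nonneg_left (hτu _ hω) hl0.le
    nlinarith
  refine (setLIntegral_mono' hms hpt).trans ((setLIntegral_le_lintegral _ _).trans ?_)
  rw [lintegral_const_mul _ (by fun_prop)]
  refine (mul_le_mul_right (hmain.trans (ENNReal.ofReal_le_ofReal (Real.exp_le_exp.2 h2))) _).trans ?_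
  rw [← ENNReal.ofReal_mul (Real.exp_pos _).le, ← Real.exp_add]
  simp

end SingleVariable

end Histogram
end

noncomputable section
namespace Histogram

/-- A vector of independent centred sub-gamma random variables. -/
structure IndepNoise {Ω : Type*} [MeasurableSpace Ω] (P : Measure Ω) {n : ℕ}
    (X : Fin n → Ω → ℝ) (σ c : ℝ) : Prop where
  measurable : ∀ i, Measurable (X i)
  indep : iIndepFun X P
  subGamma : ∀ i, SubGamma P (X i) (σ ^ 2) c
  mean : ∀ i, ∫ ω, X i ω ∂P = 0

/-! ### Block independence and line-crossing inequalities -/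

section Noise

variable {Ω : Type*} [mΩ : MeasurableSpace Ω] {P : Measure Ω} [IsProbabilityMeasure P] {n : ℕ}
  {X : Fin n → Ω → ℝ} {σ c : ℝ}

/-- The σ-algebra generated by a subfamily of real random variables. -/
abbrev sigmaOf (X : Fin n → Ω → ℝ) (S : Set (Fin n)) : MeasurableSpace Ω :=
  ⨆ i ∈ S, MeasurableSpace.comap (X i) inferInstance

lemma measurable_sigmaOf {S : Set (Fin n)} {i : Fin n} (hi : i ∈ S) :
    Measurable[sigmaOf X S] (X i) := by
  rw [measurable_iff_comap_le]
  exact le_iSup₂_of_le i hi le_rfl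

lemma measurable_sum_sigmaOf {S : Set (Fin n)} {A : Finset (Fin n)} (hA : ∀ i ∈ A, i ∈ S) :
    Measurable[sigmaOf X S] (fun ω => ∑ i ∈ A, X i ω) :=
  Finset.measurable_fun_sum A fun i hi => measurable_sigmaOf (hA i hi)

lemma sigmaOf_le (hX : ∀ i, Measurable (X i)) (S : Set (Fin n)) : sigmaOf X S ≤ mΩ :=
  iSup₂_le fun i _ => (hX i).comap_le

lemma lintegral_mul_of_sigmaOf (hX : ∀ i, Measurable (X i)) (hind : iIndepFun X P)
    {S T : Set (Fin n)} (hST : Disjoint S T) {F G : Ω → ENNReal}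
    (hF : Measurable[sigmaOf X S] F) (hG : Measurable[sigmaOf X T] G) :
    ∫⁻ ω, F ω * G ω ∂P = (∫⁻ ω, F ω ∂P) * ∫⁻ ω, G ω ∂P :=
  lintegral_mul_eq_lintegral_mul_lintegral_of_independent_measurableSpace
    (sigmaOf_le hX S) (sigmaOf_le hX T)
    (indep_iSup_of_disjoint (fun i => (hX i).comap_le) hind hST) hF hG

lemma lintegral_prod_blocks (hX : ∀ i, Measurable (X i)) (hind : iIndepFun X P)
    {κ : Type*} (K : Finset κ) (A : κ → Finset (Fin n))
    (hA : (K : Set κ).PairwiseDisjoint A) (φ : κ → ℝ → ENNReal) (hφ : ∀ k, Measurable (φ k)) :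
    ∫⁻ ω, ∏ k ∈ K, φ k (∑ i ∈ A k, X i ω) ∂P =
      ∏ k ∈ K, ∫⁻ ω, φ k (∑ i ∈ A k, X i ω) ∂P := by
  classical
  induction K using Finset.induction_on with
  | empty => simp
  | insert k K hk ih =>
    simp only [Finset.prod_insert hk]
    rw [← ih (hA.subset (by simp))]
    have hdis : Disjoint ((A k : Finset (Fin n)) : Set (Fin n))
        ((K.biUnion A : Finset (Fin n)) : Set (Fin n)) := by
      rw [Finset.disjoint_coe, Finset.disjoint_biUnion_right]
      intro j hj
      exact hA (by simp) (by simp [hj]) (fun h => hk (h ▸ hj))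
    refine lintegral_mul_of_sigmaOf hX hind hdis ?_ ?_
    · exact (hφ k).comp (measurable_sum_sigmaOf fun i hi => hi)
    · refine Finset.measurable_fun_prod K fun j hj => (hφ j).comp (measurable_sum_sigmaOf ?_)
      intro i hi
      exact Finset.mem_coe.2 (Finset.mem_biUnion.2 ⟨j, hj, hi⟩)

/-- Block sums are sub-gamma. -/
lemma IndepNoise.subGamma_sum (h : IndepNoise P X σ c) (A : Finset (Fin n)) :
    SubGamma P (fun ω => ∑ i ∈ A, X i ω) (σ ^ 2 * A.card) c := by
  intro l hl
  have h1 : ∀ ω, ENNReal.ofReal (Real.exp (l * ∑ i ∈ A, X i ω)) =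
      ∏ i ∈ A, (fun x => ENNReal.ofReal (Real.exp (l * x))) (∑ j ∈ {i}, X j ω) := by
    intro ω
    simp only [Finset.sum_singleton]
    rw [Finset.mul_sum, Real.exp_sum, ENNReal.ofReal_prod_of_nonneg fun i _ => (Real.exp_pos _).le]
  simp_rw [h1]
  rw [lintegral_prod_blocks h.measurable h.indep A (fun i => {i})
    (fun i _ j _ hij => by simpa using hij) (fun _ x => ENNReal.ofReal (Real.exp (l * x)))
    (fun _ => by fun_prop)]
  simp only [Finset.sum_singleton]
  refine (Finset.prod_le_prod' fun i _ => h.subGamma i l hl).trans (le_of_eq ?_)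
  rw [Finset.prod_const, ← ENNReal.ofReal_pow (Real.exp_pos _).le, ← Real.exp_nat_mul]
  congr 2
  ring

lemma IndepNoise.measurable_sum (h : IndepNoise P X σ c) (A : Finset (Fin n)) :
    Measurable fun ω => ∑ i ∈ A, X i ω :=
  Finset.measurable_fun_sum A fun i _ => h.measurable i

lemma SubGamma.integrable_sq {Y : Ω → ℝ} {v : ℝ} (h : SubGamma P Y v c) (hY : Measurable Y)
    (hc : 0 ≤ c) : Integrable (fun ω => Y ω ^ 2) P := by
  refine ⟨(hY.pow_const 2).aestronglyMeasurable, ?_⟩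
  rw [hasFiniteIntegral_iff_ofReal (Filter.Eventually.of_forall fun ω => sq_nonneg _)]
  exact (h.lintegral_sq_le hY hc).trans_lt ENNReal.ofReal_lt_top

lemma SubGamma.memLp {Y : Ω → ℝ} {v : ℝ} (h : SubGamma P Y v c) (hY : Measurable Y)
    (hc : 0 ≤ c) : MemLp Y 2 P :=
  (memLp_two_iff_integrable_sq hY.aestronglyMeasurable).2 (h.integrable_sq hY hc)

lemma SubGamma.integral_sq_le {Y : Ω → ℝ} {v : ℝ} (h : SubGamma P Y v c) (hY : Measurable Y)
    (hc : 0 ≤ c) (hv : 0 ≤ v) : ∫ ω, Y ω ^ 2 ∂P ≤ v := by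
  rw [integral_eq_lintegral_of_nonneg_ae (Filter.Eventually.of_forall fun ω => sq_nonneg _)
    (hY.pow_const 2).aestronglyMeasurable]
  exact ENNReal.toReal_le_of_le_ofReal hv (h.lintegral_sq_le hY hc)

lemma IndepNoise.integrable (h : IndepNoise P X σ c) (hc : 0 ≤ c) (i : Fin n) :
    Integrable (X i) P :=
  ((h.subGamma i).memLp (h.measurable i) hc).integrable (by norm_num)

lemma IndepNoise.integrable_sum_mul (h : IndepNoise P X σ c) (hc : 0 ≤ c) (a : Fin n → ℝ)
    (A : Finset (Fin n)) : Integrable (fun ω => ∑ i ∈ A, a i * X i ω) P :=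
  integrable_finsetSum _ fun i _ => (h.integrable hc i).const_mul _

lemma IndepNoise.integral_sum_mul (h : IndepNoise P X σ c) (hc : 0 ≤ c) (a : Fin n → ℝ)
    (A : Finset (Fin n)) : ∫ ω, ∑ i ∈ A, a i * X i ω ∂P = 0 := by
  rw [integral_finsetSum _ fun i _ => (h.integrable hc i).const_mul _]
  simp [integral_const_mul, h.mean]

/-- Ville's maximal inequality for a product of independent variables. -/
lemma prefix_crossing {Z : Fin n → Ω → ℝ} (hZ : ∀ i, Measurable (Z i)) (hind : iIndepFun Z P)
    (h1 : ∀ i, ∫⁻ ω, ENNReal.ofReal (Real.exp (Z i ω)) ∂P ≤ 1) (t : ℝ) :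
    P {ω | ∃ k : ℕ, t ≤ ∑ i with i.val < k, Z i ω} ≤ ENNReal.ofReal (Real.exp (-t)) := by
  classical
  set A : ℕ → Set Ω := fun k => {ω | ∃ j ≤ k, t ≤ ∑ i with i.val < j, Z i ω} with hA
  set M : ℕ → Ω → ENNReal := fun k ω => ENNReal.ofReal (Real.exp (∑ i with i.val < k, Z i ω))
    with hM
  have hAk : ∀ k, MeasurableSet[sigmaOf Z {i | i.val < k}] (A k) := by
    intro k
    have : A k = ⋃ j ∈ Set.Iic k, {ω | t ≤ ∑ i with i.val < j, Z i ω} := by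
      ext ω; simp [hA]
    rw [this]
    refine MeasurableSet.biUnion (Set.to_countable _) fun j hj => ?_
    have hj : j ≤ k := hj
    refine (measurable_sum_sigmaOf (X := Z) (S := {i | i.val < k}) ?_) measurableSet_Ici
    intro i hi
    simp only [Finset.mem_filter, Finset.mem_univ, true_and] at hi
    exact lt_of_lt_of_le hi hj
  have hAm : ∀ k, MeasurableSet (A k) := fun k => sigmaOf_le hZ _ _ (hAk k)
  have hMk : ∀ k, Measurable[sigmaOf Z {i | i.val < k}] (M k) := by
    intro k
    refine ENNReal.measurable_ofReal.comp (Real.measurable_exp.comp (measurable_sum_sigmaOf ?_))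
    intro i hi
    simpa using hi
  have hMm : ∀ k, Measurable (M k) := fun k => (hMk k).mono (sigmaOf_le hZ _) le_rfl
  -- The stopped supermartingale written without stopping times. Before crossing, the next factor is
  -- independent of the past and has mean at most 1; on the paths that cross exactly at step k + 1,
  -- M is at least e^t, which pays for the growth of P(A).
  have key : ∀ k, ∫⁻ ω in (A k)ᶜ, M k ω ∂P + ENNReal.ofReal (Real.exp t) * P (A k) ≤ 1 := by
    intro k
    induction k with
    | zero =>
      have hM0 : ∀ ω, M 0 ω = 1 := by intro ω; simp [hM]
      simp only [hM0, lintegral_const, Measure.restrict_apply MeasurableSet.univ, Set.univ_inter,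
        one_mul]
      by_cases ht : t ≤ 0
      · have h2 : A 0 = Set.univ := by ext ω; simp [hA, ht]
        rw [h2]
        simpa using ht
      · have h2 : A 0 = ∅ := by ext ω; simp [hA, ht]
        rw [h2]; simp
    | succ k ih =>
      have hmono : A k ⊆ A (k + 1) := fun ω ⟨j, hj, h⟩ => ⟨j, hj.trans (Nat.le_succ k), h⟩
      have hstep : ∫⁻ ω in (A k)ᶜ, M (k + 1) ω ∂P ≤ ∫⁻ ω in (A k)ᶜ, M k ω ∂P := by
        by_cases hk : k < n
        · have e1 : ∀ ω, M (k + 1) ω = M k ω * ENNReal.ofReal (Real.exp (Z ⟨k, hk⟩ ω)) := by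
            intro ω
            have e2 : (Finset.univ.filter fun i : Fin n => i.val < k + 1) =
                insert ⟨k, hk⟩ (Finset.univ.filter fun i : Fin n => i.val < k) := by
              ext i
              simp only [Finset.mem_filter, Finset.mem_univ, true_and, Finset.mem_insert,
                Fin.ext_iff]
              omega
            simp only [hM]
            rw [e2, Finset.sum_insert (by simp), add_comm, Real.exp_add,
              ENNReal.ofReal_mul (Real.exp_pos _).le]
          rw [← lintegral_indicator (hAm k).compl, ← lintegral_indicator (hAm k).compl]
          have e3 : ∀ ω, (A k)ᶜ.indicator (M (k + 1)) ω =
              (A k)ᶜ.indicator (M k) ω * ENNReal.ofReal (Real.exp (Z ⟨k, hk⟩ ω)) := by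
            intro ω
            by_cases hω : ω ∈ (A k)ᶜ
            · rw [Set.indicator_of_mem hω, Set.indicator_of_mem hω, e1]
            · rw [Set.indicator_of_notMem hω, Set.indicator_of_notMem hω, zero_mul]
          have e4 := lintegral_mul_of_sigmaOf (P := P) hZ hind
            (S := {i | i.val < k}) (T := {⟨k, hk⟩}) (by simp)
            (F := (A k)ᶜ.indicator (M k))
            (G := fun ω => ENNReal.ofReal (Real.exp (Z ⟨k, hk⟩ ω)))
            (Measurable.indicator (hMk k) (hAk k).compl)
            (ENNReal.measurable_ofReal.comp (Real.measurable_exp.comp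
              (measurable_sigmaOf rfl)))
          calc _ = ∫⁻ ω, (A k)ᶜ.indicator (M k) ω *
                ENNReal.ofReal (Real.exp (Z ⟨k, hk⟩ ω)) ∂P := lintegral_congr e3
            _ ≤ (∫⁻ ω, (A k)ᶜ.indicator (M k) ω ∂P) * 1 := by
                rw [e4]; exact mul_le_mul_right (h1 _) _
            _ = _ := by rw [mul_one]
        · have e2 : (Finset.univ.filter fun i : Fin n => i.val < k + 1) =
              (Finset.univ.filter fun i : Fin n => i.val < k) := by
            ext i
            have := i.isLt
            simp only [Finset.mem_filter, Finset.mem_univ, true_and]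
            omega
          simp only [hM]
          rw [e2]
      have hsplit : ∫⁻ ω in (A k)ᶜ, M (k + 1) ω ∂P =
          ∫⁻ ω in (A (k + 1))ᶜ, M (k + 1) ω ∂P + ∫⁻ ω in A (k + 1) \ A k, M (k + 1) ω ∂P := by
        rw [← lintegral_union ((hAm (k + 1)).diff (hAm k))]
        · congr 2
          ext ω
          have := @hmono ω
          simp only [Set.mem_compl_iff, Set.mem_union, Set.mem_sdiff]
          tauto
        · rw [Set.disjoint_left]
          rintro ω h2 ⟨h3, _⟩
          exact h2 h3
      have hlow : ENNReal.ofReal (Real.exp t) * P (A (k + 1) \ A k) ≤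
          ∫⁻ ω in A (k + 1) \ A k, M (k + 1) ω ∂P := by
        rw [← setLIntegral_const]
        refine setLIntegral_mono' ((hAm (k + 1)).diff (hAm k)) ?_
        rintro ω ⟨⟨j, hj, h2⟩, h3⟩
        have hj' : j = k + 1 := by
          by_contra hne
          exact h3 ⟨j, by omega, h2⟩
        subst hj'
        exact ENNReal.ofReal_le_ofReal (Real.exp_le_exp.2 h2)
      have hP : P (A (k + 1)) ≤ P (A k) + P (A (k + 1) \ A k) := by
        refine (measure_mono ?_).trans (measure_union_le _ _)
        intro ω hω
        by_cases h2 : ω ∈ A k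
        · exact Or.inl h2
        · exact Or.inr ⟨hω, h2⟩
      calc _ ≤ ∫⁻ ω in (A (k + 1))ᶜ, M (k + 1) ω ∂P +
            ENNReal.ofReal (Real.exp t) * (P (A k) + P (A (k + 1) \ A k)) := by gcongr
        _ ≤ ∫⁻ ω in (A (k + 1))ᶜ, M (k + 1) ω ∂P + (ENNReal.ofReal (Real.exp t) * P (A k)
            + ∫⁻ ω in A (k + 1) \ A k, M (k + 1) ω ∂P) := by rw [mul_add]; gcongr
        _ = ∫⁻ ω in (A k)ᶜ, M (k + 1) ω ∂P + ENNReal.ofReal (Real.exp t) * P (A k) := by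
            rw [hsplit]; ring
        _ ≤ _ := (add_le_add hstep le_rfl).trans ih
  have hfin : {ω | ∃ k : ℕ, t ≤ ∑ i with i.val < k, Z i ω} ⊆ A n := by
    rintro ω ⟨k, hk⟩
    rcases le_total k n with h | h
    · exact ⟨k, h, hk⟩
    · refine ⟨n, le_rfl, ?_⟩
      have : (Finset.univ.filter fun i : Fin n => i.val < k) =
          (Finset.univ.filter fun i : Fin n => i.val < n) := by
        ext i
        have := i.isLt
        simp only [Finset.mem_filter, Finset.mem_univ, true_and]
        omega
      rwa [this] at hk
  have h2 : ENNReal.ofReal (Real.exp t) * P (A n) ≤ 1 := le_add_self.trans (key n)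
  have h4 : ENNReal.ofReal (Real.exp (-t)) * (ENNReal.ofReal (Real.exp t) * P (A n)) = P (A n) := by
    rw [← mul_assoc, ← ENNReal.ofReal_mul (Real.exp_pos _).le, ← Real.exp_add]
    simp
  calc _ ≤ P (A n) := measure_mono hfin
    _ = _ := h4.symm
    _ ≤ ENNReal.ofReal (Real.exp (-t)) * 1 := mul_le_mul_right h2 _
    _ = _ := mul_one _

/-- Reversing the order of the indices preserves independence and exchanges suffixes with prefixes.
-/
lemma suffix_crossing {Z : Fin n → Ω → ℝ} (hZ : ∀ i, Measurable (Z i)) (hind : iIndepFun Z P)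
    (h1 : ∀ i, ∫⁻ ω, ENNReal.ofReal (Real.exp (Z i ω)) ∂P ≤ 1) (t : ℝ) :
    P {ω | ∃ k : ℕ, t ≤ ∑ i with k ≤ i.val, Z i ω} ≤ ENNReal.ofReal (Real.exp (-t)) := by
  have := prefix_crossing (P := P) (Z := fun i => Z (Fin.rev i)) (fun i => hZ _)
    (hind.precomp Fin.rev_injective) (fun i => h1 _) t
  refine (measure_mono ?_).trans this
  rintro ω ⟨k, hk⟩
  refine ⟨n - k, ?_⟩
  convert hk using 1
  refine Finset.sum_nbij' Fin.rev Fin.rev ?_ ?_ ?_ ?_ ?_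
  · intro i hi
    simp only [Finset.mem_filter, Finset.mem_univ, true_and, Fin.val_rev] at hi ⊢
    have := i.isLt
    omega
  · intro i hi
    simp only [Finset.mem_filter, Finset.mem_univ, true_and, Fin.val_rev] at hi ⊢
    have := i.isLt
    omega
  · simp
  · simp
  · simp

/-- The affine increments used for line crossing, restricted to a block. -/
lemma IndepNoise.affine_increments (h : IndepNoise P X σ c) (A : Finset (Fin n)) {θ ψ : ℝ}
    (hθ : |θ| * c < 1) (hψ : θ ^ 2 * σ ^ 2 / (2 * (1 - |θ| * c)) ≤ ψ) :
    (∀ i, Measurable fun ω => if i ∈ A then θ * X i ω - ψ else 0) ∧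
    iIndepFun (fun i ω => if i ∈ A then θ * X i ω - ψ else 0) P ∧
    ∀ i, ∫⁻ ω, ENNReal.ofReal (Real.exp (if i ∈ A then θ * X i ω - ψ else 0)) ∂P ≤ 1 := by
  have hX := h.measurable
  refine ⟨?_, ?_, ?_⟩
  · intro i
    by_cases hi : i ∈ A
    · simp only [hi, if_true]; have := hX i; fun_prop
    · simp only [hi, if_false]; exact measurable_const
  · exact h.indep.comp (fun i x => if i ∈ A then θ * x - ψ else 0) (fun i => by
      by_cases hi : i ∈ A
      · simp only [hi, if_true]; fun_prop
      · simp only [hi, if_false]; exact measurable_const)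
  · intro i
    by_cases hi : i ∈ A
    · simp only [hi, if_true]
      have e : ∀ ω, ENNReal.ofReal (Real.exp (θ * X i ω - ψ)) =
          ENNReal.ofReal (Real.exp (-ψ)) * ENNReal.ofReal (Real.exp (θ * X i ω)) := by
        intro ω
        rw [← ENNReal.ofReal_mul (Real.exp_pos _).le, ← Real.exp_add]
        ring_nf
      simp_rw [e]
      rw [lintegral_const_mul _ (by have := hX i; fun_prop)]
      refine (mul_le_mul_right (h.subGamma i θ hθ) _).trans ?_
      rw [← ENNReal.ofReal_mul (Real.exp_pos _).le, ← Real.exp_add, ENNReal.ofReal_le_one,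
        Real.exp_le_one_iff]
      linarith
    · simp [hi]

/-- All the prefixes of a block stay below one line simultaneously, for the price of a single
exponential bound. There is no union bound, hence no logarithm of the block length later on. -/
lemma IndepNoise.prefix_crossing (h : IndepNoise P X σ c) (A : Finset (Fin n)) {θ ψ : ℝ}
    (hθ : |θ| * c < 1) (hψ : θ ^ 2 * σ ^ 2 / (2 * (1 - |θ| * c)) ≤ ψ) (t : ℝ) :
    P {ω | ∃ k : ℕ, t ≤ θ * (∑ i ∈ A with i.val < k, X i ω) -
      ψ * (A.filter fun i => i.val < k).card} ≤ ENNReal.ofReal (Real.exp (-t)) := by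
  obtain ⟨h1, h2, h3⟩ := h.affine_increments A hθ hψ
  refine le_trans (measure_mono ?_) (Histogram.prefix_crossing h1 h2 h3 t)
  rintro ω ⟨k, hk⟩
  refine ⟨k, hk.trans (le_of_eq ?_)⟩
  have e : (Finset.univ.filter fun i : Fin n => i.val < k).filter (fun i => i ∈ A) =
      A.filter fun i => i.val < k := by
    ext i; simp [and_comm]
  rw [← Finset.sum_filter, e, Finset.sum_sub_distrib, ← Finset.mul_sum,
    Finset.sum_const, nsmul_eq_mul, mul_comm (Nat.cast _) ψ]

lemma IndepNoise.suffix_crossing (h : IndepNoise P X σ c) (A : Finset (Fin n)) {θ ψ : ℝ}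
    (hθ : |θ| * c < 1) (hψ : θ ^ 2 * σ ^ 2 / (2 * (1 - |θ| * c)) ≤ ψ) (t : ℝ) :
    P {ω | ∃ k : ℕ, t ≤ θ * (∑ i ∈ A with k ≤ i.val, X i ω) -
      ψ * (A.filter fun i => k ≤ i.val).card} ≤ ENNReal.ofReal (Real.exp (-t)) := by
  obtain ⟨h1, h2, h3⟩ := h.affine_increments A hθ hψ
  refine le_trans (measure_mono ?_) (Histogram.suffix_crossing h1 h2 h3 t)
  rintro ω ⟨k, hk⟩
  refine ⟨k, hk.trans (le_of_eq ?_)⟩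
  have e : (Finset.univ.filter fun i : Fin n => k ≤ i.val).filter (fun i => i ∈ A) =
      A.filter fun i => k ≤ i.val := by
    ext i; simp [and_comm]
  rw [← Finset.sum_filter, e, Finset.sum_sub_distrib, ← Finset.mul_sum,
    Finset.sum_const, nsmul_eq_mul, mul_comm (Nat.cast _) ψ]

end Noise

end Histogram
end

noncomputable section
namespace Histogram

/-! ### Variance identities and the inequality on one interval -/

section Averages

variable {ι : Type*}

/-- The average of `h` over a finite set. -/
def avg (A : Finset ι) (h : ι → ℝ) : ℝ := (∑ i ∈ A, h i) / A.card

lemma card_mul_avg (A : Finset ι) (h : ι → ℝ) : (A.card : ℝ) * avg A h = ∑ i ∈ A, h i := by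
  rcases A.eq_empty_or_nonempty with rfl | hA
  · simp
  · have : (A.card : ℝ) ≠ 0 := by exact_mod_cast hA.card_ne_zero
    rw [avg]; field_simp

lemma sum_sub_avg (A : Finset ι) (h : ι → ℝ) : ∑ i ∈ A, (h i - avg A h) = 0 := by
  rw [Finset.sum_sub_distrib, Finset.sum_const, nsmul_eq_mul, card_mul_avg, sub_self]

lemma sum_sq_sub_const (A : Finset ι) (h : ι → ℝ) (v : ℝ) :
    ∑ i ∈ A, (h i - v) ^ 2 = ∑ i ∈ A, (h i - avg A h) ^ 2 + A.card * (avg A h - v) ^ 2 := by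
  have h0 := sum_sub_avg A h
  have : ∀ i, (h i - v) ^ 2 = (h i - avg A h) ^ 2 + 2 * (avg A h - v) * (h i - avg A h)
      + (avg A h - v) ^ 2 := fun i => by ring
  simp_rw [this]
  rw [Finset.sum_add_distrib, Finset.sum_add_distrib, ← Finset.mul_sum, h0]
  simp

lemma sum_sq_sub_avg_le (A : Finset ι) (h : ι → ℝ) (v : ℝ) :
    ∑ i ∈ A, (h i - avg A h) ^ 2 ≤ ∑ i ∈ A, (h i - v) ^ 2 := by
  rw [sum_sq_sub_const A h v]
  have : (0 : ℝ) ≤ A.card * (avg A h - v) ^ 2 := by positivity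
  linarith

lemma card_mul_avg_sub_sq_le (A : Finset ι) (h : ι → ℝ) (v : ℝ) :
    A.card * (avg A h - v) ^ 2 ≤ ∑ i ∈ A, (h i - v) ^ 2 := by
  rw [sum_sq_sub_const A h v]
  have : (0 : ℝ) ≤ ∑ i ∈ A, (h i - avg A h) ^ 2 := by positivity
  linarith

/-- Sum of squares about the mean as a double sum. -/
lemma double_sum_sq (A : Finset ι) (h : ι → ℝ) :
    ∑ i ∈ A, ∑ j ∈ A, (h i - h j) ^ 2 = 2 * (A.card * ∑ i ∈ A, (h i - avg A h) ^ 2) := by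
  have : ∀ i, ∑ j ∈ A, (h i - h j) ^ 2 =
      ∑ j ∈ A, (h j - avg A h) ^ 2 + A.card * (h i - avg A h) ^ 2 := by
    intro i
    have := sum_sq_sub_const A h (h i)
    rw [Finset.sum_congr rfl fun j _ => show (h i - h j) ^ 2 = (h j - h i) ^ 2 by ring, this]
    ring
  simp_rw [this]
  rw [Finset.sum_add_distrib, ← Finset.mul_sum, Finset.sum_const, nsmul_eq_mul]
  ring

end Averages

set_option maxHeartbeats 800000 in
/-- The basic inequality for one interval `J ∪ F ∪ J'` meeting several cells of a reference
segmentation: `G` is the piecewise mean, `r` the residual, `F` the union of the full cells. -/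
lemma interval_bound {ι : Type*} [DecidableEq ι] {J F J' : Finset ι} (hJF : Disjoint J F)
    (hJJ : Disjoint J J') (hFJ : Disjoint F J') (hJ : J.Nonempty) (hJ' : J'.Nonempty)
    {h x r G xt : ι → ℝ} (hh : ∀ i, h i = G i + r i) {μ μ' : ℝ} (hGJ : ∀ i ∈ J, G i = μ)
    (hGJ' : ∀ i ∈ J', G i = μ')
    (hFr : ∑ i ∈ F, r i = 0) (hFrG : ∑ i ∈ F, r i * G i = 0)
    (hFx : ∑ i ∈ F, x i = ∑ i ∈ F, xt i) (hFxG : ∑ i ∈ F, x i * G i = ∑ i ∈ F, xt i * G i)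
    {b₀ : ℝ} (hb₀ : (∑ i ∈ J, r i) ^ 2 ≤ b₀ * J.card) (hb₀' : (∑ i ∈ J', r i) ^ 2 ≤ b₀ * J'.card)
    {C H : ℝ}
    (hC : ∀ i ∈ F, (2 * (μ - G i) * (∑ j ∈ J, x j) - 2 / 5 * (μ - G i) ^ 2 * J.card) +
      (2 * (μ' - G i) * (∑ j ∈ J', x j) - 2 / 5 * (μ' - G i) ^ 2 * J'.card) ≤ C)
    (hC1 : 2 * (μ - μ') * (∑ j ∈ J, x j) - 1 / 5 * (μ - μ') ^ 2 * J.card ≤ C)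
    (hC2 : 2 * (μ' - μ) * (∑ j ∈ J', x j) - 1 / 5 * (μ' - μ) ^ 2 * J'.card ≤ C)
    (hH : 2 * |∑ i ∈ J ∪ F ∪ J', r i| * (|∑ i ∈ J, x i| + |∑ i ∈ J', x i|) ≤
      H * (J ∪ F ∪ J').card) :
    2 * ∑ i ∈ J ∪ F ∪ J', (h i - avg (J ∪ F ∪ J') h) * x i ≤
      2 * ∑ i ∈ J ∪ F ∪ J', r i * x i + 5 * ∑ i ∈ F, xt i ^ 2
      + 7 / 10 * ∑ i ∈ J ∪ F ∪ J', (h i - avg (J ∪ F ∪ J') h) ^ 2 + 4 * b₀ + C + H := by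
  set I := J ∪ F ∪ J' with hI
  have hdis : Disjoint (J ∪ F) J' := Finset.disjoint_union_left.2 ⟨hJJ, hFJ⟩
  have hsum : ∀ φ : ι → ℝ, ∑ i ∈ I, φ i = ∑ i ∈ J, φ i + ∑ i ∈ F, φ i + ∑ i ∈ J', φ i := by
    intro φ
    rw [hI, Finset.sum_union hdis, Finset.sum_union hJF]
  have hcard : (I.card : ℝ) = J.card + F.card + J'.card := by
    rw [hI, Finset.card_union_of_disjoint hdis, Finset.card_union_of_disjoint hJF]; push_cast; ring
  have hJ0 : (0 : ℝ) < J.card := by exact_mod_cast hJ.card_pos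
  have hJ'0 : (0 : ℝ) < J'.card := by exact_mod_cast hJ'.card_pos
  have hI0 : (0 : ℝ) < I.card := by rw [hcard]; positivity
  set hb := avg I h with hhb
  set ν := avg I G with hν
  set R := ∑ i ∈ I, r i with hR
  set S := ∑ i ∈ J, x i with hS
  set S' := ∑ i ∈ J', x i with hS'
  set D := ∑ i ∈ I, (h i - hb) ^ 2 with hD
  -- averages
  have hbν : (I.card : ℝ) * hb = I.card * ν + R := by
    rw [hhb, hν, card_mul_avg, card_mul_avg, hR, ← Finset.sum_add_distrib]
    exact Finset.sum_congr rfl fun i _ => hh i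
  -- Jensen on the three pieces
  have hDF : ∑ i ∈ F, (G i - hb) ^ 2 ≤ ∑ i ∈ F, (h i - hb) ^ 2 := by
    have e : ∑ i ∈ F, (h i - hb) ^ 2 = ∑ i ∈ F, (G i - hb) ^ 2 + ∑ i ∈ F, r i ^ 2
        + 2 * ∑ i ∈ F, r i * G i - 2 * hb * ∑ i ∈ F, r i := by
      rw [Finset.mul_sum, Finset.mul_sum, ← Finset.sum_add_distrib, ← Finset.sum_add_distrib,
        ← Finset.sum_sub_distrib]
      exact Finset.sum_congr rfl fun i _ => by rw [hh]; ring
    rw [e, hFr, hFrG]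
    have : (0 : ℝ) ≤ ∑ i ∈ F, r i ^ 2 := by positivity
    linarith
  have piece : ∀ (A : Finset ι) (m : ℝ), (0 : ℝ) < A.card → (∀ i ∈ A, G i = m) →
      (∑ i ∈ A, r i) ^ 2 ≤ b₀ * A.card →
      A.card * (m - hb) ^ 2 ≤ 5 / 4 * ∑ i ∈ A, (h i - hb) ^ 2 + 5 * b₀ := by
    intro A m hA hGA hbA
    have h1 := card_mul_avg_sub_sq_le A h hb
    have h2 : (A.card : ℝ) * avg A h = A.card * m + ∑ i ∈ A, r i := by
      rw [card_mul_avg, Finset.sum_congr rfl fun i hi => show h i = m + r i by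
        rw [hh, hGA i hi], Finset.sum_add_distrib, Finset.sum_const, nsmul_eq_mul]
    set q := (∑ i ∈ A, r i) with hq
    have h3 : avg A h = m + q / A.card := by field_simp; linarith
    have h4 : A.card * (q / A.card) ^ 2 ≤ b₀ := by
      have : (A.card : ℝ) * (q / A.card) ^ 2 = q ^ 2 / A.card := by field_simp
      rw [this, div_le_iff₀ hA]; exact hbA
    rw [h3] at h1
    -- With d = m - hb and e = q/|A|, the identity is 5/4 (d + e)² + 5e² - d² = (d + 5e)²/4; the
    -- term |A|e² is at most b₀.
    nlinarith [mul_nonneg hA.le (sq_nonneg ((m - hb) + 5 * (q / A.card)))]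
  have hpJ := piece J μ hJ0 hGJ hb₀
  have hpJ' := piece J' μ' hJ'0 hGJ' hb₀'
  have hDsplit := hsum fun i => (h i - hb) ^ 2
  -- the variance of `G`
  set DG := ∑ i ∈ I, (G i - ν) ^ 2 with hDG
  have hDG1 : DG ≤ 5 / 4 * D + 10 * b₀ := by
    have h1 := sum_sq_sub_avg_le I G hb
    have h2 := hsum fun i => (G i - hb) ^ 2
    have h3 : ∑ i ∈ J, (G i - hb) ^ 2 = J.card * (μ - hb) ^ 2 := by
      rw [Finset.sum_congr rfl fun i hi => show (G i - hb) ^ 2 = (μ - hb) ^ 2 by rw [hGJ i hi]]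
      simp
    have h4 : ∑ i ∈ J', (G i - hb) ^ 2 = J'.card * (μ' - hb) ^ 2 := by
      rw [Finset.sum_congr rfl fun i hi => show (G i - hb) ^ 2 = (μ' - hb) ^ 2 by rw [hGJ' i hi]]
      simp
    have h5 : (0 : ℝ) ≤ ∑ i ∈ F, (h i - hb) ^ 2 := by positivity
    rw [← hν, ← hDG] at h1
    linarith
  -- lower bound by pairs
  have hpairs : ∑ i ∈ F, (J.card * (μ - G i) ^ 2 + J'.card * (μ' - G i) ^ 2) +
      J.card * J'.card * (μ - μ') ^ 2 ≤ I.card * DG := by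
    have hdd := double_sum_sq I G
    rw [← hν, ← hDG] at hdd
    set PF := ∑ i ∈ F, (J.card * (μ - G i) ^ 2 + J'.card * (μ' - G i) ^ 2) with hPF
    have e1 : ∑ i ∈ J, ∑ j ∈ I, (G i - G j) ^ 2 = J.card * (∑ j ∈ F, (μ - G j) ^ 2)
        + J.card * J'.card * (μ - μ') ^ 2 := by
      have : ∀ i ∈ J, ∑ j ∈ I, (G i - G j) ^ 2 = ∑ j ∈ F, (μ - G j) ^ 2
          + J'.card * (μ - μ') ^ 2 := by
        intro i hi
        rw [hsum, hGJ i hi,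
          Finset.sum_congr rfl fun j hj => show (μ - G j) ^ 2 = 0 by rw [hGJ j hj]; ring,
          Finset.sum_congr (s₁ := J') rfl fun j hj => show (μ - G j) ^ 2 = (μ - μ') ^ 2 by
            rw [hGJ' j hj]]
        simp
      rw [Finset.sum_congr rfl this, Finset.sum_const, nsmul_eq_mul]
      ring
    have e2 : ∑ i ∈ J', ∑ j ∈ I, (G i - G j) ^ 2 = J'.card * (∑ j ∈ F, (μ' - G j) ^ 2)
        + J.card * J'.card * (μ - μ') ^ 2 := by
      have : ∀ i ∈ J', ∑ j ∈ I, (G i - G j) ^ 2 = ∑ j ∈ F, (μ' - G j) ^ 2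
          + J.card * (μ - μ') ^ 2 := by
        intro i hi
        rw [hsum, hGJ' i hi,
          Finset.sum_congr (s₁ := J') rfl fun j hj => show (μ' - G j) ^ 2 = 0 by
            rw [hGJ' j hj]; ring,
          Finset.sum_congr (s₁ := J) rfl fun j hj => show (μ' - G j) ^ 2 = (μ - μ') ^ 2 by
            rw [hGJ j hj]; ring]
        simp [add_comm]
      rw [Finset.sum_congr rfl this, Finset.sum_const, nsmul_eq_mul]
      ring
    have e3 : PF ≤ ∑ i ∈ F, ∑ j ∈ I, (G i - G j) ^ 2 := by
      refine Finset.sum_le_sum fun i _ => ?_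
      rw [hsum,
        Finset.sum_congr (s₁ := J') rfl fun j hj => show (G i - G j) ^ 2 = (μ' - G i) ^ 2 by
            rw [hGJ' j hj]; ring,
        Finset.sum_congr (s₁ := J) rfl fun j hj => show (G i - G j) ^ 2 = (μ - G i) ^ 2 by
            rw [hGJ j hj]; ring]
      have : (0 : ℝ) ≤ ∑ j ∈ F, (G i - G j) ^ 2 := by positivity
      simp only [Finset.sum_const, nsmul_eq_mul]
      linarith
    have e4 : PF = J.card * (∑ j ∈ F, (μ - G j) ^ 2) + J'.card * (∑ j ∈ F, (μ' - G j) ^ 2) := by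
      rw [hPF, Finset.sum_add_distrib, Finset.mul_sum, Finset.mul_sum]
    have e5 := hsum fun i => ∑ j ∈ I, (G i - G j) ^ 2
    linarith
  -- the partial cells
  have hpart : 2 * (μ - ν) * S + 2 * (μ' - ν) * S' ≤ 2 / 5 * DG + C := by
    have hIν : (I.card : ℝ) * ν = J.card * μ + ∑ i ∈ F, G i + J'.card * μ' := by
      rw [hν, card_mul_avg, hsum, Finset.sum_congr rfl hGJ, Finset.sum_congr (s₁ := J') rfl hGJ']
      simp
    -- After multiplication by |I|, the deviation from the mean ν becomes a sum of differences over
    -- pairs of points. Each pair then has its own quadratic term in |I|·DG, so a bound is needed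
    -- only for each fixed difference of levels. The pair formed by the two end pieces is split in
    -- two halves, hence 1/5 there and 2/5 elsewhere.
    have e1 : (I.card : ℝ) * (2 * (μ - ν) * S + 2 * (μ' - ν) * S') =
        ∑ i ∈ F, (2 * (μ - G i) * S + 2 * (μ' - G i) * S') +
        J'.card * (2 * (μ - μ') * S) + J.card * (2 * (μ' - μ) * S') := by
      have : ∑ i ∈ F, (2 * (μ - G i) * S + 2 * (μ' - G i) * S') =
          F.card * (2 * μ * S + 2 * μ' * S') - (2 * S + 2 * S') * ∑ i ∈ F, G i := by
        rw [Finset.sum_congr rfl fun i _ => show 2 * (μ - G i) * S + 2 * (μ' - G i) * S' =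
          (2 * μ * S + 2 * μ' * S') - (2 * S + 2 * S') * G i by ring, Finset.sum_sub_distrib,
          Finset.sum_const, nsmul_eq_mul, ← Finset.mul_sum]
      rw [this]
      linear_combination (2 * μ * S + 2 * μ' * S') * hcard - (2 * S + 2 * S') * hIν
    have e2 : ∑ i ∈ F, (2 * (μ - G i) * S + 2 * (μ' - G i) * S') ≤
        F.card * C + 2 / 5 * ∑ i ∈ F, (J.card * (μ - G i) ^ 2 + J'.card * (μ' - G i) ^ 2) := by
      rw [Finset.mul_sum, ← nsmul_eq_mul, ← Finset.sum_const, ← Finset.sum_add_distrib]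
      refine Finset.sum_le_sum fun i hi => ?_
      linarith [hC i hi]
    have e3 := mul_le_mul_of_nonneg_left hC1 hJ'0.le
    have e4 := mul_le_mul_of_nonneg_left hC2 hJ0.le
    have e5 : (I.card : ℝ) * (2 * (μ - ν) * S + 2 * (μ' - ν) * S') ≤
        I.card * (2 / 5 * DG + C) := by
      have e6 : (I.card : ℝ) * C = J.card * C + F.card * C + J'.card * C := by rw [hcard]; ring
      rw [e1]
      linarith
    exact le_of_mul_le_mul_left e5 hI0
  -- the full cells
  have hfull : 2 * ∑ i ∈ F, (G i - hb) * x i ≤ 1 / 5 * D + 5 * ∑ i ∈ F, xt i ^ 2 := by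
    have e1 : ∑ i ∈ F, (G i - hb) * x i = ∑ i ∈ F, (G i - hb) * xt i := by
      have : ∀ y : ι → ℝ, ∑ i ∈ F, (G i - hb) * y i = ∑ i ∈ F, y i * G i - hb * ∑ i ∈ F, y i := by
        intro y
        rw [Finset.mul_sum, ← Finset.sum_sub_distrib]
        exact Finset.sum_congr rfl fun i _ => by ring
      rw [this, this, hFx, hFxG]
    rw [e1]
    have e2 : 2 * ∑ i ∈ F, (G i - hb) * xt i ≤ 1 / 5 * ∑ i ∈ F, (G i - hb) ^ 2
        + 5 * ∑ i ∈ F, xt i ^ 2 := by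
      rw [Finset.mul_sum, Finset.mul_sum, Finset.mul_sum, ← Finset.sum_add_distrib]
      refine Finset.sum_le_sum fun i _ => ?_
      nlinarith [sq_nonneg ((G i - hb) - 5 * xt i)]
    have h3 : (0 : ℝ) ≤ ∑ i ∈ J, (h i - hb) ^ 2 := by positivity
    have h4 : (0 : ℝ) ≤ ∑ i ∈ J', (h i - hb) ^ 2 := by positivity
    linarith
  -- the correction by the mean of the residuals
  have hcorr : -(2 * (R / I.card) * (S + S')) ≤ H := by
    have h1 : -(2 * (R / I.card) * (S + S')) ≤ 2 * |R| * (|S| + |S'|) / I.card := by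
      have : -(2 * (R / I.card) * (S + S')) = (2 * (-R * (S + S'))) / I.card := by ring
      rw [this]
      refine div_le_div_of_nonneg_right ?_ hI0.le
      calc 2 * (-R * (S + S')) ≤ 2 * (|R| * |S + S'|) := by
            have := neg_abs_le (R * (S + S'))
            rw [abs_mul] at this
            linarith
        _ ≤ 2 * (|R| * (|S| + |S'|)) := by
            gcongr
            exact abs_add_le _ _
        _ = 2 * |R| * (|S| + |S'|) := by ring
    exact h1.trans ((div_le_iff₀ hI0).2 hH)
  have hbν' : hb = ν + R / I.card := by field_simp; linarith
  have hmain : ∑ i ∈ I, (h i - hb) * x i = ∑ i ∈ I, r i * x i + ∑ i ∈ F, (G i - hb) * x i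
      + (μ - hb) * S + (μ' - hb) * S' := by
    have e1 : ∑ i ∈ I, (h i - hb) * x i = ∑ i ∈ I, r i * x i + ∑ i ∈ I, (G i - hb) * x i := by
      rw [← Finset.sum_add_distrib]
      exact Finset.sum_congr rfl fun i _ => by rw [hh]; ring
    rw [e1, hsum fun i => (G i - hb) * x i,
      Finset.sum_congr rfl fun i hi => show (G i - hb) * x i = (μ - hb) * x i by rw [hGJ i hi],
      Finset.sum_congr (s₁ := J') rfl fun i hi => show (G i - hb) * x i = (μ' - hb) * x i by
        rw [hGJ' i hi], ← Finset.mul_sum, ← Finset.mul_sum]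
    ring
  have e7 : 2 * (μ - hb) * S + 2 * (μ' - hb) * S' = 2 * (μ - ν) * S + 2 * (μ' - ν) * S'
      - 2 * (R / I.card) * (S + S') := by rw [hbν']; ring
  linarith

end Histogram
end

noncomputable section
namespace Histogram

/-! ### Segmentations as monotone labelings, and the optimal one -/

section Labelings

variable {n : ℕ}

/-- The fibre of a labeling over the label `k`. -/
def cell (g : Fin n → ℕ) (k : ℕ) : Finset (Fin n) := Finset.univ.filter fun i => g i = k

@[simp] lemma mem_cell {g : Fin n → ℕ} {k : ℕ} {i : Fin n} : i ∈ cell g k ↔ g i = k := by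
  simp [cell]

/-- The projection of `h` onto the vectors constant on the cells of `g`. -/
def cellMean (g : Fin n → ℕ) (h : Fin n → ℝ) (i : Fin n) : ℝ := avg (cell g (g i)) h

lemma cellMean_congr {g : Fin n → ℕ} {h : Fin n → ℝ} {i j : Fin n} (hij : g i = g j) :
    cellMean g h i = cellMean g h j := by rw [cellMean, cellMean, hij]

/-- Monotone labelings with labels `< q` that are constant on the cells of `e`. -/
structure IsLabeling (e : Fin n → ℕ) (q : ℕ) (g : Fin n → ℕ) : Prop where
  mono : Monotone g
  adm : ∀ i j, e i = e j → g i = g j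
  lt : ∀ i, g i < q

lemma sum_cells {g : Fin n → ℕ} {q : ℕ} (hg : ∀ i, g i < q) (φ : Fin n → ℝ) :
    ∑ k ∈ Finset.range q, ∑ i ∈ cell g k, φ i = ∑ i, φ i :=
  Finset.sum_fiberwise_of_maps_to (fun i _ => Finset.mem_range.2 (hg i)) φ

lemma sum_sq_sub_cellMean_le {g : Fin n → ℕ} {q : ℕ} (hg : ∀ i, g i < q) (h z : Fin n → ℝ)
    (hz : ∀ i j, g i = g j → z i = z j) :
    ∑ i, (h i - cellMean g h i) ^ 2 ≤ ∑ i, (h i - z i) ^ 2 := by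
  rw [← sum_cells hg, ← sum_cells hg]
  refine Finset.sum_le_sum fun k _ => ?_
  rcases (cell g k).eq_empty_or_nonempty with h0 | ⟨j, hj⟩
  · rw [h0]; simp
  · have hj' := mem_cell.1 hj
    have e1 : ∑ i ∈ cell g k, (h i - cellMean g h i) ^ 2 =
        ∑ i ∈ cell g k, (h i - avg (cell g k) h) ^ 2 :=
      Finset.sum_congr rfl fun i hi => by rw [cellMean, mem_cell.1 hi]
    have e2 : ∑ i ∈ cell g k, (h i - z i) ^ 2 = ∑ i ∈ cell g k, (h i - z j) ^ 2 :=
      Finset.sum_congr rfl fun i hi => by rw [hz i j ((mem_cell.1 hi).trans hj'.symm)]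
    rw [e1, e2]
    exact sum_sq_sub_avg_le _ _ _

/-- A labeling minimizing the squared bias plus `b₀` per label. -/
structure IsOptimal (h : Fin n → ℝ) (e : Fin n → ℕ) (b₀ : ℝ) (q : ℕ) (g : Fin n → ℕ) : Prop
    extends IsLabeling e q g where
  opt : ∀ q' g', IsLabeling e q' g' → ∀ z : Fin n → ℝ, (∀ i j, g' i = g' j → z i = z j) →
    ∑ i, (h i - cellMean g h i) ^ 2 + b₀ * q ≤ ∑ i, (h i - z i) ^ 2 + b₀ * q'

/-- Beyond some number N of labels, the labels alone cost more than the constant labeling, so the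
minimum is taken over finitely many candidates. Labels need not all be used, which leaves shifts and
merges of labels admissible without renumbering. -/
lemma exists_isOptimal (h : Fin n → ℝ) (e : Fin n → ℕ) {b₀ : ℝ} (hb₀ : 0 < b₀) :
    ∃ q g, IsOptimal h e b₀ q g := by
  set cost : ℕ × (Fin n → ℕ) → ℝ := fun p => ∑ i, (h i - cellMean p.2 h i) ^ 2 + b₀ * p.1
    with hcost
  obtain ⟨N, hN⟩ := exists_nat_gt (cost (1, fun _ => 0) / b₀)
  set s : Set (ℕ × (Fin n → ℕ)) := {p | p.1 ≤ N ∧ IsLabeling e p.1 p.2} with hs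
  have hfin : s.Finite := by
    refine Set.Finite.subset ((Set.finite_Iic N).prod (Set.Finite.pi' fun _ : Fin n =>
      Set.finite_Iic N)) ?_
    rintro ⟨q, g⟩ ⟨h1, h2⟩
    exact ⟨h1, fun i => ((h2.lt i).le.trans h1 : g i ≤ N)⟩
  have h1lab : IsLabeling e 1 (fun _ : Fin n => 0) := ⟨fun _ _ _ => le_rfl, fun _ _ _ => rfl,
    fun _ => Nat.one_pos⟩
  have hN' : cost (1, fun _ => 0) < b₀ * N := by rw [div_lt_iff₀ hb₀] at hN; linarith
  have hN1 : 1 ≤ N := by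
    by_contra hcon
    have : N = 0 := by omega
    subst this
    have : 0 ≤ cost (1, fun _ => 0) := by simp only [hcost]; positivity
    simp at hN'
    linarith
  obtain ⟨⟨q, g⟩, ⟨hqN, hlab⟩, hmin⟩ := Set.exists_min_image s cost hfin
    ⟨(1, fun _ => 0), hN1, h1lab⟩
  refine ⟨q, g, hlab, fun q' g' hg' z hz => ?_⟩
  have h2 := sum_sq_sub_cellMean_le hg'.lt h z hz
  by_cases hq' : q' ≤ N
  · have h3 : cost (q, g) ≤ cost (q', g') := hmin (q', g') ⟨hq', hg'⟩
    simp only [hcost] at h3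
    linarith
  · have h3 := hmin (1, fun _ => 0) ⟨hN1, h1lab⟩
    have h4 : b₀ * N ≤ b₀ * q' := by
      have : (N : ℝ) ≤ q' := by exact_mod_cast (not_le.1 hq').le
      gcongr
    have h5 : (0 : ℝ) ≤ ∑ i, (h i - z i) ^ 2 := by positivity
    change cost (q, g) ≤ _
    linarith

variable {h : Fin n → ℝ} {e : Fin n → ℕ} {b₀ : ℝ} {q : ℕ} {g : Fin n → ℕ}

/-- Splitting a cell of an optimal labeling does not pay. -/
lemma IsOptimal.split (ho : IsOptimal h e b₀ q g) {s : Fin n → ℕ} {d : ℕ}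
    (hs : Monotone s) (hadm : ∀ i j, e i = e j → s i = s j) (hd : ∀ i, s i ≤ d) (l v : ℕ) :
    (∑ i with g i = l ∧ s i = v, (h i - cellMean g h i)) ^ 2 ≤
      d * b₀ * (Finset.univ.filter fun i => g i = l ∧ s i = v).card := by
  set J := Finset.univ.filter fun i => g i = l ∧ s i = v with hJ
  set F := ∑ i ∈ J, (h i - cellMean g h i) with hF
  rcases J.eq_empty_or_nonempty with h0 | hne
  · rw [hF, h0]; simp
  have hJ0 : (0 : ℝ) < J.card := by exact_mod_cast hne.card_pos
  -- Both functions are nondecreasing, so their sum can agree at two points only if each of them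
  -- does; g + s therefore encodes the common refinement with at most d additional labels.
  have key : ∀ i j, g i + s i = g j + s j → g i = g j ∧ s i = s j := by
    intro i j hij
    rcases le_total i j with h1 | h1
    · have := ho.mono h1; have := hs h1; omega
    · have := ho.mono h1; have := hs h1; omega
  have hopt := ho.opt (q + d) (fun i => g i + s i)
    ⟨fun i j hij => add_le_add (ho.mono hij) (hs hij),
      fun i j hij => by rw [ho.adm i j hij, hadm i j hij],
      fun i => by have := ho.lt i; have := hd i; omega⟩
    -- Correcting the mean on the single piece J lowers the squared error by exactly F²/|J|;
    -- optimality says that this does not exceed the price d·b₀ of the new labels.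
    (fun i => cellMean g h i + if i ∈ J then F / J.card else 0) (by
      intro i j hij
      obtain ⟨h1, h2⟩ := key i j hij
      have : i ∈ J ↔ j ∈ J := by simp only [hJ, Finset.mem_filter, h1, h2, Finset.mem_univ]
      simp only [this, cellMean_congr h1])
  have e1 : ∑ i, (h i - (cellMean g h i + if i ∈ J then F / J.card else 0)) ^ 2 =
      ∑ i, (h i - cellMean g h i) ^ 2 - F ^ 2 / J.card := by
    have : ∀ i, (h i - (cellMean g h i + if i ∈ J then F / J.card else 0)) ^ 2 =
        (h i - cellMean g h i) ^ 2 + if i ∈ J then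
          (-(2 * (F / J.card)) * (h i - cellMean g h i) + (F / J.card) ^ 2) else 0 := by
      intro i
      split_ifs <;> ring
    simp_rw [this]
    rw [Finset.sum_add_distrib, Finset.sum_ite_mem, Finset.univ_inter, Finset.sum_add_distrib,
      ← Finset.mul_sum, ← hF, Finset.sum_const, nsmul_eq_mul]
    field_simp
    ring
  rw [e1] at hopt
  push_cast at hopt
  have : F ^ 2 / J.card ≤ d * b₀ := by linarith
  rwa [div_le_iff₀ hJ0] at this

/-- Merging consecutive cells of an optimal labeling does not pay. -/
lemma IsOptimal.merge (ho : IsOptimal h e b₀ q g) {l r : ℕ} (hlr : l + 2 ≤ r) (hr : r ≤ q)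
    (v : ℝ) :
    b₀ * ((r : ℝ) - l - 2) ≤ ∑ i with l < g i ∧ g i < r, (h i - v) ^ 2 := by
  classical
  -- The labels strictly between l and r collapse to l + 1, and those from r on are shifted down,
  -- which saves r - l - 2 labels.
  set g' : Fin n → ℕ := fun i => if g i ≤ l then g i else if g i < r then l + 1 else
    g i - (r - l - 2) with hg'
  have hmono : ∀ x y : ℕ, x ≤ y → (if x ≤ l then x else if x < r then l + 1 else x - (r - l - 2)) ≤
      (if y ≤ l then y else if y < r then l + 1 else y - (r - l - 2)) := by
    intro x y hxy
    split_ifs <;> omega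
  have hopt := ho.opt (q - (r - l - 2)) g' ⟨fun i j hij => hmono _ _ (ho.mono hij),
    fun i j hij => by simp only [hg', ho.adm i j hij], fun i => by
      have := ho.lt i
      simp only [hg']
      split_ifs <;> omega⟩
    (fun i => if l < g i ∧ g i < r then v else cellMean g h i) (by
      intro i j hij
      simp only [hg'] at hij
      by_cases h1 : l < g i ∧ g i < r
      · have h2 : l < g j ∧ g j < r := by
          split_ifs at hij <;> omega
        simp [h1, h2]
      · have h2 : ¬ (l < g j ∧ g j < r) := by
          split_ifs at hij <;> omega
        have h3 : g i = g j := by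
          split_ifs at hij <;> omega
        simp only [h1, h2, if_false]
        exact cellMean_congr h3)
  have e1 : ∑ i, (h i - if l < g i ∧ g i < r then v else cellMean g h i) ^ 2 ≤
      ∑ i, (h i - cellMean g h i) ^ 2 + ∑ i with l < g i ∧ g i < r, (h i - v) ^ 2 := by
    rw [Finset.sum_filter, ← Finset.sum_add_distrib]
    refine Finset.sum_le_sum fun i _ => ?_
    split_ifs
    · have := sq_nonneg (h i - cellMean g h i); linarith
    · simp
  have e2 : ((q - (r - l - 2) : ℕ) : ℝ) = q - (r - l - 2) := by
    rw [Nat.cast_sub (by omega), Nat.sub_sub, Nat.cast_sub hlr]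
    push_cast; ring
  rw [e2] at hopt
  linarith

/-- On a union of whole cells, averaging over cells does not change inner products with vectors that
are constant on cells. This is what replaces the noise by its projection on the full cells inside a
segment. -/
lemma sum_residual_full {A : Finset (Fin n)} (hA : ∀ i ∈ A, cell g (g i) ⊆ A) (y : Fin n → ℝ)
    (ψ : Fin n → ℝ) (hψ : ∀ i j, g i = g j → ψ i = ψ j) :
    ∑ i ∈ A, y i * ψ i = ∑ i ∈ A, cellMean g y i * ψ i := by
  classical
  have hfib : ∀ φ : Fin n → ℝ, ∑ i ∈ A, φ i = ∑ k ∈ A.image g, ∑ i ∈ cell g k, φ i := by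
    intro φ
    rw [← Finset.sum_fiberwise_of_maps_to (t := A.image g) (g := g)
      (fun i hi => Finset.mem_image_of_mem g hi)]
    refine Finset.sum_congr rfl fun k hk => Finset.sum_congr ?_ fun _ _ => rfl
    obtain ⟨j, hj, rfl⟩ := Finset.mem_image.1 hk
    ext i
    simp only [Finset.mem_filter, mem_cell]
    exact ⟨fun h => h.2, fun h => ⟨hA j hj (mem_cell.2 h), h⟩⟩
  rw [hfib, hfib]
  refine Finset.sum_congr rfl fun k hk => ?_
  obtain ⟨j, hj, rfl⟩ := Finset.mem_image.1 hk
  have h1 : ∀ i ∈ cell g (g j), ψ i = ψ j := fun i hi => hψ i j (mem_cell.1 hi)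
  have h2 : ∀ i ∈ cell g (g j), cellMean g y i = avg (cell g (g j)) y := fun i hi => by
    rw [cellMean, mem_cell.1 hi]
  have e1 : ∑ i ∈ cell g (g j), y i * ψ i = (∑ i ∈ cell g (g j), y i) * ψ j := by
    rw [Finset.sum_mul]
    exact Finset.sum_congr rfl fun i hi => by rw [h1 i hi]
  have e2 : ∑ i ∈ cell g (g j), cellMean g y i * ψ i =
      ∑ _i ∈ cell g (g j), avg (cell g (g j)) y * ψ j :=
    Finset.sum_congr rfl fun i hi => by rw [h1 i hi, h2 i hi]
  rw [e1, e2, Finset.sum_const, nsmul_eq_mul, ← mul_assoc, card_mul_avg]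

lemma sum_sub_cellMean_full {A : Finset (Fin n)} (hA : ∀ i ∈ A, cell g (g i) ⊆ A) (y : Fin n → ℝ)
    (ψ : Fin n → ℝ) (hψ : ∀ i j, g i = g j → ψ i = ψ j) :
    ∑ i ∈ A, (y i - cellMean g y i) * ψ i = 0 := by
  simp_rw [sub_mul]
  rw [Finset.sum_sub_distrib, sum_residual_full hA y ψ hψ, sub_self]

end Labelings

end Histogram
end

noncomputable section
namespace Histogram

/-! ### One segment of a competitor against the optimal segmentation -/

section Window

variable {n : ℕ} {h : Fin n → ℝ} {e : Fin n → ℕ} {b₀ : ℝ} {q : ℕ} {g : Fin n → ℕ}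

/-- `suf` dominates the fluctuations along the final pieces of the cells of `g`. -/
def SuffixBound (g : Fin n → ℕ) (h x : Fin n → ℝ) (q : ℕ) (w T β : ℝ) (suf : ℕ → ℝ) : Prop :=
  ∀ l k p : ℕ, l < k → k < q → w ≤ ((cell g l).filter fun i => p ≤ i.val).card →
    ∀ s : ℝ, s = 1 ∨ s = 2 →
    2 * (s * (avg (cell g l) h - avg (cell g k) h)) * (∑ i ∈ cell g l with p ≤ i.val, x i)
      - (s * (avg (cell g l) h - avg (cell g k) h)) ^ 2 / 5 *
        ((cell g l).filter fun i => p ≤ i.val).card - T - β * ((k : ℝ) - l) ≤ suf l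

/-- `pre` dominates the fluctuations along the initial pieces of the cells of `g`. -/
def PrefixBound (g : Fin n → ℕ) (h x : Fin n → ℝ) (q : ℕ) (w T β : ℝ) (pre : ℕ → ℝ) : Prop :=
  ∀ l k p : ℕ, k < l → l < q → w ≤ ((cell g l).filter fun i => i.val < p).card →
    ∀ s : ℝ, s = 1 ∨ s = 2 →
    2 * (s * (avg (cell g l) h - avg (cell g k) h)) * (∑ i ∈ cell g l with i.val < p, x i)
      - (s * (avg (cell g l) h - avg (cell g k) h)) ^ 2 / 5 *
        ((cell g l).filter fun i => i.val < p).card - T - β * ((l : ℝ) - k) ≤ pre l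

lemma card_le_of_saturated {w : ℝ} (hw : ∀ i, w ≤ ((cell e (e i)).card : ℝ))
    {A : Finset (Fin n)} (hA : A.Nonempty) (hsat : ∀ i ∈ A, ∀ j, e i = e j → j ∈ A) :
    w ≤ (A.card : ℝ) := by
  obtain ⟨i, hi⟩ := hA
  refine (hw i).trans ?_
  exact_mod_cast Finset.card_le_card fun j hj => hsat i hi j (mem_cell.1 hj).symm

/-- The deterministic inequality for one cell `I` of a competing labeling `t`. -/
lemma IsOptimal.window_bound (ho : IsOptimal h e b₀ q g) (hb₀ : 0 < b₀) {p : ℕ}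
    {t : Fin n → ℕ} (ht : IsLabeling e p t) {w : ℝ}
    (hw : ∀ i, w ≤ ((cell e (e i)).card : ℝ)) {a : ℕ} {i₁ i₂ : Fin n}
    (hi₁ : i₁ ∈ cell t a) (hi₂ : i₂ ∈ cell t a) (hmin : ∀ i ∈ cell t a, i₁ ≤ i)
    (hmax : ∀ i ∈ cell t a, i ≤ i₂) {x : Fin n → ℝ} {T : ℝ} (hT : 0 ≤ T) {suf pre : ℕ → ℝ}
    (hsuf0 : ∀ l, 0 ≤ suf l) (hpre0 : ∀ l, 0 ≤ pre l)
    (hsuf : SuffixBound g h x q w T (b₀ / 20) suf) (hpre : PrefixBound g h x q w T (b₀ / 20) pre)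
    {H : ℝ}
    (hH : (∑ i ∈ cell t a, (h i - cellMean g h i)) ^ 2 ≤ 2 * b₀ * (cell t a).card → ∀ l l' : ℕ,
      2 * |∑ i ∈ cell t a, (h i - cellMean g h i)| *
        (|∑ i with t i = a ∧ g i = l, x i| + |∑ i with t i = a ∧ g i = l', x i|)
        ≤ H * (cell t a).card) :
    2 * ∑ i ∈ cell t a, (h i - avg (cell t a) h) * x i
        - ∑ i ∈ cell t a, (h i - avg (cell t a) h) ^ 2 ≤
      2 * ∑ i ∈ cell t a, (h i - cellMean g h i) * x i
        + 5 * ∑ i with t i = a ∧ (g i₁ < g i ∧ g i < g i₂), cellMean g x i ^ 2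
        + (if g i₁ < g i₂ then suf (g i₁) + pre (g i₂) else 0) + (T + 41 / 10 * b₀) + H
        - 1 / 4 * ∑ i ∈ cell t a, (h i - avg (cell t a) h) ^ 2 := by
  classical
  set D := ∑ i ∈ cell t a, (h i - avg (cell t a) h) ^ 2 with hD
  have hD0 : 0 ≤ D := by positivity
  have ht₁ := mem_cell.1 hi₁
  have ht₂ := mem_cell.1 hi₂
  have hmem : ∀ i, i₁ ≤ i → i ≤ i₂ → t i = a := fun i h1 h2 =>
    le_antisymm ((ht.mono h2).trans ht₂.le) (ht₁.ge.trans (ht.mono h1))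
  have hgl : ∀ i ∈ cell t a, g i₁ ≤ g i := fun i hi => ho.mono (hmin i hi)
  have hgr : ∀ i ∈ cell t a, g i ≤ g i₂ := fun i hi => ho.mono (hmax i hi)
  have hIne : (cell t a).Nonempty := ⟨i₁, hi₁⟩
  have hI0 : (0 : ℝ) < (cell t a).card := by exact_mod_cast hIne.card_pos
  rcases eq_or_lt_of_le (hgl i₂ hi₂) with heq | hlt
  · -- the cell is contained in a cell of `g`
    have hgI : ∀ i ∈ cell t a, g i = g i₁ := fun i hi =>
      le_antisymm ((hgr i hi).trans heq.ge) (hgl i hi)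
    have hset : (Finset.univ.filter fun i => t i = a ∧ g i = g i₁) = cell t a := by
      ext i
      simp only [Finset.mem_filter, Finset.mem_univ, true_and, mem_cell]
      exact ⟨fun h => h.1, fun h => ⟨h, hgI i (mem_cell.2 h)⟩⟩
    have hF2 : (∑ i ∈ cell t a, (h i - cellMean g h i)) ^ 2 ≤ 2 * b₀ * (cell t a).card := by
      -- The values 0, 1, 2 stand for before, inside and after the segment. Isolating an interior
      -- piece of a cell takes two cuts, whence 2b₀.
      set s : Fin n → ℕ := fun i => (if a ≤ t i then 1 else 0) + (if a < t i then 1 else 0) with hs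
      have := ho.split (s := s) (d := 2) (by
          intro i j hij
          have := ht.mono hij
          simp only [hs]
          split_ifs <;> omega)
        (fun i j hij => by simp only [hs, ht.adm i j hij])
        (fun i => by simp only [hs]; split_ifs <;> omega) (g i₁) 1
      have hset2 : (Finset.univ.filter fun i => g i = g i₁ ∧ s i = 1) = cell t a := by
        ext i
        simp only [Finset.mem_filter, Finset.mem_univ, true_and, mem_cell, hs]
        constructor
        · rintro ⟨_, h2⟩
          split_ifs at h2 <;> omega
        · intro h2
          refine ⟨hgI i (mem_cell.2 h2), ?_⟩
          split_ifs <;> omega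
      rw [hset2] at this
      exact_mod_cast this
    have hH' := hH hF2 (g i₁) (g i₁)
    rw [hset] at hH'
    set F := ∑ i ∈ cell t a, (h i - cellMean g h i) with hF
    set S := ∑ i ∈ cell t a, x i with hS
    rw [if_neg (by omega)]
    have hG : ∀ i ∈ cell t a, cellMean g h i = cellMean g h i₁ := fun i hi =>
      cellMean_congr (hgI i hi)
    have havg : avg (cell t a) h = cellMean g h i₁ + F / (cell t a).card := by
      have : F = ((cell t a).card : ℝ) * avg (cell t a) h - (cell t a).card * cellMean g h i₁ := by
        rw [hF, Finset.sum_sub_distrib, card_mul_avg, Finset.sum_congr (g := fun i => cellMean g h i₁)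
          rfl hG, Finset.sum_const, nsmul_eq_mul]
      rw [this]; field_simp; ring
    have e1 : ∑ i ∈ cell t a, (h i - avg (cell t a) h) * x i =
        ∑ i ∈ cell t a, (h i - cellMean g h i) * x i - F / (cell t a).card * S := by
      rw [hS, Finset.mul_sum, ← Finset.sum_sub_distrib]
      refine Finset.sum_congr rfl fun i hi => ?_
      rw [havg, hG i hi]; ring
    have e2 : -(2 * (F / (cell t a).card * S)) ≤ H := by
      have h1 : -(2 * (F / (cell t a).card * S)) = -(2 * (F * S)) / (cell t a).card := by
        field_simp
      rw [h1, div_le_iff₀ hI0]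
      have h2 := neg_abs_le (F * S)
      rw [abs_mul] at h2
      have h3 : 0 ≤ |F| * |S| := by positivity
      nlinarith
    have e3 : 0 ≤ ∑ i with t i = a ∧ (g i₁ < g i ∧ g i < g i₂), cellMean g x i ^ 2 := by positivity
    rw [e1]
    linarith
  · -- the cell meets several cells of `g`
    rw [if_pos hlt]
    set J := Finset.univ.filter fun i => t i = a ∧ g i = g i₁ with hJ
    set J' := Finset.univ.filter fun i => t i = a ∧ g i = g i₂ with hJ'
    set F := Finset.univ.filter fun i => t i = a ∧ (g i₁ < g i ∧ g i < g i₂) with hF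
    have hunion : J ∪ F ∪ J' = cell t a := by
      ext i
      have h1 := hgl i
      have h2 := hgr i
      simp only [mem_cell] at h1 h2
      simp only [hJ, hF, hJ', Finset.mem_union, Finset.mem_filter, Finset.mem_univ, true_and,
        mem_cell]
      constructor
      · rintro ((h | h) | h) <;> exact h.1
      · intro h
        have := h1 h
        have := h2 h
        omega
    have hJF : Disjoint J F := by
      rw [Finset.disjoint_left]; intro i h1 h2
      simp only [hJ, hF, Finset.mem_filter] at h1 h2; omega
    have hJJ : Disjoint J J' := by
      rw [Finset.disjoint_left]; intro i h1 h2
      simp only [hJ, hJ', Finset.mem_filter] at h1 h2; omega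
    have hFJ : Disjoint F J' := by
      rw [Finset.disjoint_left]; intro i h1 h2
      simp only [hJ', hF, Finset.mem_filter] at h1 h2; omega
    have hJne : J.Nonempty := ⟨i₁, by simp [hJ, ht₁]⟩
    have hJ'ne : J'.Nonempty := ⟨i₂, by simp [hJ', ht₂]⟩
    -- the first piece is the end of a cell, the last piece the beginning of a cell
    have hend : ∀ i, g i = g i₁ → t i ≤ a := by
      intro i hi
      by_contra hcon
      have h1 : i₂ ≤ i := by
        by_contra h2
        have := ht.mono (not_le.1 h2).le
        omega
      have := ho.mono h1
      omega
    have hbeg : ∀ i, g i = g i₂ → a ≤ t i := by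
      intro i hi
      by_contra hcon
      have h1 : i ≤ i₁ := by
        by_contra h2
        have := ht.mono (not_le.1 h2).le
        omega
      have := ho.mono h1
      omega
    have hJsuf : J = (cell g (g i₁)).filter fun i => i₁.val ≤ i.val := by
      ext i
      simp only [hJ, Finset.mem_filter, Finset.mem_univ, true_and, mem_cell]
      constructor
      · rintro ⟨h1, h2⟩
        exact ⟨h2, hmin i (mem_cell.2 h1)⟩
      · rintro ⟨h1, h2⟩
        refine ⟨le_antisymm (hend i h1) ?_, h1⟩
        exact ht₁.ge.trans (ht.mono h2)
    have hJ'pre : J' = (cell g (g i₂)).filter fun i => i.val < i₂.val + 1 := by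
      ext i
      simp only [hJ', Finset.mem_filter, Finset.mem_univ, true_and, mem_cell]
      constructor
      · rintro ⟨h1, h2⟩
        exact ⟨h2, Nat.lt_succ_of_le (hmax i (mem_cell.2 h1))⟩
      · rintro ⟨h1, h2⟩
        refine ⟨le_antisymm ((ht.mono (Nat.le_of_lt_succ h2)).trans ht₂.le) (hbeg i h1), h1⟩
    have hsat : ∀ l : ℕ, ∀ i ∈ Finset.univ.filter (fun i => t i = a ∧ g i = l), ∀ j, e i = e j →
        j ∈ Finset.univ.filter (fun i => t i = a ∧ g i = l) := by
      intro l i hi j hij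
      simp only [Finset.mem_filter, Finset.mem_univ, true_and] at hi ⊢
      rw [← ht.adm i j hij, ← ho.adm i j hij]
      exact hi
    have hJw : w ≤ (J.card : ℝ) := card_le_of_saturated hw hJne (hsat _)
    have hJ'w : w ≤ (J'.card : ℝ) := card_le_of_saturated hw hJ'ne (hsat _)
    have hbJ : (∑ i ∈ J, (h i - cellMean g h i)) ^ 2 ≤ b₀ * J.card := by
      -- J is the final piece of a cell, so a single cut isolates it and the bound is b₀ instead of
      -- 2b₀.
      set s : Fin n → ℕ := fun i => if a ≤ t i then 1 else 0 with hs
      have := ho.split (s := s) (d := 1) (by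
          intro i j hij
          have := ht.mono hij
          simp only [hs]
          split_ifs <;> omega)
        (fun i j hij => by simp only [hs, ht.adm i j hij])
        (fun i => by simp only [hs]; split_ifs <;> omega) (g i₁) 1
      have hset2 : (Finset.univ.filter fun i => g i = g i₁ ∧ s i = 1) = J := by
        ext i
        simp only [Finset.mem_filter, Finset.mem_univ, true_and, hJ, hs]
        constructor
        · rintro ⟨h1, h2⟩
          have := hend i h1
          split_ifs at h2 <;> omega
        · rintro ⟨h1, h2⟩
          refine ⟨h2, ?_⟩
          split_ifs <;> omega
      rw [hset2] at this
      simpa using this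
    have hbJ' : (∑ i ∈ J', (h i - cellMean g h i)) ^ 2 ≤ b₀ * J'.card := by
      set s : Fin n → ℕ := fun i => if a < t i then 1 else 0 with hs
      have := ho.split (s := s) (d := 1) (by
          intro i j hij
          have := ht.mono hij
          simp only [hs]
          split_ifs <;> omega)
        (fun i j hij => by simp only [hs, ht.adm i j hij])
        (fun i => by simp only [hs]; split_ifs <;> omega) (g i₂) 0
      have hset2 : (Finset.univ.filter fun i => g i = g i₂ ∧ s i = 0) = J' := by
        ext i
        simp only [Finset.mem_filter, Finset.mem_univ, true_and, hJ', hs]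
        constructor
        · rintro ⟨h1, h2⟩
          have := hbeg i h1
          split_ifs at h2 <;> omega
        · rintro ⟨h1, h2⟩
          refine ⟨h2, ?_⟩
          split_ifs <;> omega
      rw [hset2] at this
      simpa using this
    have hsumsplit : ∀ φ : Fin n → ℝ, ∑ i ∈ cell t a, φ i =
        ∑ i ∈ J, φ i + ∑ i ∈ F, φ i + ∑ i ∈ J', φ i := by
      intro φ
      rw [← hunion, Finset.sum_union (Finset.disjoint_union_left.2 ⟨hJJ, hFJ⟩),
        Finset.sum_union hJF]
    have hcardsplit : ((cell t a).card : ℝ) = J.card + F.card + J'.card := by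
      rw [← hunion, Finset.card_union_of_disjoint (Finset.disjoint_union_left.2 ⟨hJJ, hFJ⟩),
        Finset.card_union_of_disjoint hJF]
      push_cast; ring
    have hFfull : ∀ i ∈ F, cell g (g i) ⊆ F := by
      intro i hi j hj
      have hj := mem_cell.1 hj
      simp only [hF, Finset.mem_filter, Finset.mem_univ, true_and] at hi ⊢
      refine ⟨hmem j ?_ ?_, by omega, by omega⟩
      · by_contra hcon
        have := ho.mono (not_le.1 hcon).le
        omega
      · by_contra hcon
        have := ho.mono (not_le.1 hcon).le
        omega
    have hFr : ∑ i ∈ F, (h i - cellMean g h i) = 0 := by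
      simpa using sum_sub_cellMean_full hFfull h (fun _ => 1) (fun _ _ _ => rfl)
    have hF2 : (∑ i ∈ cell t a, (h i - cellMean g h i)) ^ 2 ≤ 2 * b₀ * (cell t a).card := by
      rw [hsumsplit, hFr, hcardsplit]
      set A := ∑ i ∈ J, (h i - cellMean g h i)
      set B := ∑ i ∈ J', (h i - cellMean g h i)
      have : (0 : ℝ) ≤ b₀ * F.card := by positivity
      nlinarith [sq_nonneg (A - B)]
    have hH' := hH hF2 (g i₁) (g i₂)
    rw [← hJ, ← hJ', ← hunion] at hH'
    have hgi₂ := ho.lt i₂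
    set δ : ℕ → ℕ → ℝ := fun l k => avg (cell g l) h - avg (cell g k) h with hδ
    have hsufk : ∀ k, g i₁ < k → k < q → ∀ s : ℝ, s = 1 ∨ s = 2 →
        2 * (s * δ (g i₁) k) * (∑ i ∈ J, x i) - (s * δ (g i₁) k) ^ 2 / 5 * J.card - T -
          b₀ / 20 * ((k : ℝ) - g i₁) ≤ suf (g i₁) := by
      intro k h1 h2 s hs
      have := hsuf (g i₁) k i₁.val h1 h2 (by rw [← hJsuf]; exact hJw) s hs
      rwa [← hJsuf] at this
    have hprek : ∀ k, k < g i₂ → ∀ s : ℝ, s = 1 ∨ s = 2 →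
        2 * (s * δ (g i₂) k) * (∑ i ∈ J', x i) - (s * δ (g i₂) k) ^ 2 / 5 * J'.card - T -
          b₀ / 20 * ((g i₂ : ℝ) - k) ≤ pre (g i₂) := by
      intro k h1 s hs
      have := hpre (g i₂) k (i₂.val + 1) h1 hgi₂ (by rw [← hJ'pre]; exact hJ'w) s hs
      rwa [← hJ'pre] at this
    have hltR : (g i₁ : ℝ) + 1 ≤ g i₂ := by exact_mod_cast hlt
    have hmain := interval_bound hJF hJJ hFJ hJne hJ'ne (h := h) (x := x)
      (r := fun i => h i - cellMean g h i) (G := cellMean g h) (xt := cellMean g x)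
      (fun i => by ring) (μ := avg (cell g (g i₁)) h) (μ' := avg (cell g (g i₂)) h)
      (fun i hi => by
        simp only [hJ, Finset.mem_filter] at hi
        rw [cellMean, hi.2.2])
      (fun i hi => by
        simp only [hJ', Finset.mem_filter] at hi
        rw [cellMean, hi.2.2])
      hFr (sum_sub_cellMean_full hFfull h _ fun i j => cellMean_congr)
      (by simpa using sum_residual_full hFfull x (fun _ => 1) (fun _ _ _ => rfl))
      (sum_residual_full hFfull x _ fun i j => cellMean_congr) hbJ hbJ'
      (C := T + b₀ / 20 * ((g i₂ : ℝ) - g i₁) + suf (g i₁) + pre (g i₂)) (H := H)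
      (by
        intro i hi
        simp only [hF, Finset.mem_filter, Finset.mem_univ, true_and] at hi
        -- Halving the bound for twice the difference of levels gives the coefficient 2/5 at the
        -- price of only T/2 for each end, so both ends together cost one T.
        have h1 := hsufk (g i) hi.2.1 (ho.lt i) 2 (Or.inr rfl)
        have h2 := hprek (g i) hi.2.2 2 (Or.inr rfl)
        simp only [hδ] at h1 h2
        have h3 : (0 : ℝ) ≤ b₀ / 20 * ((g i₂ : ℝ) - g i₁) := by
          apply mul_nonneg (by positivity); linarith
        rw [cellMean]
        linarith [hsuf0 (g i₁), hpre0 (g i₂)])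
      (by
        have h1 := hsufk (g i₂) hlt hgi₂ 1 (Or.inl rfl)
        simp only [hδ] at h1
        linarith [hpre0 (g i₂)])
      (by
        have h1 := hprek (g i₁) hlt 1 (Or.inl rfl)
        simp only [hδ] at h1
        linarith [hsuf0 (g i₁)])
      hH'
    rw [hunion] at hmain
    -- The allowance linear in the distance between labels is paid by the bias of the competitor:
    -- were that bias small, merging the labels in between would have improved the optimal labeling.
    -- Two labels are not saved, which leaves b₀/10.
    have hmerge : b₀ / 20 * ((g i₂ : ℝ) - g i₁) ≤ 1 / 20 * D + b₀ / 10 := by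
      by_cases h2 : g i₁ + 2 ≤ g i₂
      · have h3 := ho.merge h2 hgi₂.le (avg (cell t a) h)
        have h4 : ∑ i with g i₁ < g i ∧ g i < g i₂, (h i - avg (cell t a) h) ^ 2 ≤ D := by
          refine Finset.sum_le_sum_of_subset_of_nonneg ?_ fun _ _ _ => sq_nonneg _
          intro i hi
          simp only [Finset.mem_filter, Finset.mem_univ, true_and] at hi
          rw [mem_cell]
          refine hmem i ?_ ?_
          · by_contra hcon
            have := ho.mono (not_le.1 hcon).le
            omega
          · by_contra hcon
            have := ho.mono (not_le.1 hcon).le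
            omega
        linarith
      · have : (g i₂ : ℝ) = g i₁ + 1 := by
          have : g i₂ = g i₁ + 1 := by omega
          exact_mod_cast this
        rw [this]
        linarith
    linarith

end Window

end Histogram
end

noncomputable section
namespace Histogram

/-! ### Dyadic windows and the sum over all segments -/

section Sum

variable {n : ℕ} {h : Fin n → ℝ} {e : Fin n → ℕ} {b₀ : ℝ} {q : ℕ} {g : Fin n → ℕ}

/-- The window `[k 2ˢ, (k + 2) 2ˢ)`. -/
def window (n s k : ℕ) : Finset (Fin n) :=
  Finset.univ.filter fun i => k * 2 ^ s ≤ i.val ∧ i.val < (k + 2) * 2 ^ s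

@[simp] lemma mem_window {s k : ℕ} {i : Fin n} :
    i ∈ window n s k ↔ k * 2 ^ s ≤ i.val ∧ i.val < (k + 2) * 2 ^ s := by simp [window]

lemma card_window_le (s k : ℕ) : (window n s k).card ≤ 2 ^ (s + 1) := by
  have : ((window n s k).map Fin.valEmbedding).card ≤ (Finset.Ico (k * 2 ^ s) ((k + 2) * 2 ^ s)).card := by
    apply Finset.card_le_card
    intro j hj
    simp only [Finset.mem_map, mem_window, Fin.valEmbedding_apply] at hj
    obtain ⟨i, hi, rfl⟩ := hj
    exact Finset.mem_Ico.2 hi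
  rw [Finset.card_map, Nat.card_Ico] at this
  refine this.trans (le_of_eq ?_)
  rw [← Nat.sub_mul, Nat.add_sub_cancel_left, pow_succ, mul_comm]

/-- The local size of `r` at a window, cut off at `√(2 b₀)`. -/
def localSize (b₀ : ℝ) (r : Fin n → ℝ) (s k : ℕ) : ℝ :=
  min (Real.sqrt (2 * b₀)) (2 * ((∑ i ∈ window n s k, |r i|) / Real.sqrt (2 ^ (s + 1))))

lemma localSize_nonneg (r : Fin n → ℝ) (s k : ℕ) : 0 ≤ localSize b₀ r s k :=
  le_min (Real.sqrt_nonneg _) (by positivity)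

/-- Every interval is contained in a dyadic window of comparable length. -/
lemma exists_window {I : Finset (Fin n)} {i₁ i₂ : Fin n} (h12 : i₁ ≤ i₂)
    (hI : ∀ i, i ∈ I ↔ i₁ ≤ i ∧ i ≤ i₂) :
    ∃ s k : ℕ, s ≤ n ∧ k ≤ n ∧ I ⊆ window n s k ∧ I.card ≤ 2 ^ (s + 1) ∧
      2 ^ (s + 1) ≤ 4 * I.card := by
  have hcard : I.card = i₂.val + 1 - i₁.val := by
    have : I = Finset.Icc i₁ i₂ := by ext i; simp [hI]
    rw [this, Fin.card_Icc]
  have h12' : i₁.val ≤ i₂.val := h12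
  set m := I.card with hm
  have hm1 : 1 ≤ m := by omega
  have hs1 : m ≤ 2 ^ Nat.clog 2 m := Nat.le_pow_clog (by norm_num) m
  refine ⟨Nat.clog 2 m, i₁.val / 2 ^ Nat.clog 2 m, ?_, ?_, ?_, ?_, ?_⟩
  · have hmn : m ≤ n := by have := i₂.isLt; omega
    refine Nat.clog_le_of_le_pow (hmn.trans (Nat.lt_two_pow_self).le)
  · exact (Nat.div_le_self _ _).trans i₁.isLt.le
  · intro i hi
    obtain ⟨h1, h2⟩ := (hI i).1 hi
    have h1 : i₁.val ≤ i.val := h1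
    have h2 : i.val ≤ i₂.val := h2
    have h3 := Nat.div_mul_le_self i₁.val (2 ^ Nat.clog 2 m)
    have h4 := Nat.lt_div_mul_add (a := i₁.val) (b := 2 ^ Nat.clog 2 m) (by positivity)
    rw [mem_window, add_mul]
    omega
  · rw [pow_succ]; omega
  · rw [pow_succ]
    rcases eq_or_lt_of_le hm1 with h1 | h1
    · rw [← h1]; simp
    · have h2 := Nat.pow_pred_clog_lt_self (b := 2) (by norm_num) (show 1 < m by omega)
      have h3 : 1 ≤ Nat.clog 2 m := Nat.clog_pos (by norm_num) h1
      have h4 : 2 ^ Nat.clog 2 m = 2 * 2 ^ (Nat.clog 2 m - 1) := by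
        rw [← pow_succ', Nat.sub_add_cancel h3]
      rw [Nat.pred_eq_sub_one] at h2
      omega

/-- The sum over an interval inside Q is a difference of two partial sums along Q. -/
lemma abs_sum_interval_le {Q A : Finset (Fin n)} {x : Fin n → ℝ} {M : ℝ} (hM0 : 0 ≤ M)
    (hM : ∀ p : ℕ, |∑ i ∈ Q with i.val < p, x i| ≤ M) (hAQ : A ⊆ Q)
    (hA : ∀ i ∈ A, ∀ k ∈ A, ∀ j, i ≤ j → j ≤ k → j ∈ A) : |∑ i ∈ A, x i| ≤ 2 * M := by
  rcases A.eq_empty_or_nonempty with rfl | hne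
  · simpa using hM0
  set j₁ := A.min' hne
  set j₂ := A.max' hne
  have hA' : ∀ i, i ∈ A ↔ j₁ ≤ i ∧ i ≤ j₂ := fun i =>
    ⟨fun hi => ⟨A.min'_le i hi, A.le_max' i hi⟩, fun hi =>
      hA j₁ (A.min'_mem hne) j₂ (A.max'_mem hne) i hi.1 hi.2⟩
  have h12 : j₁.val ≤ j₂.val := A.min'_le_max' hne
  have key : ∑ i ∈ Q with i.val < j₂.val + 1, x i = ∑ i ∈ Q with i.val < j₁.val, x i
      + ∑ i ∈ A, x i := by
    rw [← Finset.sum_union]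
    · congr 1
      ext i
      have h1 := hA' i
      have h2 := @hAQ i
      simp only [Finset.mem_union, Finset.mem_filter, h1, Fin.le_def] at h2 ⊢
      constructor
      · rintro ⟨h3, h4⟩
        rcases lt_or_ge i.val j₁.val with h5 | h5
        · exact Or.inl ⟨h3, h5⟩
        · exact Or.inr ⟨h5, by omega⟩
      · rintro (⟨h3, h4⟩ | h3)
        · exact ⟨h3, by omega⟩
        · exact ⟨h2 h3, by omega⟩
    · rw [Finset.disjoint_left]
      intro i hi hi'
      have h1 := ((hA' i).1 hi').1
      rw [Fin.le_def] at h1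
      simp only [Finset.mem_filter] at hi
      omega
  have h3 : ∑ i ∈ A, x i = ∑ i ∈ Q with i.val < j₂.val + 1, x i -
      ∑ i ∈ Q with i.val < j₁.val, x i := by rw [key]; ring
  rw [h3]
  have h4 := hM (j₂.val + 1)
  have h5 := hM j₁.val
  have h6 := abs_sub (∑ i ∈ Q with i.val < j₂.val + 1, x i) (∑ i ∈ Q with i.val < j₁.val, x i)
  linarith

/-- `Hs` dominates the fluctuations at the dyadic windows. -/
def WindowBound (b₀ : ℝ) (r : Fin n → ℝ) (w v : ℝ) (M Hs : ℕ → ℕ → ℝ) : Prop :=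
  ∀ s k : ℕ, w ≤ 2 ^ (s + 1) →
    16 * localSize b₀ r s k * M s k / Real.sqrt (2 ^ (s + 1)) - v ≤ Hs s k

/-- Segments are far too numerous to be treated one by one, so the correction by the mean residual
of a segment is charged to a dyadic window of comparable length containing it. -/
lemma WindowBound.apply {r x : Fin n → ℝ} {w v : ℝ} {M Hs : ℕ → ℕ → ℝ}
    (hW : WindowBound b₀ r w v M Hs) (hb₀ : 0 < b₀) (hM0 : ∀ s k, 0 ≤ M s k)
    (hM : ∀ s k p : ℕ, |∑ i ∈ window n s k with i.val < p, x i| ≤ M s k)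
    {I A B : Finset (Fin n)} {s k : ℕ} (hI : I ⊆ window n s k) (hne : I.Nonempty)
    (hwI : w ≤ I.card)
    (h1 : I.card ≤ 2 ^ (s + 1)) (h2 : 2 ^ (s + 1) ≤ 4 * I.card)
    (hF : (∑ i ∈ I, r i) ^ 2 ≤ 2 * b₀ * I.card)
    (hAI : A ⊆ I) (hA : ∀ i ∈ A, ∀ k ∈ A, ∀ j, i ≤ j → j ≤ k → j ∈ A)
    (hBI : B ⊆ I) (hB : ∀ i ∈ B, ∀ k ∈ B, ∀ j, i ≤ j → j ≤ k → j ∈ B) :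
    2 * |∑ i ∈ I, r i| * (|∑ i ∈ A, x i| + |∑ i ∈ B, x i|) ≤ (v + Hs s k) * I.card := by
  have hSA := abs_sum_interval_le (hM0 s k) (hM s k) (hAI.trans hI) hA
  have hSB := abs_sum_interval_le (hM0 s k) (hM s k) (hBI.trans hI) hB
  have hI0 : (0 : ℝ) < I.card := by exact_mod_cast hne.card_pos
  have h1' : (I.card : ℝ) ≤ 2 ^ (s + 1) := by exact_mod_cast h1
  have h2' : (2 : ℝ) ^ (s + 1) ≤ 4 * I.card := by exact_mod_cast h2
  have hb := hW s k (hwI.trans h1')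
  set N : ℝ := 2 ^ (s + 1) with hN
  have hN0 : 0 < N := by positivity
  have hsN : 0 < Real.sqrt N := Real.sqrt_pos.2 hN0
  have hsN2 : Real.sqrt N ^ 2 = N := Real.sq_sqrt hN0.le
  set F := |∑ i ∈ I, r i| with hFdef
  have hF0 : 0 ≤ F := abs_nonneg _
  -- Both entries of the minimum in `localSize` are legitimate: the cut-off comes from the
  -- optimality bound on F², the other from |r| summed over the window, and each uses N ≤ 4|I|.
  have hFα : F * Real.sqrt N ≤ 2 * localSize b₀ r s k * I.card := by
    rw [localSize, ← hN]
    rcases min_choice (Real.sqrt (2 * b₀)) (2 * ((∑ i ∈ window n s k, |r i|) / Real.sqrt N))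
      with hmin | hmin
    · rw [hmin]
      have h3 : F ^ 2 ≤ 2 * b₀ * I.card := by rw [hFdef, sq_abs]; exact hF
      have h4 : Real.sqrt (2 * b₀) ^ 2 = 2 * b₀ := Real.sq_sqrt (by positivity)
      refine abs_le_of_sq_le_sq' ?_ (by positivity) |>.2
      rw [mul_pow, hsN2, mul_pow, mul_pow, h4]
      calc F ^ 2 * N ≤ (2 * b₀ * I.card) * (4 * I.card) := by gcongr
        _ = _ := by ring
    · rw [hmin]
      have h3 : F ≤ ∑ i ∈ window n s k, |r i| :=
        (Finset.abs_sum_le_sum_abs _ _).trans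
          (Finset.sum_le_sum_of_subset_of_nonneg hI fun _ _ _ => abs_nonneg _)
      set Rs := ∑ i ∈ window n s k, |r i|
      have h4 : F * N ≤ Rs * (4 * I.card) := by
        have : 0 ≤ Rs := hF0.trans h3
        gcongr
      have h5 : 2 * (2 * (Rs / Real.sqrt N)) * I.card = Rs * (4 * I.card) / Real.sqrt N := by
        field_simp; ring
      rw [h5, le_div_iff₀ hsN, mul_assoc, ← pow_two, hsN2]
      exact h4
  have h6 : 2 * F * (|∑ i ∈ A, x i| + |∑ i ∈ B, x i|) ≤ 8 * F * M s k := by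
    calc _ ≤ 2 * F * (2 * M s k + 2 * M s k) := by gcongr
      _ = _ := by ring
  refine h6.trans ?_
  have h7 : 8 * F * M s k ≤ 16 * localSize b₀ r s k * M s k / Real.sqrt N * I.card := by
    rw [div_mul_eq_mul_div, le_div_iff₀ hsN]
    have := mul_le_mul_of_nonneg_right hFα (hM0 s k)
    linarith
  refine h7.trans ?_
  gcongr
  linarith

/-- Deterministic bound for all competing labelings at once. -/
theorem IsOptimal.sum_bound (ho : IsOptimal h e b₀ q g) (hb₀ : 0 < b₀) {w : ℝ}
    (hw : ∀ i, w ≤ ((cell e (e i)).card : ℝ)) {x : Fin n → ℝ} {T v : ℝ} (hT : 0 ≤ T) (hv : 0 ≤ v)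
    {suf pre : ℕ → ℝ} (hsuf0 : ∀ l, 0 ≤ suf l) (hpre0 : ∀ l, 0 ≤ pre l)
    (hsuf : SuffixBound g h x q w T (b₀ / 20) suf) (hpre : PrefixBound g h x q w T (b₀ / 20) pre)
    {M Hs : ℕ → ℕ → ℝ} (hM0 : ∀ s k, 0 ≤ M s k) (hHs0 : ∀ s k, 0 ≤ Hs s k)
    (hM : ∀ s k p : ℕ, |∑ i ∈ window n s k with i.val < p, x i| ≤ M s k)
    (hW : WindowBound b₀ (fun i => h i - cellMean g h i) w v M Hs)
    {p : ℕ} {t : Fin n → ℕ} (ht : IsLabeling e p t) :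
    ∑ a ∈ Finset.range p, (2 * ∑ i ∈ cell t a, (h i - avg (cell t a) h) * x i
        - ∑ i ∈ cell t a, (h i - avg (cell t a) h) ^ 2 - (T + 87 / 20 * b₀ + v)) ≤
      2 * ∑ i, (h i - cellMean g h i) * x i + 5 * ∑ i, cellMean g x i ^ 2
        + ∑ k ∈ Finset.range q, (suf k + pre k)
        + 4 * ∑ s ∈ Finset.range (n + 1), ∑ k ∈ Finset.range (n + 1), Hs s k
        - 1 / 4 * (∑ i, (h i - cellMean g h i) ^ 2 + b₀ * q) := by
  classical
  -- Applied to the competitor itself: its bias is at least the optimal cost minus b₀p. This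
  -- transfers the leftover quarter of its bias to the reference segmentation.
  have hopt := ho.opt p t ht (cellMean t h) (fun i j => cellMean_congr)
  have hDt : ∑ i, (h i - cellMean t h i) ^ 2 =
      ∑ a ∈ Finset.range p, ∑ i ∈ cell t a, (h i - avg (cell t a) h) ^ 2 := by
    rw [← sum_cells ht.lt]
    refine Finset.sum_congr rfl fun a _ => Finset.sum_congr rfl fun i hi => ?_
    rw [cellMean, mem_cell.1 hi]
  -- the end points and the window of each cell
  have hex : ∀ a, (cell t a).Nonempty → ∃ i₁ i₂ : Fin n, ∃ s k : ℕ, i₁ ∈ cell t a ∧ i₂ ∈ cell t a ∧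
      (∀ i ∈ cell t a, i₁ ≤ i) ∧ (∀ i ∈ cell t a, i ≤ i₂) ∧ s ≤ n ∧ k ≤ n ∧
      cell t a ⊆ window n s k ∧ (cell t a).card ≤ 2 ^ (s + 1) ∧
      2 ^ (s + 1) ≤ 4 * (cell t a).card := by
    intro a hne
    have h1 := (cell t a).min'_mem hne
    have h2 := (cell t a).max'_mem hne
    obtain ⟨s, k, hsk⟩ := exists_window (I := cell t a) ((cell t a).min'_le_max' hne) (by
      intro i
      refine ⟨fun hi => ⟨(cell t a).min'_le i hi, (cell t a).le_max' i hi⟩, fun hi => ?_⟩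
      have h3 := ht.mono hi.1
      have h4 := ht.mono hi.2
      rw [mem_cell] at h1 h2 ⊢
      omega)
    exact ⟨_, _, s, k, h1, h2, fun i hi => (cell t a).min'_le i hi,
      fun i hi => (cell t a).le_max' i hi, hsk⟩
  rcases isEmpty_or_nonempty (Fin n) with hempty | hnonempty
  · have h1 : ∀ a, cell t a = ∅ := fun a => Finset.eq_empty_of_isEmpty _
    have h2 : (0 : ℝ) ≤ ∑ k ∈ Finset.range q, (suf k + pre k) :=
      Finset.sum_nonneg fun k _ => add_nonneg (hsuf0 k) (hpre0 k)
    have h3 : (0 : ℝ) ≤ ∑ s ∈ Finset.range (n + 1), ∑ k ∈ Finset.range (n + 1), Hs s k :=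
      Finset.sum_nonneg fun s _ => Finset.sum_nonneg fun k _ => hHs0 s k
    simp only [h1, Finset.univ_eq_empty, Finset.sum_empty, Finset.sum_const, Finset.card_range,
      nsmul_eq_mul] at hopt ⊢
    have : (0 : ℝ) ≤ p * (T + 41 / 10 * b₀ + v) := by positivity
    nlinarith
  choose! lo hi sc kc hlo hhi hmin hmax hsc hkc hsub hc1 hc2 using hex
  set S := (Finset.range p).filter fun a => (cell t a).Nonempty with hS
  have hSmem : ∀ a ∈ S, (cell t a).Nonempty := fun a ha => (Finset.mem_filter.1 ha).2
  have hzero : ∀ φ : Fin n → ℝ, ∑ a ∈ S, ∑ i ∈ cell t a, φ i = ∑ i, φ i := by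
    intro φ
    rw [← sum_cells ht.lt, hS, Finset.sum_filter]
    refine Finset.sum_congr rfl fun a _ => ?_
    split_ifs with h1
    · rfl
    · rw [Finset.not_nonempty_iff_eq_empty.1 h1, Finset.sum_empty]
  -- the bound for each cell
  have hcell : ∀ a ∈ S, 2 * ∑ i ∈ cell t a, (h i - avg (cell t a) h) * x i
        - ∑ i ∈ cell t a, (h i - avg (cell t a) h) ^ 2 ≤
      2 * ∑ i ∈ cell t a, (h i - cellMean g h i) * x i
        + 5 * ∑ i ∈ cell t a, cellMean g x i ^ 2
        + (if g (lo a) < g (hi a) then suf (g (lo a)) + pre (g (hi a)) else 0)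
        + (T + 41 / 10 * b₀) + (v + Hs (sc a) (kc a))
        - 1 / 4 * ∑ i ∈ cell t a, (h i - avg (cell t a) h) ^ 2 := by
    intro a ha
    have hne := hSmem a ha
    have hwI : w ≤ ((cell t a).card : ℝ) := card_le_of_saturated hw hne (by
      intro i hi j hij
      rw [mem_cell] at hi ⊢
      rw [← ht.adm i j hij, hi])
    have hpiece : ∀ l : ℕ, ∀ i ∈ Finset.univ.filter (fun i => t i = a ∧ g i = l),
        ∀ k ∈ Finset.univ.filter (fun i => t i = a ∧ g i = l), ∀ j, i ≤ j → j ≤ k →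
        j ∈ Finset.univ.filter (fun i => t i = a ∧ g i = l) := by
      intro l i hi k hk j hij hjk
      simp only [Finset.mem_filter, Finset.mem_univ, true_and] at hi hk ⊢
      have h1 := ht.mono hij
      have h2 := ht.mono hjk
      have h3 := ho.mono hij
      have h4 := ho.mono hjk
      omega
    have hpsub : ∀ l : ℕ, Finset.univ.filter (fun i => t i = a ∧ g i = l) ⊆ cell t a := by
      intro l i hi
      simp only [Finset.mem_filter, Finset.mem_univ, true_and] at hi
      exact mem_cell.2 hi.1
    have h1 := ho.window_bound hb₀ ht hw (hlo a hne) (hhi a hne) (hmin a hne) (hmax a hne) hT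
      hsuf0 hpre0 hsuf hpre (H := v + Hs (sc a) (kc a)) (fun hF l l' =>
        hW.apply hb₀ hM0 hM (hsub a hne) hne hwI (hc1 a hne) (hc2 a hne) hF (hpsub l) (hpiece l)
          (hpsub l') (hpiece l'))
    have h2 : ∑ i with t i = a ∧ (g (lo a) < g i ∧ g i < g (hi a)), cellMean g x i ^ 2 ≤
        ∑ i ∈ cell t a, cellMean g x i ^ 2 := by
      refine Finset.sum_le_sum_of_subset_of_nonneg ?_ fun _ _ _ => sq_nonneg _
      intro i hi
      exact mem_cell.2 (Finset.mem_filter.1 hi).2.1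
    linarith
  -- the end pieces
  have hinj : ∀ a ∈ S, ∀ b ∈ S, a < b → g (lo a) < g (hi a) → g (lo b) < g (hi b) →
      g (lo a) < g (lo b) ∧ g (hi a) < g (hi b) := by
    intro a ha b hb hab h1 h2
    have ta := mem_cell.1 (hhi a (hSmem a ha))
    have tb := mem_cell.1 (hlo b (hSmem b hb))
    have h3 : hi a ≤ lo b := by
      by_contra hcon
      have := ht.mono (not_le.1 hcon).le
      omega
    have := ho.mono h3
    omega
  have hends : ∑ a ∈ S, (if g (lo a) < g (hi a) then suf (g (lo a)) + pre (g (hi a)) else 0) ≤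
      ∑ k ∈ Finset.range q, (suf k + pre k) := by
    rw [← Finset.sum_filter, Finset.sum_add_distrib, Finset.sum_add_distrib]
    have aux : ∀ (u : ℕ → Fin n) (φ : ℕ → ℝ), (∀ l, 0 ≤ φ l) →
        (∀ a ∈ S, ∀ b ∈ S, a < b → g (lo a) < g (hi a) → g (lo b) < g (hi b) →
          g (u a) < g (u b)) →
        ∑ a ∈ S.filter (fun a => g (lo a) < g (hi a)), φ (g (u a)) ≤
          ∑ k ∈ Finset.range q, φ k := by
      intro u φ hφ hu
      rw [← Finset.sum_image (s := S.filter fun a => g (lo a) < g (hi a)) (g := fun a => g (u a))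
        (f := φ)]
      · refine Finset.sum_le_sum_of_subset_of_nonneg ?_ fun l _ _ => hφ l
        intro l hl
        obtain ⟨a, _, rfl⟩ := Finset.mem_image.1 hl
        exact Finset.mem_range.2 (ho.lt _)
      · intro a ha b hb hab
        simp only [Finset.coe_filter, Set.mem_ofPred_eq] at ha hb
        rcases lt_trichotomy a b with h | h | h
        · have := hu a ha.1 b hb.1 h ha.2 hb.2
          simp only at hab; omega
        · exact h
        · have := hu b hb.1 a ha.1 h hb.2 ha.2
          simp only at hab; omega
    exact add_le_add (aux lo suf hsuf0 fun a ha b hb hab h1 h2 => (hinj a ha b hb hab h1 h2).1)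
      (aux hi pre hpre0 fun a ha b hb hab h1 h2 => (hinj a ha b hb hab h1 h2).2)
  -- the windows
  have hwin : ∑ a ∈ S, Hs (sc a) (kc a) ≤
      4 * ∑ s ∈ Finset.range (n + 1), ∑ k ∈ Finset.range (n + 1), Hs s k := by
    rw [← Finset.sum_product' (f := fun s k => Hs s k),
      ← Finset.sum_fiberwise_of_maps_to (t := Finset.range (n + 1) ×ˢ Finset.range (n + 1))
        (g := fun a => (sc a, kc a)) (by
          intro a ha
          have h1 := hsc a (hSmem a ha)
          have h2 := hkc a (hSmem a ha)
          simp only [Finset.mem_product, Finset.mem_range]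
          omega), Finset.mul_sum]
    refine Finset.sum_le_sum fun sk _ => ?_
    obtain ⟨s, k⟩ := sk
    set U := S.filter fun a => (sc a, kc a) = (s, k) with hU
    have hUeq : ∀ a ∈ U, a ∈ S ∧ sc a = s ∧ kc a = k := by
      intro a ha
      have := Finset.mem_filter.1 ha
      exact ⟨this.1, (Prod.mk.inj this.2).1, (Prod.mk.inj this.2).2⟩
    have hcardU : ∑ a ∈ U, (cell t a).card ≤ 2 ^ (s + 1) := by
      rw [← Finset.card_biUnion]
      · refine (Finset.card_le_card ?_).trans (card_window_le (n := n) s k)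
        intro i hi
        obtain ⟨a, ha, hia⟩ := Finset.mem_biUnion.1 hi
        obtain ⟨h1, h2, h3⟩ := hUeq a ha
        have := hsub a (hSmem a h1) hia
        rwa [h2, h3] at this
      · intro a _ b _ hab
        rw [Function.onFun, Finset.disjoint_left]
        intro i h1 h2
        exact hab ((mem_cell.1 h1).symm.trans (mem_cell.1 h2))
    -- The segments assigned to one window are disjoint, lie inside it and each fill at least a
    -- quarter of its nominal length.
    have hU4 : U.card * 2 ^ (s + 1) ≤ 4 * 2 ^ (s + 1) := by
      calc U.card * 2 ^ (s + 1) = ∑ a ∈ U, 2 ^ (s + 1) := by rw [Finset.sum_const, smul_eq_mul]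
        _ ≤ ∑ a ∈ U, 4 * (cell t a).card := by
            refine Finset.sum_le_sum fun a ha => ?_
            obtain ⟨h1, h2, h3⟩ := hUeq a ha
            have := hc2 a (hSmem a h1)
            rwa [h2] at this
        _ = 4 * ∑ a ∈ U, (cell t a).card := by rw [Finset.mul_sum]
        _ ≤ _ := Nat.mul_le_mul_left _ hcardU
    have hU4' : U.card ≤ 4 := Nat.le_of_mul_le_mul_right hU4 (by positivity)
    calc ∑ a ∈ U, Hs (sc a) (kc a) = ∑ a ∈ U, Hs s k :=
          Finset.sum_congr rfl fun a ha => by rw [(hUeq a ha).2.1, (hUeq a ha).2.2]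
      _ = U.card * Hs s k := by rw [Finset.sum_const, nsmul_eq_mul]
      _ ≤ 4 * Hs s k := by
          have := hHs0 s k
          gcongr
          exact_mod_cast hU4'
  have hsumS : ∑ a ∈ Finset.range p, (2 * ∑ i ∈ cell t a, (h i - avg (cell t a) h) * x i
        - ∑ i ∈ cell t a, (h i - avg (cell t a) h) ^ 2) =
      ∑ a ∈ S, (2 * ∑ i ∈ cell t a, (h i - avg (cell t a) h) * x i
        - ∑ i ∈ cell t a, (h i - avg (cell t a) h) ^ 2) := by
    rw [hS, Finset.sum_filter]
    refine Finset.sum_congr rfl fun a _ => ?_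
    split_ifs with h1
    · rfl
    · rw [Finset.not_nonempty_iff_eq_empty.1 h1]; simp
  have hDt' : ∑ a ∈ S, ∑ i ∈ cell t a, (h i - avg (cell t a) h) ^ 2 =
      ∑ i, (h i - cellMean t h i) ^ 2 := by
    rw [hDt, hS, Finset.sum_filter]
    refine Finset.sum_congr rfl fun a _ => ?_
    split_ifs with h1
    · rfl
    · rw [Finset.not_nonempty_iff_eq_empty.1 h1]; simp
  have hScard : (S.card : ℝ) ≤ p := by
    have := Finset.card_filter_le (Finset.range p) fun a => (cell t a).Nonempty
    rw [Finset.card_range] at this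
    exact_mod_cast this
  have htotal := Finset.sum_le_sum hcell
  rw [← hsumS] at htotal
  simp only [Finset.sum_add_distrib, Finset.sum_sub_distrib, ← Finset.mul_sum, hzero,
    Finset.sum_const, nsmul_eq_mul, Finset.card_range] at htotal hends ⊢
  rw [hDt'] at htotal
  -- The factor 87/20 is 41/10 from the individual segments plus 1/4 from a quarter of `hopt`.
  have hSb : (S.card : ℝ) * (T + 41 / 10 * b₀ + v) ≤ p * (T + 41 / 10 * b₀ + v) := by gcongr
  linarith

end Sum

end Histogram
end

noncomputable section
namespace Histogram

/-! ### Expected excess of the end pieces -/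

section PosSup

variable {ι : Type*}

/-- The positive part of a finite maximum. -/
def posSup (F : ι → ℝ) : ℝ := ⨆ i, max (F i) 0

lemma le_posSup [Finite ι] (F : ι → ℝ) (i : ι) : F i ≤ posSup F :=
  (le_max_left _ _).trans (le_ciSup (f := fun i => max (F i) 0) (Set.finite_range _).bddAbove i)

lemma posSup_nonneg (F : ι → ℝ) : 0 ≤ posSup F := Real.iSup_nonneg fun _ => le_max_right _ _

lemma exists_le_of_le_posSup [Finite ι] [Nonempty ι] {F : ι → ℝ} {y : ℝ} (hy : 0 < y) (h : y ≤ posSup F) :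
    ∃ i, y ≤ F i := by
  obtain ⟨i, hi⟩ := exists_eq_ciSup_of_finite (f := fun i => max (F i) 0)
  refine ⟨i, ?_⟩
  rw [posSup, ← hi] at h
  rcases le_max_iff.1 h with h | h
  · exact h
  · linarith

lemma measurable_posSup [Finite ι] {Ω : Type*} [MeasurableSpace Ω] {F : ι → Ω → ℝ}
    (hF : ∀ i, Measurable (F i)) : Measurable fun ω => posSup fun i => F i ω := by
  unfold posSup
  exact Measurable.iSup fun i => (hF i).max measurable_const

end PosSup

/-- The function z^m e^{-z} decreases for z ≥ m. This trades an exponential for a power while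
retaining the small constant e^{-a}. -/
lemma exp_neg_le_pow {z a : ℝ} (ha : 0 < a) (hz : a ≤ z) (m : ℕ) (hm : (m : ℝ) ≤ a) :
    Real.exp (-z) ≤ (a / z) ^ m * Real.exp (-a) := by
  have hz0 : 0 < z := ha.trans_le hz
  have h1 : z / a ≤ Real.exp (z / a - 1) := by
    have := Real.add_one_le_exp (z / a - 1); linarith
  have h2 : (z / a) ^ m ≤ Real.exp (z - a) := by
    calc (z / a) ^ m ≤ Real.exp (z / a - 1) ^ m := by gcongr
      _ = Real.exp (m * (z / a - 1)) := (Real.exp_nat_mul _ _).symm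
      _ ≤ Real.exp (z - a) := by
          apply Real.exp_le_exp.2
          have h3 : z / a - 1 = (z - a) / a := by field_simp
          rw [h3]
          calc (m : ℝ) * ((z - a) / a) ≤ a * ((z - a) / a) := by
                gcongr
            _ = z - a := by field_simp
  have h4 : Real.exp (-z) = Real.exp (-a) * Real.exp (-(z - a)) := by
    rw [← Real.exp_add]; ring_nf
  have h5 : Real.exp (-(z - a)) ≤ (a / z) ^ m := by
    rw [Real.exp_neg]
    have : (a / z) ^ m = ((z / a) ^ m)⁻¹ := by rw [← inv_pow, inv_div]
    rw [this]
    gcongr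
  rw [h4, mul_comm]
  gcongr

/-- Size of the expected excess of one end piece. -/
lemma excess_numeric {v c w d R Y₀ : ℝ} (hv : 0 < v) (hc : 0 ≤ c) (hw : 0 < w) (hd : 0 ≤ d)
    (hR : R = v + 7 * c ^ 2 / w) (hY₀ : 320 * R ≤ Y₀) :
    (20 * v + 2 * d * c) * Real.exp (-((Y₀ + d ^ 2 * w / 10) / (20 * v + 2 * d * c))) ≤
      84 * R ^ 3 / Y₀ ^ 2 := by
  obtain ⟨m, hm0, hm⟩ : ∃ m : ℝ, 0 ≤ m ∧ c = m * w := ⟨c / w, by positivity, by field_simp⟩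
  have hR' : R = v + 7 * (m ^ 2 * w) := by rw [hR, hm]; field_simp
  have hR0 : 0 < R := by rw [hR']; positivity
  have hY0 : 0 < Y₀ := by linarith
  set x := 20 * v + 2 * d * c with hx
  set Y := Y₀ + d ^ 2 * w / 10 with hY
  have hx0 : 0 < x := by positivity
  have hYY : Y₀ ≤ Y := by rw [hY]; have : 0 ≤ d ^ 2 * w / 10 := by positivity
                          linarith
  have hYp : 0 < Y := by linarith
  -- With c = mw, the cross term 28dmw is absorbed by w(d - 140m)²/10. What remains requires 320 ≥
  -- 280 for v and 320·7 ≥ 1960 for m²w.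
  have h14 : 14 * x ≤ Y := by
    have : 0 ≤ w * (d - 140 * m) ^ 2 := by positivity
    rw [hx, hY, hm]
    nlinarith
  have hx2 : x ^ 2 ≤ 143 / 25 * R * Y := by
    have h1 : 143 / 25 * R * (320 * R + d ^ 2 * w / 10) ≤ 143 / 25 * R * Y := by
      rw [hY]; gcongr
    refine le_trans ?_ h1
    rw [hx, hm, hR']
    have e1 : 0 ≤ v * w * (d - 70 * m) ^ 2 := by positivity
    have e2 : 0 ≤ v * w * m ^ 2 := by positivity
    have e3 : 0 ≤ w ^ 2 * m ^ 2 * d ^ 2 := by positivity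
    have e4 : 0 ≤ v ^ 2 := by positivity
    have e5 : 0 ≤ w ^ 2 * m ^ 4 := by positivity
    nlinarith
  -- Power six produces x⁷/Y⁶. One factor x is at most Y/14 and x⁶ is at most a multiple of (RY)³,
  -- so the result decays like R³/Y², which is summable over the levels Y used later.
  have hexp := exp_neg_le_pow (a := 14) (z := Y / x) (by norm_num)
    (by rw [le_div_iff₀ hx0]; exact h14) 6 (by norm_num)
  have he : Real.exp (-14) ≤ 1 / 2.7182 ^ 14 := by
    rw [Real.exp_neg, one_div]
    gcongr
    have h1 := Real.exp_one_gt_d9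
    calc (2.7182 : ℝ) ^ 14 ≤ Real.exp 1 ^ 14 := by gcongr; linarith
      _ = Real.exp 14 := by rw [← Real.exp_nat_mul]; norm_num
  have h6 : x ^ 6 ≤ (143 / 25 * R * Y) ^ 3 := by
    calc x ^ 6 = (x ^ 2) ^ 3 := by ring
      _ ≤ _ := by gcongr
  calc x * Real.exp (-(Y / x)) ≤ x * ((14 / (Y / x)) ^ 6 * Real.exp (-14)) := by gcongr
    _ ≤ x * ((14 / (Y / x)) ^ 6 * (1 / 2.7182 ^ 14)) := by gcongr
    _ = (14 * x) * x ^ 6 * (14 ^ 5 / 2.7182 ^ 14) / Y ^ 6 := by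
        field_simp
    _ ≤ Y * (143 / 25 * R * Y) ^ 3 * (14 ^ 5 / 2.7182 ^ 14) / Y ^ 6 := by gcongr
    _ = (143 / 25) ^ 3 * (14 ^ 5 / 2.7182 ^ 14) * R ^ 3 / Y ^ 2 := by field_simp
    _ ≤ 84 * R ^ 3 / Y ^ 2 := by gcongr; norm_num
    _ ≤ 84 * R ^ 3 / Y₀ ^ 2 := by gcongr

/-- Telescoping: each term is at most the product of the reciprocals of two consecutive
denominators. -/
lemma sum_inv_sq_le {A β : ℝ} (hA : 0 < A) (hβ : 0 < β) (m : ℕ) :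
    ∑ j ∈ Finset.range m, 1 / (A + β * ((j : ℝ) + 1)) ^ 2 ≤ 1 / (β * A) := by
  have key : ∑ j ∈ Finset.range m, 1 / (A + β * ((j : ℝ) + 1)) ^ 2 ≤
      1 / (β * A) - 1 / (β * (A + β * m)) := by
    induction m with
    | zero => simp
    | succ m ih =>
      rw [Finset.sum_range_succ]
      have h1 : 1 / (A + β * ((m : ℝ) + 1)) ^ 2 ≤
          1 / (β * (A + β * m)) - 1 / (β * (A + β * ((m + 1 : ℕ) : ℝ))) := by
        push_cast
        have e : 1 / (β * (A + β * m)) - 1 / (β * (A + β * (m + 1))) =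
            1 / ((A + β * m) * (A + β * (m + 1))) := by
          field_simp
          ring
        rw [e]
        apply one_div_le_one_div_of_le (by positivity)
        rw [pow_two]
        gcongr
        linarith
      linarith
  have : 0 ≤ 1 / (β * (A + β * m)) := by positivity
  linarith

lemma sum_comp_le_sum_range {S : Finset ℕ} {φ : ℕ → ℕ} {m : ℕ} (hφ : Set.InjOn φ S)
    (hm : ∀ k ∈ S, φ k < m) {f : ℕ → ℝ} (hf : ∀ j, 0 ≤ f j) :
    ∑ k ∈ S, f (φ k) ≤ ∑ j ∈ Finset.range m, f j := by
  rw [← Finset.sum_image (f := f) hφ]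
  refine Finset.sum_le_sum_of_subset_of_nonneg ?_ fun j _ _ => hf j
  intro j hj
  obtain ⟨k, hk, rfl⟩ := Finset.mem_image.1 hj
  exact Finset.mem_range.2 (hm k hk)

section Noise

variable {Ω : Type*} [mΩ : MeasurableSpace Ω] {P : Measure Ω} [IsProbabilityMeasure P] {n : ℕ}
  {X : Fin n → Ω → ℝ} {σ c : ℝ}

/-- Excess of the drifted partial sums over the subsets `B p` of size at least `w`. -/
def pieceExcess (B : Fin (n + 1) → Finset (Fin n)) (x : Fin n → ℝ) (w d Y : ℝ) : ℝ :=
  posSup fun p => if w ≤ ((B p).card : ℝ) then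
    2 * d * (∑ i ∈ B p, x i) - d ^ 2 / 5 * (B p).card - Y else 0

lemma pieceExcess_nonneg (B : Fin (n + 1) → Finset (Fin n)) (x : Fin n → ℝ) (w d Y : ℝ) :
    0 ≤ pieceExcess B x w d Y := posSup_nonneg _

lemma IndepNoise.measurable_pieceExcess (hX : IndepNoise P X σ c)
    (B : Fin (n + 1) → Finset (Fin n)) (w d Y : ℝ) :
    Measurable fun ω => pieceExcess B (fun i => X i ω) w d Y := by
  refine measurable_posSup fun p => ?_
  have := hX.measurable_sum (B p)
  split_ifs
  · fun_prop
  · exact measurable_const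

lemma IndepNoise.lintegral_pieceExcess_le (hX : IndepNoise P X σ c) (hσ : 0 < σ) (hc : 0 ≤ c)
    {B : Fin (n + 1) → Finset (Fin n)}
    (hB : ∀ θ ψ : ℝ, |θ| * c < 1 → θ ^ 2 * σ ^ 2 / (2 * (1 - |θ| * c)) ≤ ψ → ∀ t : ℝ,
      P {ω | ∃ p, t ≤ θ * (∑ i ∈ B p, X i ω) - ψ * (B p).card} ≤
        ENNReal.ofReal (Real.exp (-t)))
    {w : ℝ} (hw : 0 < w) (d : ℝ) {Y₀ R : ℝ} (hR : R = σ ^ 2 + 7 * c ^ 2 / w)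
    (hY₀ : 320 * R ≤ Y₀) :
    ∫⁻ ω, ENNReal.ofReal (pieceExcess B (fun i => X i ω) w d Y₀) ∂P ≤
      ENNReal.ofReal (84 * R ^ 3 / Y₀ ^ 2) := by
  set x := 20 * σ ^ 2 + 2 * |d| * c with hx
  have hx0 : 0 < x := by positivity
  -- For θ = 2ld this l gives 1 - |θ|c = 20lσ², so the log-Laplace bound per index is exactly
  -- ld²/10, half of the drift ld²/5. The other half, on at least w indices, yields the gain d²w/10
  -- that offsets the growth of x with |d|.
  set l := 1 / x with hl
  have hl0 : 0 < l := by positivity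
  have hlx : l * x = 1 := by rw [hl]; field_simp
  have h1 : |2 * l * d| * c = 1 - 20 * l * σ ^ 2 := by
    rw [abs_mul, abs_of_pos (by positivity)]
    have : l * (20 * σ ^ 2 + 2 * |d| * c) = 1 := hlx
    linarith
  have hpos : 0 < 20 * l * σ ^ 2 := by positivity
  have hψ : (2 * l * d) ^ 2 * σ ^ 2 / (2 * (1 - |2 * l * d| * c)) ≤ l * d ^ 2 / 10 := by
    rw [h1, div_le_iff₀ (by linarith)]
    apply le_of_eq; ring
  have htail : ∀ y : ℝ, 0 < y → P {ω | y ≤ pieceExcess B (fun i => X i ω) w d Y₀} ≤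
      ENNReal.ofReal (Real.exp (-(l * (Y₀ + d ^ 2 * w / 10))) * Real.exp (-(l * y))) := by
    intro y hy
    have h2 := hB (2 * l * d) (l * d ^ 2 / 10) (by linarith) hψ (l * (Y₀ + d ^ 2 * w / 10) + l * y)
    rw [neg_add, Real.exp_add] at h2
    refine (measure_mono ?_).trans h2
    intro ω hω
    obtain ⟨p, hp⟩ := exists_le_of_le_posSup hy hω
    refine ⟨p, ?_⟩
    by_cases hcard : w ≤ ((B p).card : ℝ)
    · rw [if_pos hcard] at hp
      have h3 := mul_le_mul_of_nonneg_left hp hl0.le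
      have h4 : l * d ^ 2 / 10 * w ≤ l * d ^ 2 / 10 * (B p).card := by gcongr
      linarith
    · rw [if_neg hcard] at hp
      linarith
  refine (lintegral_ofReal_le_of_tail (hX.measurable_pieceExcess B w d Y₀) (Real.exp_pos _).le
    hl0 htail).trans (ENNReal.ofReal_le_ofReal ?_)
  have h5 := excess_numeric (v := σ ^ 2) (by positivity) hc hw (abs_nonneg d) hR hY₀
  rw [sq_abs, ← hx] at h5
  refine le_trans (le_of_eq ?_) h5
  rw [hl]
  field_simp

/-- Total excess of the end pieces of the cell `l`. -/
def endExcess (B : ℕ → Fin (n + 1) → Finset (Fin n)) (S : ℕ → Finset ℕ) (μ : ℕ → ℝ)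
    (dist : ℕ → ℕ → ℕ) (w R : ℝ) (x : Fin n → ℝ) (l : ℕ) : ℝ :=
  ∑ k ∈ S l, (pieceExcess (B l) x w (1 * (μ l - μ k)) (320 * R + 7 / 5 * R * dist l k) +
    pieceExcess (B l) x w (2 * (μ l - μ k)) (320 * R + 7 / 5 * R * dist l k))

lemma endExcess_nonneg (B : ℕ → Fin (n + 1) → Finset (Fin n)) (S : ℕ → Finset ℕ) (μ : ℕ → ℝ)
    (dist : ℕ → ℕ → ℕ) (w R : ℝ) (x : Fin n → ℝ) (l : ℕ) :
    0 ≤ endExcess B S μ dist w R x l :=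
  Finset.sum_nonneg fun _ _ => add_nonneg (pieceExcess_nonneg _ _ _ _ _) (pieceExcess_nonneg _ _ _ _ _)

lemma IndepNoise.measurable_endExcess (hX : IndepNoise P X σ c)
    (B : ℕ → Fin (n + 1) → Finset (Fin n)) (S : ℕ → Finset ℕ) (μ : ℕ → ℝ)
    (dist : ℕ → ℕ → ℕ) (w R : ℝ) (l : ℕ) :
    Measurable fun ω => endExcess B S μ dist w R (fun i => X i ω) l :=
  Finset.measurable_fun_sum _ fun _ _ =>
    (hX.measurable_pieceExcess _ _ _ _).add (hX.measurable_pieceExcess _ _ _ _)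

lemma IndepNoise.lintegral_endExcess_le (hX : IndepNoise P X σ c) (hσ : 0 < σ) (hc : 0 ≤ c)
    {B : ℕ → Fin (n + 1) → Finset (Fin n)} {l : ℕ}
    (hB : ∀ θ ψ : ℝ, |θ| * c < 1 → θ ^ 2 * σ ^ 2 / (2 * (1 - |θ| * c)) ≤ ψ → ∀ t : ℝ,
      P {ω | ∃ p, t ≤ θ * (∑ i ∈ B l p, X i ω) - ψ * (B l p).card} ≤
        ENNReal.ofReal (Real.exp (-t)))
    {S : ℕ → Finset ℕ} {μ : ℕ → ℝ} {dist : ℕ → ℕ → ℕ} {w R : ℝ} (hw : 0 < w)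
    (hR : R = σ ^ 2 + 7 * c ^ 2 / w) (hdist : Set.InjOn (dist l) (S l))
    (hdist0 : ∀ k ∈ S l, 1 ≤ dist l k) :
    ∫⁻ ω, ENNReal.ofReal (endExcess B S μ dist w R (fun i => X i ω) l) ∂P ≤
      ENNReal.ofReal (3 / 8 * R) := by
  have hR0 : 0 < R := by rw [hR]; positivity
  have hY : ∀ k : ℕ, 320 * R ≤ 320 * R + 7 / 5 * R * (k : ℝ) := fun k => by
    have : 0 ≤ 7 / 5 * R * (k : ℝ) := by positivity
    linarith
  have e1 : ∀ ω, ENNReal.ofReal (endExcess B S μ dist w R (fun i => X i ω) l) =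
      ∑ k ∈ S l, (ENNReal.ofReal (pieceExcess (B l) (fun i => X i ω) w (1 * (μ l - μ k))
          (320 * R + 7 / 5 * R * dist l k)) +
        ENNReal.ofReal (pieceExcess (B l) (fun i => X i ω) w (2 * (μ l - μ k))
          (320 * R + 7 / 5 * R * dist l k))) := by
    intro ω
    rw [endExcess, ENNReal.ofReal_sum_of_nonneg fun k _ =>
      add_nonneg (pieceExcess_nonneg _ _ _ _ _) (pieceExcess_nonneg _ _ _ _ _)]
    exact Finset.sum_congr rfl fun k _ => ENNReal.ofReal_add (pieceExcess_nonneg _ _ _ _ _)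
      (pieceExcess_nonneg _ _ _ _ _)
  simp_rw [e1]
  have hm : ∀ d Y, Measurable fun ω => ENNReal.ofReal (pieceExcess (B l) (fun i => X i ω) w d Y) :=
    fun d Y => (hX.measurable_pieceExcess _ _ _ _).ennreal_ofReal
  rw [lintegral_finsetSum]
  swap
  · exact fun k _ => (hm _ _).add (hm _ _)
  have e2 : ∀ k ∈ S l, ∫⁻ ω, (ENNReal.ofReal (pieceExcess (B l) (fun i => X i ω) w
        (1 * (μ l - μ k)) (320 * R + 7 / 5 * R * dist l k)) +
      ENNReal.ofReal (pieceExcess (B l) (fun i => X i ω) w (2 * (μ l - μ k))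
        (320 * R + 7 / 5 * R * dist l k))) ∂P ≤
      ENNReal.ofReal (168 * R ^ 3 * (1 / (320 * R + 7 / 5 * R * dist l k) ^ 2)) := by
    intro k _
    rw [lintegral_add_left (hm _ _)]
    refine (add_le_add (hX.lintegral_pieceExcess_le hσ hc hB hw _ hR (hY _))
      (hX.lintegral_pieceExcess_le hσ hc hB hw _ hR (hY _))).trans (le_of_eq ?_)
    rw [← ENNReal.ofReal_add (by positivity) (by positivity)]
    congr 1
    ring
  refine (Finset.sum_le_sum e2).trans ?_
  rw [← ENNReal.ofReal_sum_of_nonneg fun k _ => by positivity]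
  apply ENNReal.ofReal_le_ofReal
  rw [← Finset.mul_sum]
  obtain ⟨m, hm⟩ : ∃ m, ∀ k ∈ S l, dist l k - 1 < m := by
    refine ⟨(S l).sup (dist l) + 1, fun k hk => ?_⟩
    have := Finset.le_sup (f := dist l) hk
    omega
  have h1 : ∑ k ∈ S l, 1 / (320 * R + 7 / 5 * R * (dist l k : ℝ)) ^ 2 ≤
      ∑ j ∈ Finset.range m, 1 / (320 * R + 7 / 5 * R * ((j : ℝ) + 1)) ^ 2 := by
    refine le_trans (le_of_eq ?_) (sum_comp_le_sum_range (S := S l) (φ := fun k => dist l k - 1)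
      (f := fun j : ℕ => 1 / (320 * R + 7 / 5 * R * ((j : ℝ) + 1)) ^ 2) ?_ hm
      fun j => by positivity)
    · refine Finset.sum_congr rfl fun k hk => ?_
      rw [Nat.cast_sub (hdist0 k hk)]
      simp
    · intro k hk k' hk' h
      have := hdist0 k hk
      have := hdist0 k' hk'
      simp only at h
      exact hdist hk hk' (by omega)
  -- The level grows by 7R/5 with each unit of distance between labels, so the sum over all other
  -- labels is of order R whatever their number.
  have h2 := sum_inv_sq_le (A := 320 * R) (β := 7 / 5 * R) (by positivity) (by positivity) m
  calc 168 * R ^ 3 * _ ≤ 168 * R ^ 3 * (1 / (7 / 5 * R * (320 * R))) := by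
        gcongr
        exact h1.trans h2
    _ = 3 / 8 * R := by field_simp; norm_num

end Noise

end Histogram
end

noncomputable section
namespace Histogram

/-! ### Local sizes of the residual and the excess at dyadic windows -/

section LocalSize

variable {n : ℕ}

/-- A geometric sum is at most twice its largest term. The induction carries the second bound
2^{S+1}, which is the useful one as long as the condition holds. -/
lemma sum_two_pow_le (M : ℝ) (hM : 0 ≤ M) (S : ℕ) :
    ∑ s ∈ Finset.range S, (if (2 : ℝ) ^ (s + 1) ≤ M then (2 : ℝ) ^ (s + 1) else 0) ≤ 2 * M := by
  have key : ∑ s ∈ Finset.range S, (if (2 : ℝ) ^ (s + 1) ≤ M then (2 : ℝ) ^ (s + 1) else 0) ≤ 2 * M ∧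
      ∑ s ∈ Finset.range S, (if (2 : ℝ) ^ (s + 1) ≤ M then (2 : ℝ) ^ (s + 1) else 0) ≤ 2 ^ (S + 1) := by
    induction S with
    | zero => simp [hM]
    | succ S ih =>
      rw [Finset.sum_range_succ]
      have : (2 : ℝ) ^ (S + 1 + 1) = 2 * 2 ^ (S + 1) := by rw [pow_succ]; ring
      have h0 : (0 : ℝ) < 2 ^ (S + 1) := by positivity
      split_ifs with h
      · constructor <;> linarith
      · constructor <;> linarith
  exact key.1

/-- A geometric series whose ratio 1/√2 is at most 3/4, so it is at most four times its first term.
The induction is made possible by subtracting the next term inside the bound. -/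
lemma sum_inv_sqrt_two_pow_le {y : ℝ} (hy : 0 < y) (S : ℕ) :
    ∑ s ∈ Finset.range S, (if y < Real.sqrt (2 ^ (s + 1)) then 1 / Real.sqrt (2 ^ (s + 1)) else 0)
      ≤ 4 / y := by
  have hratio : ∀ s : ℕ, 1 / Real.sqrt ((2 : ℝ) ^ (s + 1 + 1)) ≤
      3 / 4 * (1 / Real.sqrt (2 ^ (s + 1))) := by
    intro s
    have h1 : Real.sqrt ((2 : ℝ) ^ (s + 1 + 1)) = Real.sqrt (2 ^ (s + 1)) * Real.sqrt 2 := by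
      rw [pow_succ, Real.sqrt_mul (by positivity)]
    have h2 : (4 / 3 : ℝ) ≤ Real.sqrt 2 := by
      apply Real.le_sqrt_of_sq_le; norm_num
    have h3 : 0 < Real.sqrt ((2 : ℝ) ^ (s + 1)) := Real.sqrt_pos.2 (by positivity)
    rw [h1]
    calc 1 / (Real.sqrt (2 ^ (s + 1)) * Real.sqrt 2) ≤ 1 / (Real.sqrt (2 ^ (s + 1)) * (4 / 3)) := by
          gcongr
      _ = _ := by field_simp
  have key : ∑ s ∈ Finset.range S, (if y < Real.sqrt (2 ^ (s + 1)) then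
      1 / Real.sqrt (2 ^ (s + 1)) else 0) ≤ 4 * max 0 (1 / y - 1 / Real.sqrt (2 ^ (S + 1))) := by
    induction S with
    | zero => simp
    | succ S ih =>
      rw [Finset.sum_range_succ]
      have hr := hratio S
      have h3 : 0 < Real.sqrt ((2 : ℝ) ^ (S + 1)) := Real.sqrt_pos.2 (by positivity)
      have hpos : 0 < 1 / Real.sqrt ((2 : ℝ) ^ (S + 1)) := by positivity
      split_ifs with h
      · have h4 : 1 / Real.sqrt (2 ^ (S + 1)) < 1 / y := one_div_lt_one_div_of_lt hy h
        rw [max_eq_right (by linarith)] at ih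
        rw [max_eq_right (by linarith)]
        linarith
      · have h4 : 1 / y ≤ 1 / Real.sqrt (2 ^ (S + 1)) := one_div_le_one_div_of_le h3 (not_lt.1 h)
        rw [max_eq_left (by linarith)] at ih
        have := le_max_left 0 (1 / y - 1 / Real.sqrt ((2 : ℝ) ^ (S + 1 + 1)))
        linarith
  refine key.trans ?_
  have : max 0 (1 / y - 1 / Real.sqrt ((2 : ℝ) ^ (S + 1))) ≤ 1 / y := by
    apply max_le (by positivity)
    have : 0 ≤ 1 / Real.sqrt ((2 : ℝ) ^ (S + 1)) := by positivity
    linarith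
  calc _ ≤ 4 * (1 / y) := by gcongr
    _ = 4 / y := by ring

/-- At a given scale a point belongs to at most two windows. -/
lemma sum_windows_le (s K : ℕ) (φ : Fin n → ℝ) (hφ : ∀ i, 0 ≤ φ i) :
    ∑ k ∈ Finset.range K, ∑ i ∈ window n s k, φ i ≤ 2 * ∑ i, φ i := by
  classical
  simp only [window, Finset.sum_filter]
  rw [Finset.sum_comm, Finset.mul_sum]
  refine Finset.sum_le_sum fun i _ => ?_
  rw [← Finset.sum_filter, Finset.sum_const, nsmul_eq_mul]
  have hsub : (Finset.range K).filter (fun k => k * 2 ^ s ≤ i.val ∧ i.val < (k + 2) * 2 ^ s) ⊆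
      {i.val / 2 ^ s, i.val / 2 ^ s - 1} := by
    intro k hk
    simp only [Finset.mem_filter] at hk
    have h1 : k ≤ i.val / 2 ^ s := (Nat.le_div_iff_mul_le (by positivity)).2 hk.2.1
    have h2 : i.val / 2 ^ s < k + 2 := (Nat.div_lt_iff_lt_mul (by positivity)).2 hk.2.2
    simp only [Finset.mem_insert, Finset.mem_singleton]
    omega
  have hcard := (Finset.card_le_card hsub).trans (Finset.card_le_two)
  have := hφ i
  gcongr
  exact_mod_cast hcard

/-- The cut-off is kept only on y, which makes its contribution linear in y; x keeps its fourth
power. -/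
lemma min_add_pow_four_le {a x y : ℝ} (ha : 0 ≤ a) (hx : 0 ≤ x) (hy : 0 ≤ y) :
    min a (x + y) ^ 4 ≤ 8 * x ^ 4 + 8 * a ^ 3 * y := by
  have h1 : min a (x + y) ≤ x + min a y := by
    rcases le_total a y with h | h
    · rw [min_eq_left h]; linarith [min_le_left a (x + y)]
    · rw [min_eq_right h]; exact min_le_right _ _
  have h2 : 0 ≤ min a (x + y) := le_min ha (by linarith)
  have h3 : 0 ≤ min a y := le_min ha hy
  have h4 : (x + min a y) ^ 4 ≤ 8 * (x ^ 4 + min a y ^ 4) := by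
    have := add_pow_le hx h3 4
    norm_num at this
    linarith
  have h5 : min a y ^ 4 ≤ a ^ 3 * y := by
    calc min a y ^ 4 = min a y ^ 3 * min a y := by ring
      _ ≤ a ^ 3 * y := by
          gcongr
          · exact min_le_left _ _
          · exact min_le_right _ _
  calc min a (x + y) ^ 4 ≤ (x + min a y) ^ 4 := by gcongr
    _ ≤ _ := by linarith

lemma sum_pow_four_le_card {ι : Type*} (Q : Finset ι) {u : ι → ℝ} (hu : ∀ i, 0 ≤ u i) :
    (∑ i ∈ Q, u i) ^ 4 ≤ (Q.card : ℝ) ^ 3 * ∑ i ∈ Q, u i ^ 4 := by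
  rcases Q.eq_empty_or_nonempty with rfl | h
  · simp
  · have h0 : (0 : ℝ) < Q.card := by exact_mod_cast h.card_pos
    have := pow_sum_div_card_le_sum_pow (s := Q) (f := u) (fun i _ => hu i) 3
    rw [div_le_iff₀ (by positivity)] at this
    rw [mul_comm]
    exact this

/-- The maximal-function type estimate for the local sizes. -/
lemma sum_localSize_pow_four_le {b₀ : ℝ} (hb₀ : 0 < b₀) (r : Fin n → ℝ) (S K : ℕ) :
    ∑ s ∈ Finset.range S, ∑ k ∈ Finset.range K, localSize b₀ r s k ^ 4 ≤
      384 * (2 * b₀) * ∑ i, r i ^ 2 := by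
  classical
  set a := Real.sqrt (2 * b₀) with ha
  have ha0 : 0 < a := Real.sqrt_pos.2 (by positivity)
  have ha2 : a ^ 2 = 2 * b₀ := Real.sq_sqrt (by positivity)
  set rt : ℕ → ℝ := fun s => Real.sqrt (2 ^ (s + 1)) with hrt
  have hrt0 : ∀ s, 0 < rt s := fun s => Real.sqrt_pos.2 (by positivity)
  have hrt2 : ∀ s, rt s ^ 2 = 2 ^ (s + 1) := fun s => Real.sq_sqrt (by positivity)
  -- At each scale the residual is split into a small and a large part, as in an interpolation
  -- argument. For a fixed point the small part only occurs at short scales, where 2^{s+1}u⁴ sums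
  -- geometrically, and the large part at long scales, where 1/√(2^{s+1}) does. Both sums are of
  -- order b₀ times the squared residual at that point, without any factor counting scales.
  set u : ℕ → Fin n → ℝ := fun s i => if |r i| * rt s ≤ a / 2 then |r i| else 0 with hu
  set v : ℕ → Fin n → ℝ := fun s i => if |r i| * rt s ≤ a / 2 then 0 else |r i| with hv
  have hu0 : ∀ s i, 0 ≤ u s i := fun s i => by simp only [hu]; split_ifs <;> positivity
  have hv0 : ∀ s i, 0 ≤ v s i := fun s i => by simp only [hv]; split_ifs <;> positivity
  have huv : ∀ s i, |r i| = u s i + v s i := fun s i => by simp only [hu, hv]; split_ifs <;> simp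
  have h1 : ∀ s k, localSize b₀ r s k ^ 4 ≤
      ∑ i ∈ window n s k, (128 * 2 ^ (s + 1) * u s i ^ 4 + 16 * a ^ 3 * (v s i / rt s)) := by
    intro s k
    set Q := window n s k
    have e1 : localSize b₀ r s k = min a (2 * ((∑ i ∈ Q, u s i) / rt s) +
        2 * ((∑ i ∈ Q, v s i) / rt s)) := by
      rw [localSize, ← ha]
      congr 1
      rw [Finset.sum_congr rfl fun i _ => huv s i, Finset.sum_add_distrib]
      ring
    have hsu : 0 ≤ ∑ i ∈ Q, u s i := Finset.sum_nonneg fun i _ => hu0 s i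
    have hsv : 0 ≤ ∑ i ∈ Q, v s i := Finset.sum_nonneg fun i _ => hv0 s i
    have hr := hrt0 s
    rw [e1]
    refine (min_add_pow_four_le ha0.le (by positivity) (by positivity)).trans ?_
    have e2 : ((∑ i ∈ Q, u s i) / rt s) ^ 4 ≤ 2 ^ (s + 1) * ∑ i ∈ Q, u s i ^ 4 := by
      have h3 : (∑ i ∈ Q, u s i) ^ 4 ≤ (Q.card : ℝ) ^ 3 * ∑ i ∈ Q, u s i ^ 4 :=
        sum_pow_four_le_card Q (hu0 s)
      have h4 : (Q.card : ℝ) ≤ 2 ^ (s + 1) := by exact_mod_cast card_window_le s k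
      have h5 : rt s ^ 4 = (2 ^ (s + 1)) ^ 2 := by rw [← hrt2]; ring
      have h6 : 0 ≤ ∑ i ∈ Q, u s i ^ 4 := Finset.sum_nonneg fun i _ => by positivity
      rw [div_pow, h5, div_le_iff₀ (by positivity)]
      calc (∑ i ∈ Q, u s i) ^ 4 ≤ (Q.card : ℝ) ^ 3 * ∑ i ∈ Q, u s i ^ 4 := h3
        _ ≤ (2 ^ (s + 1)) ^ 3 * ∑ i ∈ Q, u s i ^ 4 := by gcongr
        _ = _ := by ring
    rw [Finset.sum_add_distrib, ← Finset.mul_sum, ← Finset.mul_sum, ← Finset.sum_div]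
    calc _ = 128 * ((∑ i ∈ Q, u s i) / rt s) ^ 4 + 16 * a ^ 3 * ((∑ i ∈ Q, v s i) / rt s) := by ring
      _ ≤ _ := by linarith
  have h2 : ∀ s, ∑ k ∈ Finset.range K, localSize b₀ r s k ^ 4 ≤
      2 * ∑ i, (128 * 2 ^ (s + 1) * u s i ^ 4 + 16 * a ^ 3 * (v s i / rt s)) := by
    intro s
    refine (Finset.sum_le_sum fun k _ => h1 s k).trans (sum_windows_le s K _ fun i => ?_)
    have := hu0 s i
    have := hv0 s i
    have := hrt0 s
    positivity
  refine (Finset.sum_le_sum fun s _ => h2 s).trans ?_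
  rw [← Finset.mul_sum, Finset.sum_comm, Finset.mul_sum, Finset.mul_sum]
  refine Finset.sum_le_sum fun i _ => ?_
  rcases eq_or_ne (r i) 0 with h0 | h0
  · have e1 : ∀ s, u s i = 0 := fun s => by simp [hu, h0]
    have e2 : ∀ s, v s i = 0 := fun s => by simp [hv, h0]
    simp [e1, e2, h0]
  set ρ := |r i| with hρ
  have hρ0 : 0 < ρ := abs_pos.2 h0
  have hρ2 : r i ^ 2 = ρ ^ 2 := (sq_abs _).symm
  rw [Finset.sum_add_distrib, ← Finset.mul_sum]
  have e1 : ∑ s ∈ Finset.range S, 128 * 2 ^ (s + 1) * u s i ^ 4 ≤ 64 * a ^ 2 * ρ ^ 2 := by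
    have h3 : ∀ s, 128 * 2 ^ (s + 1) * u s i ^ 4 =
        128 * ρ ^ 4 * (if (2 : ℝ) ^ (s + 1) ≤ (a / (2 * ρ)) ^ 2 then (2 : ℝ) ^ (s + 1) else 0) := by
      intro s
      have h4 : |r i| * rt s ≤ a / 2 ↔ (2 : ℝ) ^ (s + 1) ≤ (a / (2 * ρ)) ^ 2 := by
        rw [← hrt2, sq_le_sq₀ (hrt0 s).le (by positivity), le_div_iff₀ (show 0 < 2 * ρ by positivity), ← hρ]
        constructor <;> intro h <;> linarith
      simp only [hu, h4]
      split_ifs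
      · ring
      · simp
    simp_rw [h3]
    rw [← Finset.mul_sum]
    calc _ ≤ 128 * ρ ^ 4 * (2 * (a / (2 * ρ)) ^ 2) := by
          gcongr
          exact sum_two_pow_le _ (by positivity) S
      _ = _ := by field_simp; norm_num
  have e2 : ∑ s ∈ Finset.range S, v s i / rt s ≤ 8 * ρ ^ 2 / a := by
    have h3 : ∀ s, v s i / rt s = ρ * (if a / (2 * ρ) < Real.sqrt (2 ^ (s + 1)) then
        1 / Real.sqrt (2 ^ (s + 1)) else 0) := by
      intro s
      have h4 : |r i| * rt s ≤ a / 2 ↔ ¬ (a / (2 * ρ) < Real.sqrt (2 ^ (s + 1))) := by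
        rw [not_lt, le_div_iff₀ (show 0 < 2 * ρ by positivity), ← hρ]
        simp only [hrt]
        constructor <;> intro h <;> linarith
      simp only [hv, h4]
      split_ifs with h5
      · simp only [hrt]; ring
      · simp
    simp_rw [h3]
    rw [← Finset.mul_sum]
    calc _ ≤ ρ * (4 / (a / (2 * ρ))) := by
          gcongr
          exact sum_inv_sqrt_two_pow_le (by positivity) S
      _ = _ := by field_simp; norm_num
  rw [hρ2, ← ha2]
  calc _ ≤ 2 * (64 * a ^ 2 * ρ ^ 2 + 16 * a ^ 3 * (8 * ρ ^ 2 / a)) := by gcongr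
    _ = _ := by field_simp; norm_num

end LocalSize

section Noise

variable {Ω : Type*} [mΩ : MeasurableSpace Ω] {P : Measure Ω} [IsProbabilityMeasure P] {n : ℕ}
  {X : Fin n → Ω → ℝ} {σ c : ℝ}

/-- The largest absolute partial sum along a finite set of indices. -/
def maxPrefix (Q : Finset (Fin n)) (x : Fin n → ℝ) : ℝ :=
  posSup fun p : Fin (n + 1) => |∑ i ∈ Q with i.val < p.val, x i|

lemma maxPrefix_nonneg (Q : Finset (Fin n)) (x : Fin n → ℝ) : 0 ≤ maxPrefix Q x := posSup_nonneg _

lemma filter_val_lt_min (Q : Finset (Fin n)) (p : ℕ) :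
    (Q.filter fun i => i.val < p) = Q.filter fun i => i.val < min p n := by
  ext i
  have := i.isLt
  simp only [Finset.mem_filter]
  constructor <;> rintro ⟨h1, h2⟩ <;> exact ⟨h1, by omega⟩

lemma le_maxPrefix (Q : Finset (Fin n)) (x : Fin n → ℝ) (p : ℕ) :
    |∑ i ∈ Q with i.val < p, x i| ≤ maxPrefix Q x := by
  rw [filter_val_lt_min]
  exact le_posSup (fun p : Fin (n + 1) => |∑ i ∈ Q with i.val < p.val, x i|)
    ⟨min p n, Nat.lt_succ_of_le (min_le_right _ _)⟩

lemma IndepNoise.measurable_maxPrefix (hX : IndepNoise P X σ c) (Q : Finset (Fin n)) :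
    Measurable fun ω => maxPrefix Q fun i => X i ω :=
  measurable_posSup fun p => by
    have := hX.measurable_sum (Q.filter fun i => i.val < p.val)
    fun_prop

/-- Excess of the maximal partial sum at a window of nominal length `N`. -/
def windowExcess (Q : Finset (Fin n)) (x : Fin n → ℝ) (w N α v : ℝ) : ℝ :=
  if w ≤ N then max (16 * α * maxPrefix Q x / Real.sqrt N - v) 0 else 0

lemma windowExcess_nonneg (Q : Finset (Fin n)) (x : Fin n → ℝ) (w N α v : ℝ) :
    0 ≤ windowExcess Q x w N α v := by
  unfold windowExcess; split_ifs
  · exact le_max_right _ _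
  · exact le_rfl

lemma IndepNoise.measurable_windowExcess (hX : IndepNoise P X σ c) (Q : Finset (Fin n))
    (w N α v : ℝ) : Measurable fun ω => windowExcess Q (fun i => X i ω) w N α v := by
  have := hX.measurable_maxPrefix Q
  unfold windowExcess
  split_ifs
  · fun_prop
  · exact measurable_const

lemma IndepNoise.lintegral_windowExcess_le (hX : IndepNoise P X σ c) (hσ : 0 < σ) (hc : 0 ≤ c)
    {w R : ℝ} (hw : 0 < w) (hR : R = σ ^ 2 + 7 * c ^ 2 / w) {Q : Finset (Fin n)} {N : ℝ}
    (hN : (Q.card : ℝ) ≤ N) {α : ℝ} (hα : 0 ≤ α) (hαR : α ≤ Real.sqrt (56 * R)) :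
    ∫⁻ ω, ENNReal.ofReal (windowExcess Q (fun i => X i ω) w N α (830 * R)) ∂P ≤
      ENNReal.ofReal (3 / 2 / 10 ^ 6 * α ^ 4 / R) := by
  have hR0 : 0 < R := by rw [hR]; positivity
  by_cases hwN : w ≤ N
  swap
  · simp [windowExcess, hwN]
  rcases eq_or_lt_of_le hα with hα0 | hα0
  · have : ∀ ω, windowExcess Q (fun i => X i ω) w N α (830 * R) = 0 := by
      intro ω
      rw [windowExcess, if_pos hwN, ← hα0]
      apply max_eq_right
      simp only [mul_zero, zero_mul, zero_div, zero_sub]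
      linarith
    simp [this]
  have hN0 : 0 < N := hw.trans_le hwN
  set sR := Real.sqrt R with hsR
  set sN := Real.sqrt N with hsN
  have hsR0 : 0 < sR := Real.sqrt_pos.2 hR0
  have hsN0 : 0 < sN := Real.sqrt_pos.2 hN0
  have hsR2 : sR ^ 2 = R := Real.sq_sqrt hR0.le
  have hsN2 : sN ^ 2 = N := Real.sq_sqrt hN0.le
  -- Calibrated to the typical size √(RN) of the maximal partial sum over N indices: the line of
  -- slope 5/(2N) then rises by at most 5/2 over the window.
  set θ := 2 / (sR * sN) with hθ
  have hθ0 : 0 < θ := by positivity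
  -- the line-crossing conditions
  set ρ := c / (sR * sN) with hρ
  have hρ0 : 0 ≤ ρ := by positivity
  have hθc : θ * c = 2 * ρ := by rw [hθ, hρ]; ring
  have hρ2 : σ ^ 2 / R + 7 * ρ ^ 2 ≤ 1 := by
    have e1 : ρ ^ 2 = c ^ 2 / (R * N) := by rw [hρ, div_pow, mul_pow, hsR2, hsN2]
    have e2 : c ^ 2 / N ≤ c ^ 2 / w := by gcongr
    have e3 : σ ^ 2 / R + 7 * (c ^ 2 / (R * N)) = (σ ^ 2 + 7 * (c ^ 2 / N)) / R := by field_simp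
    rw [e1, e3, div_le_one hR0]
    calc _ ≤ σ ^ 2 + 7 * (c ^ 2 / w) := by linarith
      _ = R := by rw [hR]; ring
  have hσR : 0 < σ ^ 2 / R := by positivity
  have h1 : θ * c < 1 := by rw [hθc]; nlinarith
  have h2 : θ ^ 2 * σ ^ 2 / (2 * (1 - θ * c)) ≤ 5 / (2 * N) := by
    have e1 : θ ^ 2 = 4 / (R * N) := by rw [hθ, div_pow, mul_pow, hsR2, hsN2]; norm_num
    have e2 : θ ^ 2 * σ ^ 2 = 4 * (σ ^ 2 / R) / N := by rw [e1]; field_simp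
    rw [e2, div_le_iff₀ (by linarith)]
    have e3 : 5 / (2 * N) * (2 * (1 - θ * c)) = 5 * (1 - θ * c) / N := by field_simp
    rw [e3, hθc]
    apply div_le_div_of_nonneg_right _ hN0.le
    -- From σ²/R ≤ 1 - 7ρ², the claim follows from 28ρ² - 10ρ + 1 ≥ 0. The constant 7 in R makes
    -- this discriminant negative.
    nlinarith [sq_nonneg (28 * ρ - 5)]
  have hcross : ∀ z : ℝ, P {ω | ∃ p : ℕ, z ≤ |∑ i ∈ Q with i.val < p, X i ω|} ≤
      ENNReal.ofReal (2 * Real.exp (5 / 2 - θ * z)) := by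
    intro z
    have h3 := hX.prefix_crossing Q (θ := θ) (ψ := 5 / (2 * N)) (by rwa [abs_of_pos hθ0])
      (by rwa [abs_of_pos hθ0]) (θ * z - 5 / 2)
    have h4 := hX.prefix_crossing Q (θ := -θ) (ψ := 5 / (2 * N))
      (by rwa [abs_neg, abs_of_pos hθ0]) (by rwa [abs_neg, neg_sq, abs_of_pos hθ0]) (θ * z - 5 / 2)
    have hcard : ∀ p : ℕ, 5 / (2 * N) * ((Q.filter fun i => i.val < p).card : ℝ) ≤ 5 / 2 := by
      intro p
      have : ((Q.filter fun i => i.val < p).card : ℝ) ≤ N := by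
        refine le_trans ?_ hN
        exact_mod_cast Finset.card_filter_le _ _
      calc _ ≤ 5 / (2 * N) * N := by gcongr
        _ = 5 / 2 := by field_simp
    have hsub : {ω | ∃ p : ℕ, z ≤ |∑ i ∈ Q with i.val < p, X i ω|} ⊆
        {ω | ∃ p : ℕ, θ * z - 5 / 2 ≤ θ * (∑ i ∈ Q with i.val < p, X i ω) -
          5 / (2 * N) * (Q.filter fun i => i.val < p).card} ∪
        {ω | ∃ p : ℕ, θ * z - 5 / 2 ≤ -θ * (∑ i ∈ Q with i.val < p, X i ω) -
          5 / (2 * N) * (Q.filter fun i => i.val < p).card} := by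
      rintro ω ⟨p, hp⟩
      have h5 := hcard p
      rcases le_abs.1 hp with h | h
      · left
        refine ⟨p, ?_⟩
        have := mul_le_mul_of_nonneg_left h hθ0.le
        linarith
      · right
        refine ⟨p, ?_⟩
        have := mul_le_mul_of_nonneg_left h hθ0.le
        linarith
    refine (measure_mono hsub).trans ((measure_union_le _ _).trans ((add_le_add h3 h4).trans ?_))
    rw [← ENNReal.ofReal_add (Real.exp_pos _).le (Real.exp_pos _).le, ← two_mul, neg_sub]
  have htail : ∀ y : ℝ, 0 < y →
      P {ω | y ≤ windowExcess Q (fun i => X i ω) w N α (830 * R)} ≤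
      ENNReal.ofReal (2 * Real.exp (5 / 2 - 830 * R / (8 * α * sR)) *
        Real.exp (-(1 / (8 * α * sR) * y))) := by
    intro y hy
    refine le_trans (measure_mono ?_) ((hcross ((y + 830 * R) * sN / (16 * α))).trans (le_of_eq ?_))
    · intro ω hω
      have hω : y ≤ windowExcess Q (fun i => X i ω) w N α (830 * R) := hω
      rw [windowExcess, if_pos hwN] at hω
      rcases le_max_iff.1 hω with h | h
      · have h3 : (y + 830 * R) * sN / (16 * α) ≤ maxPrefix Q fun i => X i ω := by
          rw [div_le_iff₀ (by positivity)]
          have : y + 830 * R ≤ 16 * α * maxPrefix Q (fun i => X i ω) / sN := by linarith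
          rw [le_div_iff₀ hsN0] at this
          linarith
        obtain ⟨p, hp⟩ := exists_le_of_le_posSup (by positivity) h3
        exact ⟨p.val, hp⟩
      · linarith
    · rw [mul_assoc, ← Real.exp_add]
      congr 3
      rw [hθ]
      field_simp
      ring
  refine (lintegral_ofReal_le_of_tail (hX.measurable_windowExcess Q w N α _) (by positivity)
    (by positivity) htail).trans (ENNReal.ofReal_le_ofReal ?_)
  have hα7 : α ≤ 15 / 2 * sR := by
    refine hαR.trans ?_
    rw [Real.sqrt_mul (by norm_num)]
    gcongr
    rw [Real.sqrt_le_left (by norm_num)]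
    norm_num
  set z := 830 * R / (8 * α * sR) with hz
  have hz' : z = 415 / 4 * sR / α := by
    rw [hz, ← hsR2]; field_simp; norm_num
  have hz13 : 13 ≤ z := by
    rw [hz', le_div_iff₀ hα0]
    linarith
  -- Since z is a multiple of √R/α, the third power turns the prefactor α√R into α⁴/R, which is the
  -- homogeneity summed by `sum_localSize_pow_four_le`.
  have he := exp_neg_le_pow (a := 13) (by norm_num) hz13 3 (by norm_num)
  have he2 : Real.exp (5 / 2) * Real.exp (-13) ≤ 1 / 2.718 ^ 10 := by
    rw [← Real.exp_add]
    calc Real.exp (5 / 2 + -13) ≤ Real.exp (-10) := Real.exp_le_exp.2 (by norm_num)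
      _ ≤ 1 / 2.718 ^ 10 := by
          rw [Real.exp_neg, one_div]
          gcongr
          have h1 := Real.exp_one_gt_d9
          calc (2.718 : ℝ) ^ 10 ≤ Real.exp 1 ^ 10 := by gcongr; linarith
            _ = Real.exp 10 := by rw [← Real.exp_nat_mul]; norm_num
  rw [sub_eq_add_neg, Real.exp_add]
  calc 2 * (Real.exp (5 / 2) * Real.exp (-z)) / (1 / (8 * α * sR))
      ≤ 2 * (Real.exp (5 / 2) * ((13 / z) ^ 3 * Real.exp (-13))) / (1 / (8 * α * sR)) := by gcongr
    _ = 16 * α * sR * (13 / z) ^ 3 * (Real.exp (5 / 2) * Real.exp (-13)) := by field_simp; ring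
    _ ≤ 16 * α * sR * (13 / z) ^ 3 * (1 / 2.718 ^ 10) := by
        have : 0 < z := by linarith
        gcongr
    _ = 16 * (52 / 415) ^ 3 / 2.718 ^ 10 * α ^ 4 / R := by
        rw [hz', ← hsR2]; field_simp; norm_num
    _ ≤ 3 / 2 / 10 ^ 6 * α ^ 4 / R := by
        have h3 : (16 * (52 / 415) ^ 3 / 2.718 ^ 10 : ℝ) ≤ 3 / 2 / 10 ^ 6 := by norm_num
        exact div_le_div_of_nonneg_right (mul_le_mul_of_nonneg_right h3 (by positivity)) hR0.le

/-- Expected squared norm of the projected noise. -/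
lemma IndepNoise.integral_sum_cellMean_sq_le (hX : IndepNoise P X σ c) (hc : 0 ≤ c)
    {g : Fin n → ℕ} {q : ℕ} (hg : ∀ i, g i < q) :
    Integrable (fun ω => ∑ i, cellMean g (fun j => X j ω) i ^ 2) P ∧
      ∫ ω, ∑ i, cellMean g (fun j => X j ω) i ^ 2 ∂P ≤ q * σ ^ 2 := by
  have e1 : ∀ ω, ∑ i, cellMean g (fun j => X j ω) i ^ 2 =
      ∑ k ∈ Finset.range q, (1 / (cell g k).card) * (∑ i ∈ cell g k, X i ω) ^ 2 := by
    intro ω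
    rw [← sum_cells hg]
    refine Finset.sum_congr rfl fun k _ => ?_
    rw [Finset.sum_congr rfl fun i hi => show cellMean g (fun j => X j ω) i ^ 2 =
      avg (cell g k) (fun j => X j ω) ^ 2 by rw [cellMean, mem_cell.1 hi], Finset.sum_const,
      nsmul_eq_mul, avg]
    rcases (cell g k).eq_empty_or_nonempty with h | h
    · simp [h]
    · have : ((cell g k).card : ℝ) ≠ 0 := by exact_mod_cast h.card_ne_zero
      field_simp
  have hi : ∀ k, Integrable (fun ω => (1 / ((cell g k).card : ℝ)) * (∑ i ∈ cell g k, X i ω) ^ 2) P :=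
    fun k => ((hX.subGamma_sum _).integrable_sq (hX.measurable_sum _) hc).const_mul _
  simp_rw [e1]
  refine ⟨integrable_finsetSum _ fun k _ => hi k, ?_⟩
  rw [integral_finsetSum _ fun k _ => hi k]
  have : ∀ k ∈ Finset.range q, ∫ ω, (1 / ((cell g k).card : ℝ)) * (∑ i ∈ cell g k, X i ω) ^ 2 ∂P ≤
      σ ^ 2 := by
    intro k _
    rw [integral_const_mul]
    have h1 := (hX.subGamma_sum (cell g k)).integral_sq_le (hX.measurable_sum _) hc (by positivity)
    rcases (cell g k).eq_empty_or_nonempty with h | h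
    · simp [h]; positivity
    · have h0 : (0 : ℝ) < (cell g k).card := by exact_mod_cast h.card_pos
      rw [one_div, inv_mul_le_iff₀ h0]
      linarith
  refine (Finset.sum_le_sum this).trans ?_
  simp

end Noise

end Histogram
end

/-! ### Maximal inequality over all segmentations -/

noncomputable section
namespace Histogram

lemma integrable_of_lintegral_ofReal_le {Ω : Type*} [MeasurableSpace Ω] {P : Measure Ω}
    {F : Ω → ℝ} (hF : Measurable F) (h0 : ∀ ω, 0 ≤ F ω) {b : ℝ} (hb : 0 ≤ b)
    (h : ∫⁻ ω, ENNReal.ofReal (F ω) ∂P ≤ ENNReal.ofReal b) :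
    Integrable F P ∧ ∫ ω, F ω ∂P ≤ b := by
  have h0' : 0 ≤ᵐ[P] F := Filter.Eventually.of_forall h0
  refine ⟨⟨hF.aestronglyMeasurable, ?_⟩, ?_⟩
  · rw [hasFiniteIntegral_iff_ofReal h0']
    exact h.trans_lt ENNReal.ofReal_lt_top
  · rw [integral_eq_lintegral_of_nonneg_ae h0' hF.aestronglyMeasurable]
    exact ENNReal.toReal_le_of_le_ofReal hb h

lemma integral_combination {Ω : Type*} [MeasurableSpace Ω] {P : Measure Ω}
    [IsProbabilityMeasure P] {A B C E : Ω → ℝ} (hA : Integrable A P) (hB : Integrable B P)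
    (hC : Integrable C P) (hE : Integrable E P) (α β γ k : ℝ) :
    Integrable (fun ω => α * A ω + β * B ω + C ω + γ * E ω - k) P ∧
      ∫ ω, (α * A ω + β * B ω + C ω + γ * E ω - k) ∂P =
        α * ∫ ω, A ω ∂P + β * ∫ ω, B ω ∂P + ∫ ω, C ω ∂P + γ * ∫ ω, E ω ∂P - k := by
  have h1 : Integrable (fun ω => α * A ω) P := hA.const_mul α
  have h2 : Integrable (fun ω => β * B ω) P := hB.const_mul β
  have h3 : Integrable (fun ω => γ * E ω) P := hE.const_mul γ
  have h4 : Integrable (fun ω => α * A ω + β * B ω) P := h1.add h2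
  have h5 : Integrable (fun ω => α * A ω + β * B ω + C ω) P := h4.add hC
  have h6 : Integrable (fun ω => α * A ω + β * B ω + C ω + γ * E ω) P := h5.add h3
  refine ⟨h6.sub (integrable_const k), ?_⟩
  rw [integral_sub h6 (integrable_const k), integral_add h5 h3, integral_add h4 hC,
    integral_add h1 h2, integral_const_mul, integral_const_mul, integral_const_mul]
  simp

section Noise

variable {Ω : Type*} [mΩ : MeasurableSpace Ω] {P : Measure Ω} [IsProbabilityMeasure P] {n : ℕ}
  {X : Fin n → Ω → ℝ} {σ c : ℝ}

/-- A maximal inequality over all segmentations, free of the number of points: the supremum of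
the linear forms minus the squared bias minus a penalty per segment has nonpositive mean. -/
theorem IndepNoise.segmentation_bound (hX : IndepNoise P X σ c) (hσ : 0 < σ) (hc : 0 ≤ c)
    (e : Fin n → ℕ) {w : ℝ} (hw0 : 0 < w) (hw : ∀ i, w ≤ ((cell e (e i)).card : ℝ)) {R : ℝ}
    (hR : R = σ ^ 2 + 7 * c ^ 2 / w) (h : Fin n → ℝ) :
    ∃ Z : Ω → ℝ, Integrable Z P ∧ ∫ ω, Z ω ∂P ≤ 0 ∧
      ∀ ω, ∀ p t, IsLabeling e p t →
        ∑ a ∈ Finset.range p, (2 * ∑ i ∈ cell t a, (h i - avg (cell t a) h) * X i ω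
          - ∑ i ∈ cell t a, (h i - avg (cell t a) h) ^ 2 - 1280 * R) ≤ Z ω := by
  have hR0 : 0 < R := by rw [hR]; positivity
  have hσR : σ ^ 2 ≤ R := by rw [hR]; have : 0 ≤ 7 * c ^ 2 / w := by positivity
                             linarith
  -- A quarter of 28R gives 7R per label, above the 5R of projected noise plus 3R/4 of end pieces.
  -- It also makes the cut-off √(2b₀) equal to √(56R) and the distance allowance b₀/20 equal to
  -- 7R/5.
  obtain ⟨q, g, ho⟩ := exists_isOptimal h e (b₀ := 28 * R) (by positivity)
  set μ : ℕ → ℝ := fun k => avg (cell g k) h with hμ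
  set r : Fin n → ℝ := fun i => h i - cellMean g h i with hr
  set Bs : ℕ → Fin (n + 1) → Finset (Fin n) := fun l p =>
    (cell g l).filter fun i => p.val ≤ i.val with hBs
  set Bp : ℕ → Fin (n + 1) → Finset (Fin n) := fun l p =>
    (cell g l).filter fun i => i.val < p.val with hBp
  set Ss : ℕ → Finset ℕ := fun l => (Finset.range q).filter fun k => l < k with hSs
  set suf : ℕ → Ω → ℝ := fun l ω =>
    endExcess Bs Ss μ (fun l k => k - l) w R (fun i => X i ω) l with hsuf
  set pre : ℕ → Ω → ℝ := fun l ω =>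
    endExcess Bp Finset.range μ (fun l k => l - k) w R (fun i => X i ω) l with hpre
  set Hs : ℕ → ℕ → Ω → ℝ := fun s k ω => windowExcess (window n s k) (fun i => X i ω) w
    (2 ^ (s + 1)) (localSize (28 * R) r s k) (830 * R) with hHs
  have hsuf0 : ∀ l ω, 0 ≤ suf l ω := fun l ω => endExcess_nonneg _ _ _ _ _ _ _ _
  have hpre0 : ∀ l ω, 0 ≤ pre l ω := fun l ω => endExcess_nonneg _ _ _ _ _ _ _ _
  have hHs0 : ∀ s k ω, 0 ≤ Hs s k ω := fun s k ω => windowExcess_nonneg _ _ _ _ _ _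
  have hsufI : ∀ l, Integrable (suf l) P ∧ ∫ ω, suf l ω ∂P ≤ 3 / 8 * R := fun l =>
    integrable_of_lintegral_ofReal_le (hX.measurable_endExcess _ _ _ _ _ _ _) (hsuf0 l)
      (by positivity) (hX.lintegral_endExcess_le hσ hc (by
        intro θ ψ h1 h2 t
        refine (measure_mono ?_).trans (hX.suffix_crossing (cell g l) h1 h2 t)
        rintro ω ⟨p, hp⟩
        exact ⟨p.val, hp⟩) hw0 hR (by
        intro k hk k' hk' hkk
        simp only [hSs, Finset.coe_filter, Set.mem_ofPred_eq] at hk hk'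
        simp only at hkk
        omega) (by
        intro k hk
        simp only [hSs, Finset.mem_filter] at hk
        omega))
  have hpreI : ∀ l, Integrable (pre l) P ∧ ∫ ω, pre l ω ∂P ≤ 3 / 8 * R := fun l =>
    integrable_of_lintegral_ofReal_le (hX.measurable_endExcess _ _ _ _ _ _ _) (hpre0 l)
      (by positivity) (hX.lintegral_endExcess_le hσ hc (by
        intro θ ψ h1 h2 t
        refine (measure_mono ?_).trans (hX.prefix_crossing (cell g l) h1 h2 t)
        rintro ω ⟨p, hp⟩
        exact ⟨p.val, hp⟩) hw0 hR (by
        intro k hk k' hk' hkk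
        simp only [Finset.coe_range, Set.mem_Iio] at hk hk'
        simp only at hkk
        omega) (by
        intro k hk
        simp only [Finset.mem_range] at hk
        omega))
  have hHsI : ∀ s k, Integrable (Hs s k) P ∧ ∫ ω, Hs s k ω ∂P ≤
      3 / 2 / 10 ^ 6 * localSize (28 * R) r s k ^ 4 / R := fun s k =>
    integrable_of_lintegral_ofReal_le (hX.measurable_windowExcess _ _ _ _ _) (hHs0 s k)
      (by positivity) (hX.lintegral_windowExcess_le hσ hc hw0 hR
        (by exact_mod_cast card_window_le s k) (localSize_nonneg _ _ _) (by
          refine (min_le_left _ _).trans (le_of_eq ?_)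
          congr 1; ring))
  have hchi := hX.integral_sum_cellMean_sq_le hc ho.lt
  have hlin : Integrable (fun ω => ∑ i, r i * X i ω) P := hX.integrable_sum_mul hc r _
  have hlin0 : ∫ ω, ∑ i, r i * X i ω ∂P = 0 := hX.integral_sum_mul hc r _
  set D := ∑ i, r i ^ 2 with hD
  have hendI : Integrable (fun ω => ∑ k ∈ Finset.range q, (suf k ω + pre k ω)) P :=
    integrable_finsetSum _ fun k _ => (hsufI k).1.add (hpreI k).1
  have hendv : ∫ ω, ∑ k ∈ Finset.range q, (suf k ω + pre k ω) ∂P ≤ q * (3 / 4 * R) := by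
    rw [integral_finsetSum]
    swap
    · exact fun k _ => (hsufI k).1.add (hpreI k).1
    have : ∀ k ∈ Finset.range q, ∫ ω, (suf k ω + pre k ω) ∂P ≤ 3 / 4 * R := by
      intro k _
      rw [integral_add (hsufI k).1 (hpreI k).1]
      linarith [(hsufI k).2, (hpreI k).2]
    refine (Finset.sum_le_sum this).trans ?_
    simp
  have hwinI : Integrable (fun ω => ∑ s ∈ Finset.range (n + 1), ∑ k ∈ Finset.range (n + 1),
      Hs s k ω) P :=
    integrable_finsetSum _ fun s _ => integrable_finsetSum _ fun k _ => (hHsI s k).1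
  have hwinv : ∫ ω, ∑ s ∈ Finset.range (n + 1), ∑ k ∈ Finset.range (n + 1), Hs s k ω ∂P ≤
      1 / 16 * D := by
    rw [integral_finsetSum _ fun s _ => integrable_finsetSum _ fun k _ => (hHsI s k).1]
    have h1 : ∀ s, ∫ ω, ∑ k ∈ Finset.range (n + 1), Hs s k ω ∂P ≤
        3 / 2 / 10 ^ 6 / R * ∑ k ∈ Finset.range (n + 1), localSize (28 * R) r s k ^ 4 := by
      intro s
      rw [integral_finsetSum _ fun k _ => (hHsI s k).1, Finset.mul_sum]
      refine Finset.sum_le_sum fun k _ => (hHsI s k).2.trans (le_of_eq ?_)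
      ring
    refine (Finset.sum_le_sum fun s _ => h1 s).trans ?_
    rw [← Finset.mul_sum]
    calc _ ≤ 3 / 2 / 10 ^ 6 / R * (384 * (2 * (28 * R)) * D) := by
          gcongr
          exact sum_localSize_pow_four_le (by positivity) r _ _
      _ = 3 / 2 / 10 ^ 6 * 384 * 56 * D := by field_simp; ring
      _ ≤ 1 / 16 * D := by
          have : 0 ≤ D := by positivity
          nlinarith
  -- This is the right side of `IsOptimal.sum_bound`, which does not involve the competitor. In mean
  -- the first term vanishes, four times the windows is at most D/4, and the terms in q are
  -- dominated by 7Rq.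
  refine ⟨fun ω => 2 * ∑ i, r i * X i ω + 5 * ∑ i, cellMean g (fun j => X j ω) i ^ 2
    + ∑ k ∈ Finset.range q, (suf k ω + pre k ω)
    + 4 * ∑ s ∈ Finset.range (n + 1), ∑ k ∈ Finset.range (n + 1), Hs s k ω
    - 1 / 4 * (D + 28 * R * q), ?_, ?_, ?_⟩
  · exact (integral_combination hlin hchi.1 hendI hwinI 2 5 4 _).1
  · rw [(integral_combination hlin hchi.1 hendI hwinI 2 5 4 _).2, hlin0]
    have h1 := hchi.2
    have h2 : (q : ℝ) * σ ^ 2 ≤ q * R := by gcongr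
    have h3 : 0 ≤ (q : ℝ) * R := by positivity
    linarith
  · intro ω p t ht
    have hsb : SuffixBound g h (fun i => X i ω) q w (320 * R) (28 * R / 20) (fun l => suf l ω) := by
      intro l k p hlk hkq hcard s hs
      have hset : (cell g l).filter (fun i => p ≤ i.val) = Bs l ⟨min p n, by omega⟩ := by
        ext i
        have := i.isLt
        simp only [hBs, Finset.mem_filter]
        constructor <;> rintro ⟨h1, h2⟩ <;> exact ⟨h1, by omega⟩
      rw [hset] at hcard ⊢
      have h1 : ∀ d Y : ℝ, 2 * d * (∑ i ∈ Bs l ⟨min p n, by omega⟩, X i ω)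
          - d ^ 2 / 5 * (Bs l ⟨min p n, by omega⟩).card - Y ≤
          pieceExcess (Bs l) (fun i => X i ω) w d Y := by
        intro d Y
        have := le_posSup (fun p => if w ≤ ((Bs l p).card : ℝ) then
          2 * d * (∑ i ∈ Bs l p, X i ω) - d ^ 2 / 5 * (Bs l p).card - Y else 0) ⟨min p n, by omega⟩
        simp only [hcard, if_true] at this
        exact this
      have h2 : pieceExcess (Bs l) (fun i => X i ω) w (s * (μ l - μ k))
          (320 * R + 7 / 5 * R * ((k - l : ℕ) : ℝ)) ≤ suf l ω := by
        refine le_trans ?_ (Finset.single_le_sum (f := fun k =>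
          (pieceExcess (Bs l) (fun i => X i ω) w (1 * (μ l - μ k))
            (320 * R + 7 / 5 * R * ((k - l : ℕ) : ℝ)) +
          pieceExcess (Bs l) (fun i => X i ω) w (2 * (μ l - μ k))
            (320 * R + 7 / 5 * R * ((k - l : ℕ) : ℝ))))
          (fun k _ => add_nonneg (pieceExcess_nonneg _ _ _ _ _) (pieceExcess_nonneg _ _ _ _ _))
          (show k ∈ Ss l by simp [hSs, hlk, hkq]))
        rcases hs with rfl | rfl
        · linarith [pieceExcess_nonneg (Bs l) (fun i => X i ω) w (2 * (μ l - μ k))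
            (320 * R + 7 / 5 * R * ((k - l : ℕ) : ℝ))]
        · linarith [pieceExcess_nonneg (Bs l) (fun i => X i ω) w (1 * (μ l - μ k))
            (320 * R + 7 / 5 * R * ((k - l : ℕ) : ℝ))]
      have h3 := h1 (s * (μ l - μ k)) (320 * R + 7 / 5 * R * ((k - l : ℕ) : ℝ))
      rw [Nat.cast_sub hlk.le] at h2 h3
      simp only [hμ] at h2 h3
      linarith
    have hpb : PrefixBound g h (fun i => X i ω) q w (320 * R) (28 * R / 20) (fun l => pre l ω) := by
      intro l k p hkl hlq hcard s hs
      have hset : (cell g l).filter (fun i => i.val < p) = Bp l ⟨min p n, by omega⟩ :=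
        filter_val_lt_min _ _
      rw [hset] at hcard ⊢
      have h1 : ∀ d Y : ℝ, 2 * d * (∑ i ∈ Bp l ⟨min p n, by omega⟩, X i ω)
          - d ^ 2 / 5 * (Bp l ⟨min p n, by omega⟩).card - Y ≤
          pieceExcess (Bp l) (fun i => X i ω) w d Y := by
        intro d Y
        have := le_posSup (fun p => if w ≤ ((Bp l p).card : ℝ) then
          2 * d * (∑ i ∈ Bp l p, X i ω) - d ^ 2 / 5 * (Bp l p).card - Y else 0) ⟨min p n, by omega⟩
        simp only [hcard, if_true] at this
        exact this
      have h2 : pieceExcess (Bp l) (fun i => X i ω) w (s * (μ l - μ k))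
          (320 * R + 7 / 5 * R * ((l - k : ℕ) : ℝ)) ≤ pre l ω := by
        refine le_trans ?_ (Finset.single_le_sum (f := fun k =>
          (pieceExcess (Bp l) (fun i => X i ω) w (1 * (μ l - μ k))
            (320 * R + 7 / 5 * R * ((l - k : ℕ) : ℝ)) +
          pieceExcess (Bp l) (fun i => X i ω) w (2 * (μ l - μ k))
            (320 * R + 7 / 5 * R * ((l - k : ℕ) : ℝ))))
          (fun k _ => add_nonneg (pieceExcess_nonneg _ _ _ _ _) (pieceExcess_nonneg _ _ _ _ _))
          (show k ∈ Finset.range l by simp [hkl]))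
        rcases hs with rfl | rfl
        · linarith [pieceExcess_nonneg (Bp l) (fun i => X i ω) w (2 * (μ l - μ k))
            (320 * R + 7 / 5 * R * ((l - k : ℕ) : ℝ))]
        · linarith [pieceExcess_nonneg (Bp l) (fun i => X i ω) w (1 * (μ l - μ k))
            (320 * R + 7 / 5 * R * ((l - k : ℕ) : ℝ))]
      have h3 := h1 (s * (μ l - μ k)) (320 * R + 7 / 5 * R * ((l - k : ℕ) : ℝ))
      rw [Nat.cast_sub hkl.le] at h2 h3
      simp only [hμ] at h2 h3
      linarith
    have hwb : WindowBound (28 * R) r w (830 * R)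
        (fun s k => maxPrefix (window n s k) fun i => X i ω) (fun s k => Hs s k ω) := by
      intro s k hwN
      simp only [hHs, windowExcess, if_pos hwN]
      exact le_max_left _ _
    have hmain := ho.sum_bound (by positivity) hw (x := fun i => X i ω) (T := 320 * R)
      (v := 830 * R) (by positivity) (by positivity) (fun l => hsuf0 l ω) (fun l => hpre0 l ω)
      hsb hpb (fun s k => maxPrefix_nonneg _ _) (fun s k => hHs0 s k ω)
      (fun s k p => le_maxPrefix _ _ _) hwb ht
    -- The price per segment is 320R + (87/20)·28R + 830R = 1271.8R, below 1280R.
    refine le_trans (Finset.sum_le_sum fun a _ => ?_) hmain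
    linarith

end Noise

end Histogram
end

noncomputable section
namespace Histogram

/-! ### Projections onto the models, and partitions as labelings -/

section Geometry

variable {n : ℕ}

lemma Part.part_mem_parts (m : Part n) (i : Fin n) : m.part i ∈ m.parts :=
  m.part_mem.2 (Finset.mem_univ i)

lemma Part.mem_part_self' (m : Part n) (i : Fin n) : i ∈ m.part i :=
  m.mem_part_self.2 (Finset.mem_univ i)

lemma Part.sum_parts {M : Type*} [AddCommMonoid M] (m : Part n) (φ : Fin n → M) :
    ∑ I ∈ m.parts, ∑ i ∈ I, φ i = ∑ i, φ i := by
  have h := Finset.sum_biUnion (f := φ) m.disjoint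
  rw [m.biUnion_parts] at h
  simpa using h.symm

/-- If `S_m ⊆ S_{m₀}`, then every cell of `m` is a union of cells of `m₀`. -/
lemma le_of_model_le {m m₀ : Part n} (h : model m ≤ model m₀) : m₀ ≤ m := by
  intro J hJ
  obtain ⟨j, hj⟩ := m₀.nonempty_of_mem_parts hJ
  refine ⟨m.part j, m.part_mem_parts j, fun i hi => ?_⟩
  let v : EuclideanSpace ℝ (Fin n) := WithLp.toLp 2 fun k => if k ∈ m.part j then 1 else 0
  have hv : v ∈ model m := by
    intro I hI k hk l hl
    have : ∀ x ∈ I, (x ∈ m.part j ↔ I = m.part j) := fun x hx =>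
      ⟨fun hx' => m.eq_of_mem_parts hI (m.part_mem_parts j) hx hx', fun e => e ▸ hx⟩
    simp only [v, this k hk, this l hl]
  have := h hv J hJ i hi j hj
  by_contra hcon
  simp [v, hcon, m.mem_part_self' j] at this

lemma estimator_mem (m : Part n) (x : EuclideanSpace ℝ (Fin n)) : estimator m x ∈ model m :=
  (model m).starProjection_apply_mem x

lemma estimator_apply_eq {m : Part n} {I : Finset (Fin n)} (hI : I ∈ m.parts) {i : Fin n}
    (hi : i ∈ I) (x : EuclideanSpace ℝ (Fin n)) : estimator m x i = avg I x := by
  let p : EuclideanSpace ℝ (Fin n) := WithLp.toLp 2 fun k => avg (m.part k) x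
  have hp : ∀ J ∈ m.parts, ∀ j ∈ J, p j = avg J x := fun J hJ j hj => by
    simp only [p, m.part_eq_of_mem hJ hj]
  have hpm : p ∈ model m := fun J hJ j hj k hk => by rw [hp J hJ j hj, hp J hJ k hk]
  have : p = estimator m x := by
    refine ((model m).eq_starProjection_of_mem_of_inner_eq_zero hpm fun w hw => ?_).symm
    simp only [PiLp.inner_apply, PiLp.sub_apply]
    rw [← m.sum_parts]
    refine Finset.sum_eq_zero fun J hJ => ?_
    obtain ⟨j, hj⟩ := m.nonempty_of_mem_parts hJ
    have : ∀ k ∈ J, inner ℝ (x k - p k) (w k) = (x k - avg J x) * w j := fun k hk => by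
      rw [hp J hJ k hk, hw J hJ k hk j hj]; simp [mul_comm]
    rw [Finset.sum_congr rfl this, ← Finset.sum_mul, sum_sub_avg, zero_mul]
  rw [← this, hp I hI i hi]

lemma inner_eq_sum (x y : EuclideanSpace ℝ (Fin n)) : inner ℝ x y = ∑ i, x i * y i := by
  simp [PiLp.inner_apply, mul_comm]

lemma norm_sq_eq_sum (x : EuclideanSpace ℝ (Fin n)) : ‖x‖ ^ 2 = ∑ i, x i ^ 2 := by
  rw [← real_inner_self_eq_norm_sq, inner_eq_sum]; simp [sq]

lemma norm_estimator_sq (m : Part n) (x : EuclideanSpace ℝ (Fin n)) :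
    ‖estimator m x‖ ^ 2 = ∑ I ∈ m.parts, (∑ i ∈ I, x i) ^ 2 / I.card := by
  rw [norm_sq_eq_sum, ← m.sum_parts]
  refine Finset.sum_congr rfl fun I hI => ?_
  have hc : (I.card : ℝ) ≠ 0 := by exact_mod_cast (m.nonempty_of_mem_parts hI).card_ne_zero
  rw [Finset.sum_congr rfl fun i hi => by rw [estimator_apply_eq hI hi], Finset.sum_const,
    nsmul_eq_mul, avg]
  field_simp

lemma norm_sub_estimator_sq (m : Part n) (x : EuclideanSpace ℝ (Fin n)) :
    ‖x - estimator m x‖ ^ 2 = ∑ I ∈ m.parts, ∑ i ∈ I, (x i - avg I x) ^ 2 := by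
  rw [norm_sq_eq_sum, ← m.sum_parts]
  refine Finset.sum_congr rfl fun I hI => Finset.sum_congr rfl fun i hi => ?_
  rw [PiLp.sub_apply, estimator_apply_eq hI hi]

lemma inner_sub_estimator (m : Part n) (h x : EuclideanSpace ℝ (Fin n)) :
    inner ℝ (h - estimator m h) x = ∑ I ∈ m.parts, ∑ i ∈ I, (h i - avg I h) * x i := by
  rw [inner_eq_sum, ← m.sum_parts]
  refine Finset.sum_congr rfl fun I hI => Finset.sum_congr rfl fun i hi => ?_
  rw [PiLp.sub_apply, estimator_apply_eq hI hi]

lemma inner_estimator_sub (m : Part n) (x w : EuclideanSpace ℝ (Fin n)) (hw : w ∈ model m) :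
    inner ℝ (x - estimator m x) w = 0 :=
  (model m).starProjection_inner_eq_zero x w hw

lemma norm_sub_estimator_sq' (m : Part n) (x : EuclideanSpace ℝ (Fin n)) :
    ‖x - estimator m x‖ ^ 2 = ‖x‖ ^ 2 - ‖estimator m x‖ ^ 2 := by
  have h := inner_estimator_sub m x _ (estimator_mem m x)
  rw [inner_sub_left, real_inner_self_eq_norm_sq] at h
  rw [norm_sub_sq_real]
  linarith

lemma estimator_add (m : Part n) (x y : EuclideanSpace ℝ (Fin n)) :
    estimator m (x + y) = estimator m x + estimator m y := map_add _ x y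

lemma estimator_smul (m : Part n) (t : ℝ) (x : EuclideanSpace ℝ (Fin n)) :
    estimator m (t • x) = t • estimator m x := map_smul _ t x

/-- Bias and variance terms of the loss. -/
lemma loss_eq (m : Part n) (f x : EuclideanSpace ℝ (Fin n)) :
    ‖f - estimator m (f + x)‖ ^ 2 = ‖f - estimator m f‖ ^ 2 + ‖estimator m x‖ ^ 2 := by
  have h := inner_estimator_sub m f _ (estimator_mem m x)
  rw [estimator_add, ← sub_sub, norm_sub_sq_real, h]
  ring

lemma residual_eq (m : Part n) (f x : EuclideanSpace ℝ (Fin n)) :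
    ‖f + x - estimator m (f + x)‖ ^ 2 = ‖f - estimator m f‖ ^ 2
      + 2 * inner ℝ (f - estimator m f) x + ‖x‖ ^ 2 - ‖estimator m x‖ ^ 2 := by
  have h1 : f + x - estimator m (f + x) = (f - estimator m f) + (x - estimator m x) := by
    rw [estimator_add]; abel
  have h := inner_estimator_sub m f _ (estimator_mem m x)
  rw [h1, norm_add_sq_real, norm_sub_estimator_sq' m x, inner_sub_right, h]
  ring

variable {m m₀ : Part n}

lemma estimator_estimator (h : model m ≤ model m₀) (x : EuclideanSpace ℝ (Fin n)) :
    estimator m (estimator m₀ x) = estimator m x := by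
  have := congrArg (fun T => T x) (Submodule.starProjection_comp_starProjection_of_le h)
  exact this

lemma norm_estimator_sq_le (h : model m ≤ model m₀) (x : EuclideanSpace ℝ (Fin n)) :
    ‖estimator m x‖ ^ 2 ≤ ‖estimator m₀ x‖ ^ 2 := by
  rw [← estimator_estimator h x]
  have := (model m).norm_starProjection_apply_le (estimator m₀ x)
  exact pow_le_pow_left₀ (norm_nonneg _) this 2

/-- Replacing `h` by its projection on the largest model. -/
lemma residual_project (h : model m ≤ model m₀) (x y : EuclideanSpace ℝ (Fin n)) :
    ‖x - estimator m x‖ ^ 2 = ‖estimator m₀ x - estimator m (estimator m₀ x)‖ ^ 2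
        + ‖x - estimator m₀ x‖ ^ 2 ∧
      inner ℝ (x - estimator m x) y =
        inner ℝ (estimator m₀ x - estimator m (estimator m₀ x)) y
          + inner ℝ (x - estimator m₀ x) y := by
  have h0 : x - estimator m x =
      (x - estimator m₀ x) + (estimator m₀ x - estimator m x) := by abel
  rw [estimator_estimator h]
  have h1 := inner_estimator_sub m₀ x (estimator m₀ x - estimator m x)
    ((model m₀).sub_mem (estimator_mem m₀ x) (h (estimator_mem m x)))
  constructor
  · rw [h0, norm_add_sq_real, h1]; ring
  · rw [h0, inner_add_left]; ring

/-- For `g ∈ S_m` the functional `2⟨g, x⟩ - |g|²` only depends on the sums of `x` over cells. -/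
lemma two_inner_sub_norm_sq {g : EuclideanSpace ℝ (Fin n)} (hg : g ∈ model m)
    (x : EuclideanSpace ℝ (Fin n)) :
    2 * inner ℝ g x - ‖g‖ ^ 2 =
      ∑ J ∈ m.parts, (2 * avg J g * (∑ i ∈ J, x i) - avg J g ^ 2 * J.card) := by
  rw [inner_eq_sum, norm_sq_eq_sum, ← m.sum_parts, ← m.sum_parts, Finset.mul_sum,
    ← Finset.sum_sub_distrib]
  refine Finset.sum_congr rfl fun J hJ => ?_
  have hval : ∀ i ∈ J, g i = avg J g := fun i hi => by
    have hc : (J.card : ℝ) ≠ 0 := by exact_mod_cast (m.nonempty_of_mem_parts hJ).card_ne_zero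
    rw [avg, Finset.sum_congr rfl fun j hj => hg J hJ j hj i hi, Finset.sum_const, nsmul_eq_mul]
    field_simp
  have e1 : ∑ i ∈ J, g i * x i = avg J g * ∑ i ∈ J, x i := by
    rw [Finset.mul_sum]
    exact Finset.sum_congr rfl fun i hi => by rw [hval i hi]
  have e2 : ∑ i ∈ J, g i ^ 2 = J.card * avg J g ^ 2 := by
    rw [← nsmul_eq_mul, ← Finset.sum_const]
    exact Finset.sum_congr rfl fun i hi => by rw [hval i hi]
  rw [e1, e2]
  ring

/-- Completion of the square inside the model. Off the good event this bounds all the linear terms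
at once by the noise energy in the largest model. -/
lemma two_inner_sub_norm_sq_le {g : EuclideanSpace ℝ (Fin n)} (hg : g ∈ model m)
    (x : EuclideanSpace ℝ (Fin n)) : 2 * inner ℝ g x - ‖g‖ ^ 2 ≤ ‖estimator m x‖ ^ 2 := by
  have h := inner_estimator_sub m x g hg
  rw [inner_sub_left] at h
  have h2 := sq_nonneg ‖estimator m x - g‖
  rw [norm_sub_sq_real] at h2
  rw [real_inner_comm]
  linarith

/-- Rank of a cell among the cells of a partition. -/
def Part.rank (m : Part n) (I : Finset (Fin n)) : ℕ :=
  (m.parts.filter fun I' => ∀ x ∈ I', ∀ y ∈ I, x < y).card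

/-- The labeling of the indices by the rank of their cell. -/
def Part.label (m : Part n) (i : Fin n) : ℕ := m.rank (m.part i)

lemma Consecutive.lt_of_lt (hm : Consecutive m) {I J : Finset (Fin n)} (hI : I ∈ m.parts)
    (hJ : J ∈ m.parts) (hne : I ≠ J) {x y : Fin n} (hx : x ∈ I) (hy : y ∈ J) (hxy : x < y)
    {x' y' : Fin n} (hx' : x' ∈ I) (hy' : y' ∈ J) : x' < y' := by
  have key : ∀ {z}, z ∈ I → z ∈ J → False := fun h1 h2 => hne (m.eq_of_mem_parts hI hJ h1 h2)
  have oI := hm I hI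
  have oJ := hm J hJ
  have h1 : x' < y := by
    by_contra hcon
    exact key (oI.out hx hx' ⟨hxy.le, not_lt.1 hcon⟩) hy
  by_contra hcon
  exact key hx' (oJ.out hy' hy ⟨not_lt.1 hcon, h1.le⟩)

lemma Part.rank_lt_rank {I J : Finset (Fin n)} (hI : I ∈ m.parts)
    (h : ∀ x ∈ I, ∀ y ∈ J, x < y) : m.rank I < m.rank J := by
  obtain ⟨x, hx⟩ := m.nonempty_of_mem_parts hI
  refine Finset.card_lt_card (Finset.ssubset_iff_of_subset ?_ |>.2 ⟨I, ?_, ?_⟩)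
  · intro I' hI'
    rw [Finset.mem_filter] at hI' ⊢
    exact ⟨hI'.1, fun z hz y hy => (hI'.2 z hz x hx).trans (h x hx y hy)⟩
  · exact Finset.mem_filter.2 ⟨hI, h⟩
  · intro hcon
    exact lt_irrefl x ((Finset.mem_filter.1 hcon).2 x hx x hx)

lemma Consecutive.label_lt_label (hm : Consecutive m) {i j : Fin n} (hij : i < j)
    (hne : m.part i ≠ m.part j) : m.label i < m.label j :=
  Part.rank_lt_rank (m.part_mem_parts i) fun _ hx _ hy =>
    hm.lt_of_lt (m.part_mem_parts i) (m.part_mem_parts j) hne (m.mem_part_self' i)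
      (m.mem_part_self' j) hij hx hy

lemma Consecutive.label_eq_iff (hm : Consecutive m) {i j : Fin n} :
    m.label i = m.label j ↔ m.part i = m.part j := by
  refine ⟨fun h => ?_, fun h => by rw [Part.label, Part.label, h]⟩
  by_contra hne
  rcases lt_trichotomy i j with hij | rfl | hij
  · exact (hm.label_lt_label hij hne).ne h
  · exact hne rfl
  · exact (hm.label_lt_label hij (Ne.symm hne)).ne h.symm

lemma Consecutive.cell_label (hm : Consecutive m) {I : Finset (Fin n)} (hI : I ∈ m.parts) :
    cell m.label (m.rank I) = I := by
  obtain ⟨i, hi⟩ := m.nonempty_of_mem_parts hI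
  have h0 : m.part i = I := m.part_eq_of_mem hI hi
  ext j
  rw [mem_cell, ← h0]
  change m.label j = m.label i ↔ _
  rw [hm.label_eq_iff, m.mem_part_iff_part_eq_part (Finset.mem_univ _) (Finset.mem_univ _)]

lemma Part.rank_lt (m : Part n) {I : Finset (Fin n)} (hI : I ∈ m.parts) :
    m.rank I < m.parts.card := by
  obtain ⟨x, hx⟩ := m.nonempty_of_mem_parts hI
  refine Finset.card_lt_card (Finset.ssubset_iff_of_subset (Finset.filter_subset _ _) |>.2
    ⟨I, hI, fun hcon => lt_irrefl x ((Finset.mem_filter.1 hcon).2 x hx x hx)⟩)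

/-- The cells of consecutive integers are totally ordered, so their ranks are exactly 0, …, |m| - 1,
with no unused label. -/
lemma Consecutive.sum_range_label (hm : Consecutive m) (F : Finset (Fin n) → ℝ) :
    ∑ k ∈ Finset.range m.parts.card, F (cell m.label k) = ∑ I ∈ m.parts, F I := by
  have hinj : Set.InjOn m.rank m.parts := fun I hI J hJ h => by
    rw [← hm.cell_label hI, ← hm.cell_label hJ, h]
  have himg : m.parts.image m.rank = Finset.range m.parts.card := by
    refine Finset.eq_of_subset_of_card_le ?_ ?_
    · intro k hk
      obtain ⟨I, hI, rfl⟩ := Finset.mem_image.1 hk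
      exact Finset.mem_range.2 (m.rank_lt hI)
    · rw [Finset.card_range, Finset.card_image_of_injOn hinj]
  rw [← himg, Finset.sum_image hinj]
  exact Finset.sum_congr rfl fun I hI => by rw [hm.cell_label hI]

lemma Consecutive.isLabeling (hm : Consecutive m) (hm₀ : Consecutive m₀) (hle : m₀ ≤ m) :
    IsLabeling m₀.label m.parts.card m.label where
  mono := by
    intro i j hij
    rcases hij.eq_or_lt with rfl | hlt
    · exact le_rfl
    · by_cases h : m.part i = m.part j
      · exact (hm.label_eq_iff.2 h).le
      · exact (hm.label_lt_label hlt h).le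
  adm := by
    intro i j hij
    rw [hm₀.label_eq_iff] at hij
    rw [hm.label_eq_iff]
    obtain ⟨I, hI, hsub⟩ := hle (m₀.part_mem_parts i)
    rw [m.part_eq_of_mem hI (hsub (m₀.mem_part_self' i)),
      m.part_eq_of_mem hI (hsub (hij ▸ m₀.mem_part_self' j))]
  lt := fun i => m.rank_lt (m.part_mem_parts i)

/-- The number of distinct cells of consecutive integers. -/
lemma card_le_of_ordConnected {𝓘 : Finset (Finset (Fin n))}
    (h : ∀ I ∈ 𝓘, I.Nonempty ∧ (I : Set (Fin n)).OrdConnected) : 𝓘.card ≤ n ^ 2 := by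
  have hsub : 𝓘 ⊆ (Finset.univ : Finset (Fin n × Fin n)).image fun p => Finset.Icc p.1 p.2 := by
    intro I hI
    obtain ⟨hne, hoc⟩ := h I hI
    refine Finset.mem_image.2 ⟨(I.min' hne, I.max' hne), Finset.mem_univ _, ?_⟩
    ext x
    rw [Finset.mem_Icc]
    exact ⟨fun hx => hoc.out (I.min'_mem hne) (I.max'_mem hne) hx,
      fun hx => ⟨I.min'_le x hx, I.le_max' x hx⟩⟩
  refine (Finset.card_le_card hsub).trans (Finset.card_image_le.trans ?_)
  simp [sq]

end Geometry

end Histogram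
end

noncomputable section
namespace Histogram

/-! ### Exponential moments on the good event -/

section GoodEvent

variable {Ω : Type*} {n : ℕ} {X : Fin n → Ω → ℝ}

/-- The vector with coordinates `X i ω`. -/
def noiseVec (X : Fin n → Ω → ℝ) (ω : Ω) : EuclideanSpace ℝ (Fin n) :=
  WithLp.toLp 2 fun i => X i ω

@[simp] lemma noiseVec_apply (X : Fin n → Ω → ℝ) (ω : Ω) (i : Fin n) :
    noiseVec X ω i = X i ω := rfl

/-- The event on which all the cell averages of the noise are at most `u`. -/
def goodEvent (m : Part n) (X : Fin n → Ω → ℝ) (u : ℝ) : Set Ω :=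
  {ω | ∀ I ∈ m.parts, |∑ i ∈ I, X i ω| ≤ u * I.card}

lemma mem_goodEvent {m : Part n} {u : ℝ} {ω : Ω} :
    ω ∈ goodEvent m X u ↔ ∀ I ∈ m.parts, |∑ i ∈ I, X i ω| ≤ u * I.card := Iff.rfl

/-- A cell of m is a union of cells of the finer partition, and bounds proportional to cardinality
add up. Hence the event of the finest partition serves every model simultaneously. -/
lemma goodEvent_mono {m m₀ : Part n} (hle : m₀ ≤ m) (u : ℝ) :
    goodEvent m₀ X u ⊆ goodEvent m X u := by
  intro ω hω I hI
  have h1 : ∀ φ : Fin n → ℝ, ∑ i ∈ I, φ i =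
      ∑ J ∈ m₀.parts, ∑ i ∈ J, if i ∈ I then φ i else 0 := fun φ => by
    rw [m₀.sum_parts, Finset.sum_ite_mem, Finset.univ_inter]
  have h2 : (I.card : ℝ) = ∑ i ∈ I, 1 := by simp
  rw [h2, h1, h1, Finset.mul_sum]
  refine (Finset.abs_sum_le_sum_abs _ _).trans (Finset.sum_le_sum fun J hJ => ?_)
  obtain ⟨I', hI', hsub⟩ := hle hJ
  by_cases hII : I' = I
  · subst hII
    rw [Finset.sum_congr rfl fun i hi => if_pos (hsub hi),
      Finset.sum_congr (g := fun _ => (1 : ℝ)) rfl fun i hi => if_pos (hsub hi)]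
    simpa using hω J hJ
  · have : ∀ i ∈ J, i ∉ I := fun i hi hiI => hII (m.eq_of_mem_parts hI' hI (hsub hi) hiI)
    rw [Finset.sum_congr rfl fun i hi => if_neg (this i hi),
      Finset.sum_congr (g := fun _ => (0 : ℝ)) rfl fun i hi => if_neg (this i hi)]
    simp

end GoodEvent

section Events

variable {Ω : Type*} [MeasurableSpace Ω] {P : Measure Ω} {n : ℕ} {X : Fin n → Ω → ℝ} {σ c : ℝ}

lemma SubGamma.mono {Z : Ω → ℝ} {v v' c' : ℝ} (h : SubGamma P Z v c) (hv0 : 0 ≤ v)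
    (hv : v ≤ v') (hc : c ≤ c') : SubGamma P Z v' c' := by
  intro l hl
  have h1 : |l| * c ≤ |l| * c' := mul_le_mul_of_nonneg_left hc (abs_nonneg l)
  have h2 : 0 < 1 - |l| * c' := by linarith
  refine (h l (by linarith)).trans (ENNReal.ofReal_le_ofReal (Real.exp_le_exp.2 ?_))
  have h3 : 0 ≤ l ^ 2 * v' := mul_nonneg (sq_nonneg l) (hv0.trans hv)
  gcongr

/-- The pointwise inequality l(T - t) ≤ exp(l(T - t) - 1) lets a multiple of exp(lT) on S dominate
the excess; its mean is read off from the exponential moment without integrating tails. -/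
lemma exists_excess {S : Set Ω} (hS : MeasurableSet S) {T : Ω → ℝ} (hT : Measurable T)
    {l C : ℝ} (hl : 0 < l) (hC : 0 ≤ C)
    (h : ∫⁻ ω in S, ENNReal.ofReal (Real.exp (l * T ω)) ∂P ≤ ENNReal.ofReal C) (t : ℝ) :
    ∃ Z : Ω → ℝ, Integrable Z P ∧ (∀ ω, 0 ≤ Z ω) ∧ (∀ ω ∈ S, T ω - t ≤ Z ω) ∧
      ∫ ω, Z ω ∂P ≤ C / l * Real.exp (-(l * t) - 1) := by
  set k : ℝ := 1 / l * Real.exp (-(l * t) - 1) with hk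
  have hk0 : 0 ≤ k := by positivity
  set Z : Ω → ℝ := S.indicator fun ω => k * Real.exp (l * T ω) with hZ
  have hZm : Measurable Z := Measurable.indicator (by fun_prop) hS
  have hZ0 : ∀ ω, 0 ≤ Z ω := fun ω => Set.indicator_nonneg (fun _ _ => by positivity) ω
  have hb : ∫⁻ ω, ENNReal.ofReal (Z ω) ∂P ≤ ENNReal.ofReal (C / l * Real.exp (-(l * t) - 1)) := by
    have e1 : ∀ ω, ENNReal.ofReal (Z ω) =
        S.indicator (fun ω => ENNReal.ofReal k * ENNReal.ofReal (Real.exp (l * T ω))) ω :=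
      fun ω => by
        by_cases hω : ω ∈ S
        · rw [hZ, Set.indicator_of_mem hω, Set.indicator_of_mem hω, ENNReal.ofReal_mul hk0]
        · rw [hZ, Set.indicator_of_notMem hω, Set.indicator_of_notMem hω, ENNReal.ofReal_zero]
    rw [lintegral_congr e1, lintegral_indicator hS, lintegral_const_mul _ (by fun_prop)]
    refine (mul_le_mul_right h _).trans (le_of_eq ?_)
    rw [← ENNReal.ofReal_mul hk0, hk]
    congr 1
    ring
  obtain ⟨hi, hle⟩ := integrable_of_lintegral_ofReal_le hZm hZ0 (by positivity) hb
  refine ⟨Z, hi, hZ0, fun ω hω => ?_, hle⟩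
  rw [hZ, Set.indicator_of_mem hω, hk, mul_assoc, ← Real.exp_add]
  have := Real.add_one_le_exp (-(l * t) - 1 + l * T ω)
  rw [div_mul_eq_mul_div, one_mul, le_div_iff₀ hl]
  linarith

variable [IsProbabilityMeasure P]

lemma IndepNoise.measurableSet_goodEvent (h : IndepNoise P X σ c) (m : Part n) (u : ℝ) :
    MeasurableSet (goodEvent m X u) := by
  have : goodEvent m X u = ⋂ I ∈ m.parts, {ω | |∑ i ∈ I, X i ω| ≤ u * I.card} := by
    ext ω; simp [mem_goodEvent]
  rw [this]
  refine Finset.measurableSet_biInter _ fun I _ => measurableSet_le ?_ measurable_const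
  exact (h.measurable_sum I).abs

/-- The good event is itself an intersection of events depending on one cell each, so truncation
does not destroy the product structure. -/
lemma IndepNoise.lintegral_exp_sum_goodEvent (h : IndepNoise P X σ c) (m : Part n) (u : ℝ)
    (φ : Finset (Fin n) → ℝ → ℝ) (hφ : ∀ I, Measurable (φ I)) :
    ∫⁻ ω in goodEvent m X u,
        ENNReal.ofReal (Real.exp (∑ I ∈ m.parts, φ I (∑ i ∈ I, X i ω))) ∂P =
      ∏ I ∈ m.parts, ∫⁻ ω in {ω | |∑ i ∈ I, X i ω| ≤ u * I.card},
        ENNReal.ofReal (Real.exp (φ I (∑ i ∈ I, X i ω))) ∂P := by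
  classical
  set ψ : Finset (Fin n) → ℝ → ENNReal := fun I =>
    {x : ℝ | |x| ≤ u * I.card}.indicator fun x => ENNReal.ofReal (Real.exp (φ I x)) with hψ
  have hψm : ∀ I, Measurable (ψ I) := fun I => by
    refine Measurable.indicator ?_ (measurableSet_le (by fun_prop) measurable_const)
    have := hφ I
    fun_prop
  have h1 := lintegral_prod_blocks h.measurable h.indep m.parts id m.disjoint ψ hψm
  rw [← lintegral_indicator (h.measurableSet_goodEvent m u)]
  simp only [id] at h1
  have h2 : ∀ ω, (goodEvent m X u).indicator (fun ω =>
      ENNReal.ofReal (Real.exp (∑ I ∈ m.parts, φ I (∑ i ∈ I, X i ω)))) ω =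
      ∏ I ∈ m.parts, ψ I (∑ i ∈ I, X i ω) := fun ω => by
    by_cases hω : ω ∈ goodEvent m X u
    · rw [Set.indicator_of_mem hω, Real.exp_sum,
        ENNReal.ofReal_prod_of_nonneg fun _ _ => (Real.exp_pos _).le]
      refine Finset.prod_congr rfl fun I hI => ?_
      exact (Set.indicator_of_mem (s := {x : ℝ | |x| ≤ u * I.card}) (hω I hI)
        (fun x => ENNReal.ofReal (Real.exp (φ I x)))).symm
    · rw [Set.indicator_of_notMem hω]
      have : ∃ I ∈ m.parts, ¬ |∑ i ∈ I, X i ω| ≤ u * I.card := by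
        by_contra hcon
        push Not at hcon
        exact hω hcon
      obtain ⟨I, hI, hI2⟩ := this
      symm
      apply Finset.prod_eq_zero hI
      exact Set.indicator_of_notMem (s := {x : ℝ | |x| ≤ u * I.card}) hI2
        (fun x => ENNReal.ofReal (Real.exp (φ I x)))
  rw [lintegral_congr h2, h1]
  refine Finset.prod_congr rfl fun I _ => ?_
  rw [← lintegral_indicator (measurableSet_le (h.measurable_sum I).abs measurable_const)]
  rfl

lemma IndepNoise.lintegral_exp_norm_estimator_sq (h : IndepNoise P X σ c) (hσ : 0 < σ)
    (hc : 0 ≤ c) {u : ℝ} (hu : 0 ≤ u) (m : Part n) :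
    ∫⁻ ω in goodEvent m X u, ENNReal.ofReal
      (Real.exp (1 / (4 * (σ ^ 2 + c * u)) * ‖estimator m (noiseVec X ω)‖ ^ 2)) ∂P ≤
      ENNReal.ofReal (3 ^ m.parts.card) := by
  have h1 : ∀ ω, 1 / (4 * (σ ^ 2 + c * u)) * ‖estimator m (noiseVec X ω)‖ ^ 2 =
      ∑ I ∈ m.parts, (fun x : ℝ => 1 / (4 * (σ ^ 2 + c * u)) * (x ^ 2 / I.card))
        (∑ i ∈ I, X i ω) := fun ω => by
    rw [norm_estimator_sq, Finset.mul_sum]; rfl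
  simp only [h1]
  rw [h.lintegral_exp_sum_goodEvent m u
    (fun I x => 1 / (4 * (σ ^ 2 + c * u)) * (x ^ 2 / I.card)) fun I => by fun_prop]
  rw [ENNReal.ofReal_pow (by norm_num), ← Finset.prod_const]
  refine Finset.prod_le_prod' fun I hI => ?_
  have hI0 : (0 : ℝ) < I.card := by exact_mod_cast (m.nonempty_of_mem_parts hI).card_pos
  have h2 := (h.subGamma_sum I).lintegral_exp_sq_indicator_le (h.measurable_sum I)
    (by positivity) hc (s₀ := u * I.card) (W := (σ ^ 2 + c * u) * I.card)
    (by linarith [mul_assoc c u I.card]) (by positivity)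
  refine le_trans (le_of_eq ?_) (h2.trans (by norm_num))
  refine lintegral_congr fun ω => ?_
  congr 2
  have : σ ^ 2 + c * u ≠ 0 := by positivity
  field_simp

lemma IndepNoise.lintegral_exp_two_inner (h : IndepNoise P X σ c) (hσ : 0 < σ)
    (hc : 0 ≤ c) {u : ℝ} (hu : 0 ≤ u) {m : Part n} {g : EuclideanSpace ℝ (Fin n)}
    (hg : g ∈ model m) :
    ∫⁻ ω in goodEvent m X u, ENNReal.ofReal
      (Real.exp (1 / (2 * σ ^ 2 + 2 * c * u) * (2 * inner ℝ g (noiseVec X ω) - ‖g‖ ^ 2))) ∂P ≤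
      ENNReal.ofReal 1 := by
  have h1 : ∀ ω, 1 / (2 * σ ^ 2 + 2 * c * u) * (2 * inner ℝ g (noiseVec X ω) - ‖g‖ ^ 2) =
      ∑ J ∈ m.parts, (fun x : ℝ => 1 / (2 * σ ^ 2 + 2 * c * u) *
        (2 * avg J g * x - avg J g ^ 2 * J.card)) (∑ i ∈ J, X i ω) := fun ω => by
    rw [two_inner_sub_norm_sq hg, Finset.mul_sum]; rfl
  simp only [h1]
  rw [h.lintegral_exp_sum_goodEvent m u
    (fun J x => 1 / (2 * σ ^ 2 + 2 * c * u) * (2 * avg J g * x - avg J g ^ 2 * J.card))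
    fun I => by fun_prop, ENNReal.ofReal_one]
  refine Finset.prod_le_one' fun I hI => ?_
  exact (h.subGamma_sum I).lintegral_exp_quad_indicator_le hσ hc hu (by positivity)
    (h.measurable_sum I) (avg I g)

end Events

end Histogram
end

noncomputable section
namespace Histogram

/-! ### Noise energy off the good event -/

section NormSum

variable {Ω : Type*} {n : ℕ} {X : Fin n → Ω → ℝ}

/-- Normalized sum over a cell. -/
def normSum (X : Fin n → Ω → ℝ) (I : Finset (Fin n)) (ω : Ω) : ℝ :=
  (Real.sqrt I.card)⁻¹ * ∑ i ∈ I, X i ω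

lemma normSum_sq (I : Finset (Fin n)) (ω : Ω) :
    normSum X I ω ^ 2 = (∑ i ∈ I, X i ω) ^ 2 / I.card := by
  rw [normSum, mul_pow, inv_pow, Real.sq_sqrt (by positivity)]
  ring

lemma norm_estimator_noiseVec_sq (m : Part n) (ω : Ω) :
    ‖estimator m (noiseVec X ω)‖ ^ 2 = ∑ I ∈ m.parts, normSum X I ω ^ 2 := by
  rw [norm_estimator_sq]
  exact Finset.sum_congr rfl fun I _ => (normSum_sq I ω).symm

end NormSum

lemma setLIntegral_le_sum {Ω : Type*} [MeasurableSpace Ω] {P : Measure Ω} {κ : Type*} (s : Finset κ) (E : κ → Set Ω)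
    (hE : ∀ k, MeasurableSet (E k)) {S : Set Ω} (hS : MeasurableSet S)
    (hsub : ∀ ω ∈ S, ∃ k ∈ s, ω ∈ E k) (F : Ω → ENNReal) (hF : Measurable F) :
    ∫⁻ ω in S, F ω ∂P ≤ ∑ k ∈ s, ∫⁻ ω in E k, F ω ∂P := by
  rw [← lintegral_indicator hS]
  simp only [← lintegral_indicator (hE _)]
  rw [← lintegral_finsetSum s fun k _ => hF.indicator (hE k)]
  refine lintegral_mono fun ω => ?_
  by_cases hω : ω ∈ S
  · obtain ⟨k, hk, hk2⟩ := hsub ω hω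
    rw [Set.indicator_of_mem hω]
    refine le_trans (le_of_eq ?_) (Finset.single_le_sum (f := fun k => (E k).indicator F ω)
      (fun _ _ => zero_le) hk)
    exact (Set.indicator_of_mem hk2 F).symm
  · rw [Set.indicator_of_notMem hω]; exact zero_le

section BadEvent

variable {Ω : Type*} [MeasurableSpace Ω] {P : Measure Ω} [IsProbabilityMeasure P] {n : ℕ}
  {X : Fin n → Ω → ℝ} {σ c : ℝ}

lemma IndepNoise.measurable_normSum (h : IndepNoise P X σ c) (I : Finset (Fin n)) :
    Measurable (normSum X I) := (h.measurable_sum I).const_mul _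

/-- Dividing by √|I| ≥ 1 normalizes the variance factor and can only shrink the scale, so all cells
share the same parameters. -/
lemma IndepNoise.subGamma_normSum (h : IndepNoise P X σ c) (hc : 0 ≤ c)
    {I : Finset (Fin n)} (hI : I.Nonempty) : SubGamma P (normSum X I) (σ ^ 2) c := by
  have hI0 : (1 : ℝ) ≤ I.card := by exact_mod_cast hI.card_pos
  have h1 : 1 ≤ Real.sqrt I.card := Real.one_le_sqrt.2 hI0
  refine ((h.subGamma_sum I).smul (Real.sqrt I.card)⁻¹).mono (by positivity) (le_of_eq ?_) ?_
  · rw [inv_pow, Real.sq_sqrt (by positivity)]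
    field_simp
  · rw [abs_of_nonneg (by positivity)]
    exact mul_le_of_le_one_left hc (inv_le_one_of_one_le₀ h1)

lemma IndepNoise.lintegral_normSum_sq_mul (h : IndepNoise P X σ c) {I J : Finset (Fin n)}
    (hIJ : Disjoint I J) (y : ℝ) :
    ∫⁻ ω in {ω | y ≤ |normSum X J ω|}, ENNReal.ofReal (normSum X I ω ^ 2) ∂P =
      (∫⁻ ω, ENNReal.ofReal (normSum X I ω ^ 2) ∂P) * P {ω | y ≤ |normSum X J ω|} := by
  have hms : MeasurableSet {ω | y ≤ |normSum X J ω|} :=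
    measurableSet_le measurable_const (h.measurable_normSum J).abs
  rw [← lintegral_indicator hms, ← lintegral_indicator_one hms]
  set φ : Bool → ℝ → ENNReal := fun k => if k
    then fun x => ENNReal.ofReal (((Real.sqrt I.card)⁻¹ * x) ^ 2)
    else {x : ℝ | y ≤ |(Real.sqrt J.card)⁻¹ * x|}.indicator 1 with hφ
  have hφm : ∀ k, Measurable (φ k) := fun k => by
    cases k
    · exact measurable_one.indicator (measurableSet_le measurable_const (by fun_prop))
    · simp only [hφ, if_true]; fun_prop
  have := lintegral_prod_blocks h.measurable h.indep (Finset.univ : Finset Bool)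
    (fun k => if k then I else J) (fun k _ l _ hkl => by
      cases k <;> cases l <;> simp_all [Function.onFun, hIJ.symm]) φ hφm
  simp only [Fintype.prod_bool, if_true, Bool.false_eq_true, if_false, hφ] at this
  refine Eq.trans ?_ this
  refine lintegral_congr fun ω => ?_
  by_cases hω : y ≤ |normSum X J ω|
  · rw [Set.indicator_of_mem (show ω ∈ {ω | y ≤ |normSum X J ω|} from hω),
      Set.indicator_of_mem (show _ ∈ {x : ℝ | y ≤ |(Real.sqrt J.card)⁻¹ * x|} from hω)]
    simp [normSum]
  · rw [Set.indicator_of_notMem (show ω ∉ {ω | y ≤ |normSum X J ω|} from hω),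
      Set.indicator_of_notMem (show _ ∉ {x : ℝ | y ≤ |(Real.sqrt J.card)⁻¹ * x|} from hω)]
    simp

/-- The energy of the noise in the largest model on the complement of the good event. -/
lemma IndepNoise.lintegral_bad_le (h : IndepNoise P X σ c) (hσ : 0 < σ) (hc : 0 ≤ c)
    {m : Part n} {u x : ℝ} (hx : 2 ≤ x)
    (hu : ∀ I ∈ m.parts, (σ + c) * x ≤ u * Real.sqrt I.card) :
    ∫⁻ ω in (goodEvent m X u)ᶜ, ENNReal.ofReal (‖estimator m (noiseVec X ω)‖ ^ 2) ∂P ≤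
      ENNReal.ofReal (2 * Real.exp (1 / 2 - x) *
        ((m.parts.card : ℝ) ^ 2 * σ ^ 2 + m.parts.card * ((σ + c) * x) ^ 2)) := by
  have hσc : 0 < σ + c := by linarith
  set y := (σ + c) * x with hy
  have hy0 : 0 < y := by positivity
  -- At this tilt the log-Laplace bound is σ/(2(σ + c)) ≤ 1/2, and the threshold y = (σ + c)x
  -- becomes the exponent x.
  set l := 1 / (σ + c) with hl
  have hl0 : 0 < l := by positivity
  have hlc : l * c < 1 := by rw [hl, one_div_mul_eq_div, div_lt_one hσc]; linarith
  have hly : l * y = x := by rw [hl, hy]; field_simp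
  have hlog : l ^ 2 * σ ^ 2 / (2 * (1 - l * c)) ≤ 1 / 2 := by
    have : 1 - l * c = σ / (σ + c) := by rw [hl]; field_simp; ring
    rw [this, hl]
    have e : (1 / (σ + c)) ^ 2 * σ ^ 2 / (2 * (σ / (σ + c))) = σ / (2 * (σ + c)) := by field_simp
    rw [e, div_le_iff₀ (by positivity)]
    linarith
  have hms := h.measurableSet_goodEvent m u
  set E : Finset (Fin n) → Set Ω := fun J => {ω | y ≤ |normSum X J ω|} with hE
  have hEm : ∀ J, MeasurableSet (E J) := fun J =>
    measurableSet_le measurable_const (h.measurable_normSum J).abs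
  have hFm : ∀ I, Measurable fun ω => ENNReal.ofReal (normSum X I ω ^ 2) := fun I => by
    have := h.measurable_normSum I
    fun_prop
  -- A union bound over the cell J that fails. The energy of the other cells is independent of this
  -- failure, and only the diagonal terms call for a truncated second moment.
  have hsub : ∀ ω ∈ (goodEvent m X u)ᶜ, ∃ J ∈ m.parts, ω ∈ E J := by
    intro ω hω
    rw [Set.mem_compl_iff, mem_goodEvent] at hω
    push Not at hω
    obtain ⟨J, hJ, hJ2⟩ := hω
    refine ⟨J, hJ, ?_⟩
    have hJ0 : (0 : ℝ) < J.card := by exact_mod_cast (m.nonempty_of_mem_parts hJ).card_pos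
    have hs0 := Real.sqrt_pos.2 hJ0
    change y ≤ |normSum X J ω|
    rw [normSum, abs_mul, abs_of_pos (inv_pos.2 hs0), inv_mul_eq_div, le_div_iff₀ hs0]
    have h1 := mul_le_mul_of_nonneg_right (hu J hJ) hs0.le
    rw [mul_assoc u, Real.mul_self_sqrt hJ0.le] at h1
    linarith
  have hdiag : ∀ I ∈ m.parts, ∫⁻ ω in E I, ENNReal.ofReal (normSum X I ω ^ 2) ∂P ≤
      ENNReal.ofReal (2 * Real.exp (1 / 2 - x) * y ^ 2) := by
    intro I hI
    refine ((h.subGamma_normSum hc (m.nonempty_of_mem_parts hI)).lintegral_sq_indicator_le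
      (h.measurable_normSum I) hlc hy0 (by rw [hly]; exact hx)).trans
      (ENNReal.ofReal_le_ofReal ?_)
    rw [hly, mul_right_comm]
    gcongr
  have hoff : ∀ I ∈ m.parts, ∀ J ∈ m.parts, I ≠ J →
      ∫⁻ ω in E J, ENNReal.ofReal (normSum X I ω ^ 2) ∂P ≤
      ENNReal.ofReal (2 * Real.exp (1 / 2 - x) * σ ^ 2) := by
    intro I hI J hJ hne
    have hd : Disjoint I J := m.disjoint hI hJ hne
    rw [hE, h.lintegral_normSum_sq_mul hd y, mul_comm (2 * _),
      ENNReal.ofReal_mul (by positivity)]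
    refine mul_le_mul' ((h.subGamma_normSum hc (m.nonempty_of_mem_parts hI)).lintegral_sq_le
      (h.measurable_normSum I) hc) ?_
    refine ((h.subGamma_normSum hc (m.nonempty_of_mem_parts hJ)).chernoff_abs
      (h.measurable_normSum J) hl0.le hlc y).trans (ENNReal.ofReal_le_ofReal ?_)
    rw [hly]
    gcongr
  have hall : ∀ I ∈ m.parts, ∀ J ∈ m.parts,
      ∫⁻ ω in E J, ENNReal.ofReal (normSum X I ω ^ 2) ∂P ≤
      ENNReal.ofReal (2 * Real.exp (1 / 2 - x) * (σ ^ 2 + if I = J then y ^ 2 else 0)) := by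
    intro I hI J hJ
    by_cases hIJ : I = J
    · subst hIJ
      refine (hdiag I hI).trans (ENNReal.ofReal_le_ofReal ?_)
      rw [if_pos rfl]
      gcongr
      linarith [sq_nonneg σ]
    · rw [if_neg hIJ, add_zero]
      exact hoff I hI J hJ hIJ
  calc ∫⁻ ω in (goodEvent m X u)ᶜ, ENNReal.ofReal (‖estimator m (noiseVec X ω)‖ ^ 2) ∂P
      = ∫⁻ ω in (goodEvent m X u)ᶜ, ∑ I ∈ m.parts, ENNReal.ofReal (normSum X I ω ^ 2) ∂P := by
        refine lintegral_congr fun ω => ?_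
        rw [norm_estimator_noiseVec_sq, ENNReal.ofReal_sum_of_nonneg fun _ _ => sq_nonneg _]
    _ = ∑ I ∈ m.parts, ∫⁻ ω in (goodEvent m X u)ᶜ, ENNReal.ofReal (normSum X I ω ^ 2) ∂P :=
        lintegral_finsetSum _ fun I _ => hFm I
    _ ≤ ∑ I ∈ m.parts, ∑ J ∈ m.parts,
        ENNReal.ofReal (2 * Real.exp (1 / 2 - x) * (σ ^ 2 + if I = J then y ^ 2 else 0)) :=
        Finset.sum_le_sum fun I hI => (setLIntegral_le_sum m.parts E hEm hms.compl hsub _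
          (hFm I)).trans (Finset.sum_le_sum fun J hJ => hall I hI J hJ)
    _ = _ := by
        have hnn : ∀ I J : Finset (Fin n),
            0 ≤ 2 * Real.exp (1 / 2 - x) * (σ ^ 2 + if I = J then y ^ 2 else 0) := fun I J => by
          split_ifs <;> positivity
        simp only [← ENNReal.ofReal_sum_of_nonneg fun J _ => hnn _ J]
        rw [← ENNReal.ofReal_sum_of_nonneg fun I _ => Finset.sum_nonneg fun J _ => hnn I J]
        congr 1
        simp only [← Finset.mul_sum, Finset.sum_add_distrib, Finset.sum_ite_eq, Finset.sum_const,
          nsmul_eq_mul]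
        rw [Finset.sum_congr rfl fun I hI => if_pos hI, Finset.sum_const, nsmul_eq_mul]
        ring

end BadEvent

end Histogram
end

/-! ### The bad-event energy is a fraction of the penalty factor -/

noncomputable section
namespace Histogram

lemma penFactor_eq (σ c : ℝ) {a : ℝ} (b : ℝ) (ha : 0 < a) :
    penFactor σ c a b = 324 * σ ^ 2 + 36 * c * ((σ + c) * (b + 2) / a) := by
  rw [penFactor, kappa]
  field_simp
  ring

lemma log_sq_le {n : ℕ} (hn : 2 ≤ n) : Real.log n ^ 2 ≤ n := by
  have hn0 : (0 : ℝ) < n := by positivity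
  have hL : 0 ≤ Real.log n := Real.log_nonneg (by exact_mod_cast (by omega : 1 ≤ n))
  have h1 := Real.quadratic_le_exp_of_nonneg (x := Real.log n / 2) (by positivity)
  have h2 : Real.log n ≤ Real.exp (Real.log n / 2) := by
    nlinarith [sq_nonneg (Real.log n / 2 - 1)]
  calc Real.log n ^ 2 ≤ Real.exp (Real.log n / 2) ^ 2 := pow_le_pow_left₀ hL h2 2
    _ = n := by rw [← Real.exp_nat_mul]; push_cast; rw [mul_div_cancel₀ _ two_ne_zero,
      Real.exp_log hn0]

lemma Part.sum_card_real {n : ℕ} (m : Part n) : ∑ I ∈ m.parts, (I.card : ℝ) = n := by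
  have := m.sum_card_parts
  rw [Finset.card_univ, Fintype.card_fin] at this
  exact_mod_cast this

lemma Part.card_mul_le {n : ℕ} (m : Part n) {w : ℝ} (hw : ∀ I ∈ m.parts, w ≤ (I.card : ℝ)) :
    m.parts.card * w ≤ n := by
  rw [← m.sum_card_real, ← nsmul_eq_mul]
  exact Finset.card_nsmul_le_sum _ _ _ hw

lemma Part.card_parts_le {n : ℕ} (m : Part n) : (m.parts.card : ℝ) ≤ n := by
  have := m.card_mul_le (w := 1) fun I hI => by
    exact_mod_cast (m.nonempty_of_mem_parts hI).card_pos
  linarith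

variable {Ω : Type*} [MeasurableSpace Ω] {P : Measure Ω} [IsProbabilityMeasure P] {n : ℕ}
  {X : Fin n → Ω → ℝ} {σ c : ℝ}

lemma IndepNoise.lintegral_norm_estimator_sq_le (h : IndepNoise P X σ c) (hc : 0 ≤ c)
    (m : Part n) :
    ∫⁻ ω, ENNReal.ofReal (‖estimator m (noiseVec X ω)‖ ^ 2) ∂P ≤
      ENNReal.ofReal (m.parts.card * σ ^ 2) := by
  have hFm : ∀ I, Measurable fun ω => ENNReal.ofReal (normSum X I ω ^ 2) := fun I => by
    have := h.measurable_normSum I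
    fun_prop
  simp only [norm_estimator_noiseVec_sq, ENNReal.ofReal_sum_of_nonneg fun _ _ => sq_nonneg _]
  rw [lintegral_finsetSum _ fun I _ => hFm I, ENNReal.ofReal_mul (by positivity),
    ENNReal.ofReal_natCast, ← nsmul_eq_mul, ← Finset.sum_const]
  exact Finset.sum_le_sum fun I hI =>
    (h.subGamma_normSum hc (m.nonempty_of_mem_parts hI)).lintegral_sq_le
      (h.measurable_normSum I) hc

/-- Here ν is n, L is log n and N is the number of cells. Since b + 2 ≥ 2, the exponential is at
most n^{-2} and kills N² ≤ n²; for the terms in c², the minimal cell size, through N a²L² ≤ n, turns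
c² into a multiple of cu. -/
lemma bad_energy_numeric {σ c a b N L ν : ℝ} (hc : 0 ≤ c) (hσ : 0 < σ) (ha : 0 < a) (hb : 0 < b)
    (hν : 33 ≤ ν) (hL : 1 ≤ L) (hLν : L ^ 2 ≤ ν) (hexp : Real.exp (-(2 * L)) = 1 / ν ^ 2)
    (hN0 : 0 ≤ N) (hN : N ≤ ν) (hNa : N * (a ^ 2 * L ^ 2) ≤ ν) :
    2 * Real.exp (1 / 2 - (b + 2) * L) *
        (N ^ 2 * σ ^ 2 + N * ((σ + c) * ((b + 2) * L)) ^ 2) ≤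
      (324 * σ ^ 2 + 36 * c * ((σ + c) * (b + 2) / a)) / 10 := by
  have hν0 : 0 < ν := by linarith
  set x := (b + 2) * L with hx
  have hxL : 2 * L ≤ x := by rw [hx]; nlinarith
  have hx0 : 0 < x := by linarith
  have hs : Real.exp (1 / 2) ≤ 1.65 := by
    have h1 : Real.exp (1 / 2) ^ 2 = Real.exp 1 := by rw [← Real.exp_nat_mul]; norm_num
    have h2 := Real.exp_one_lt_d9
    by_contra hcon
    push Not at hcon
    nlinarith
  have he : Real.exp (-x) ≤ 1 / ν ^ 2 := by
    rw [← hexp]; exact Real.exp_le_exp.2 (by linarith)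
  have hq : x ^ 2 * Real.exp (-x) ≤ 4 * L ^ 2 / ν ^ 2 := by
    have := exp_neg_le_pow (a := 2 * L) (z := x) (by linarith) hxL 2 (by push_cast; linarith)
    rw [hexp] at this
    calc x ^ 2 * Real.exp (-x) ≤ x ^ 2 * ((2 * L / x) ^ 2 * (1 / ν ^ 2)) := by gcongr
      _ = 4 * L ^ 2 / ν ^ 2 := by field_simp; ring
  have hLn : 5.5 * L ≤ ν := by
    by_contra hcon
    push Not at hcon
    nlinarith
  have hNaL : N * (a * L ^ 2) ≤ ν * L := by
    have h1 : a * L ≤ (1 + a ^ 2 * L ^ 2) / 2 := by nlinarith [sq_nonneg (a * L - 1)]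
    have h2 : N * (a * L) ≤ ν := by
      have := mul_le_mul_of_nonneg_left h1 hN0
      linarith
    nlinarith
  have hu : 2 * c ^ 2 ≤ c * ((σ + c) * (b + 2) / a) * a := by
    have e : c * ((σ + c) * (b + 2) / a) * a = c * (σ + c) * (b + 2) := by field_simp
    rw [e]
    nlinarith [mul_nonneg hc hc, mul_nonneg hc hσ.le, mul_nonneg (mul_nonneg hc hc) hb.le,
      mul_nonneg (mul_nonneg hc hσ.le) hb.le]
  set U := c * ((σ + c) * (b + 2) / a) with hU
  have hU0 : 0 ≤ U := by positivity
  have hexp2 : Real.exp (1 / 2 - x) = Real.exp (1 / 2) * Real.exp (-x) := by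
    rw [← Real.exp_add]; ring_nf
  have key1 : N ^ 2 * σ ^ 2 * Real.exp (-x) ≤ σ ^ 2 := by
    calc N ^ 2 * σ ^ 2 * Real.exp (-x) ≤ ν ^ 2 * σ ^ 2 * (1 / ν ^ 2) := by gcongr
      _ = σ ^ 2 := by field_simp
  have key2 : N * (2 * σ ^ 2) * (x ^ 2 * Real.exp (-x)) ≤ 8 * σ ^ 2 := by
    calc N * (2 * σ ^ 2) * (x ^ 2 * Real.exp (-x)) ≤ ν * (2 * σ ^ 2) * (4 * ν / ν ^ 2) := by
          refine mul_le_mul (by gcongr) (hq.trans (by gcongr)) (by positivity) (by positivity)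
      _ = 8 * σ ^ 2 := by field_simp; ring
  have key3 : N * (2 * c ^ 2) * (x ^ 2 * Real.exp (-x)) ≤ 8 / 11 * U := by
    calc N * (2 * c ^ 2) * (x ^ 2 * Real.exp (-x)) ≤ N * (U * a) * (4 * L ^ 2 / ν ^ 2) := by
          gcongr
      _ = 4 * U * (N * (a * L ^ 2)) / ν ^ 2 := by ring
      _ ≤ 4 * U * (ν * L) / ν ^ 2 := by gcongr
      _ = 4 * U * (L / ν) := by field_simp
      _ ≤ 4 * U * (2 / 11) := by
          refine mul_le_mul_of_nonneg_left ?_ (by positivity)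
          rw [div_le_iff₀ hν0]
          linarith
      _ = _ := by ring
  have key4 : N * ((σ + c) * x) ^ 2 * Real.exp (-x) ≤ 8 * σ ^ 2 + 8 / 11 * U := by
    calc N * ((σ + c) * x) ^ 2 * Real.exp (-x) = (N * (σ + c) ^ 2) * (x ^ 2 * Real.exp (-x)) := by
          ring
      _ ≤ (N * (2 * σ ^ 2) + N * (2 * c ^ 2)) * (x ^ 2 * Real.exp (-x)) := by
          rw [← mul_add]
          gcongr
          nlinarith [sq_nonneg (σ - c)]
      _ ≤ _ := by rw [add_mul]; exact add_le_add key2 key3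
  calc 2 * Real.exp (1 / 2 - x) * (N ^ 2 * σ ^ 2 + N * ((σ + c) * x) ^ 2)
      = 2 * Real.exp (1 / 2) *
          (N ^ 2 * σ ^ 2 * Real.exp (-x) + N * ((σ + c) * x) ^ 2 * Real.exp (-x)) := by
        rw [hexp2]; ring
    _ ≤ 2 * 1.65 * (σ ^ 2 + (8 * σ ^ 2 + 8 / 11 * U)) := by gcongr
    _ ≤ _ := by nlinarith [sq_nonneg σ]

lemma le_mul_sqrt_card {σ c a b L k : ℝ} (hσc : 0 ≤ σ + c) (ha : 0 < a) (hb : 0 < b)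
    (hk : a ^ 2 * L ^ 2 ≤ k) :
    (σ + c) * ((b + 2) * L) ≤ (σ + c) * (b + 2) / a * Real.sqrt k := by
  have h1 : a * L ≤ Real.sqrt k := Real.le_sqrt_of_sq_le (by rw [mul_pow]; exact hk)
  calc (σ + c) * ((b + 2) * L) = (σ + c) * (b + 2) / a * (a * L) := by field_simp
    _ ≤ _ := by gcongr

lemma IndepNoise.lintegral_bad_le_penFactor (h : IndepNoise P X σ c) (hσ : 0 < σ) (hc : 0 ≤ c)
    {a b : ℝ} (ha : 0 < a) (hb : 0 < b) (hn : 2 ≤ n) {m : Part n}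
    (hcell : ∀ I ∈ m.parts, a ^ 2 * Real.log n ^ 2 ≤ (I.card : ℝ)) :
    ∫⁻ ω in (goodEvent m X ((σ + c) * (b + 2) / a))ᶜ,
        ENNReal.ofReal (‖estimator m (noiseVec X ω)‖ ^ 2) ∂P ≤
      ENNReal.ofReal (penFactor σ c a b / 10) := by
  rw [penFactor_eq σ c b ha]
  have hU : 0 ≤ c * ((σ + c) * (b + 2) / a) := by positivity
  have hN := m.card_parts_le
  -- For n ≤ 32 the full energy is at most 32σ², already below 324σ²/10. The tail computation for
  -- larger n uses log n ≥ 1 and 5.5 log n ≤ n, the latter derived from (log n)² ≤ n.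
  rcases le_or_gt n 32 with h32 | h32
  · refine (setLIntegral_le_lintegral _ _).trans
      ((h.lintegral_norm_estimator_sq_le hc m).trans (ENNReal.ofReal_le_ofReal ?_))
    have h32' : (n : ℝ) ≤ 32 := by exact_mod_cast h32
    nlinarith [sq_nonneg σ]
  · have h33 : (33 : ℝ) ≤ n := by exact_mod_cast h32
    have hn0 : (0 : ℝ) < n := by linarith
    have hL : 1 ≤ Real.log n := by
      rw [Real.le_log_iff_exp_le hn0]
      linarith [Real.exp_one_lt_d9]
    refine (h.lintegral_bad_le hσ hc (x := (b + 2) * Real.log n) (by nlinarith) fun I hI =>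
      le_mul_sqrt_card (by linarith) ha hb (hcell I hI)).trans
      (ENNReal.ofReal_le_ofReal ?_)
    refine bad_energy_numeric hc hσ ha hb h33 hL (log_sq_le hn) ?_ (by positivity) hN
      (m.card_mul_le hcell)
    rw [Real.exp_neg, mul_comm, Real.exp_mul, Real.exp_log hn0, one_div]
    norm_cast

end Histogram
end

/-! ### Uniform control of the variance terms -/

noncomputable section
namespace Histogram

lemma restrict_mem_model {n : ℕ} {m m₀ : Part n} (hle : m₀ ≤ m) {I : Finset (Fin n)}
    (hI : I ∈ m.parts) {h : EuclideanSpace ℝ (Fin n)} (hh : h ∈ model m₀) (v : ℝ) :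
    WithLp.toLp 2 (fun i => if i ∈ I then h i - v else 0) ∈ model m₀ := by
  intro J hJ i hi j hj
  obtain ⟨I', hI', hsub⟩ := hle hJ
  have hiff : ∀ k ∈ J, k ∈ I ↔ I' = I := fun k hk =>
    ⟨fun hkI => m.eq_of_mem_parts hI' hI (hsub hk) hkI, fun e => e ▸ hsub hk⟩
  simp only [hiff i hi, hiff j hj, hh J hJ i hi j hj]

/-- Centred restriction of `h` to `I`. -/
def centredOn {n : ℕ} (h : EuclideanSpace ℝ (Fin n)) (I : Finset (Fin n)) :
    EuclideanSpace ℝ (Fin n) :=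
  WithLp.toLp 2 fun i => if i ∈ I then h i - avg I h else 0

lemma two_inner_sub_norm_sq_centredOn {n : ℕ} (h x : EuclideanSpace ℝ (Fin n))
    (I : Finset (Fin n)) :
    2 * inner ℝ (centredOn h I) x - ‖centredOn h I‖ ^ 2 =
      2 * ∑ i ∈ I, (h i - avg I h) * x i - ∑ i ∈ I, (h i - avg I h) ^ 2 := by
  rw [inner_eq_sum, norm_sq_eq_sum]
  simp [centredOn, ite_pow, ite_mul]

lemma two_inner_sub_norm_sq_residual {n : ℕ} (m : Part n) (h x : EuclideanSpace ℝ (Fin n)) :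
    2 * inner ℝ (h - estimator m h) x - ‖h - estimator m h‖ ^ 2 =
      ∑ I ∈ m.parts, (2 * inner ℝ (centredOn h I) x - ‖centredOn h I‖ ^ 2) := by
  simp only [two_inner_sub_norm_sq_centredOn]
  rw [inner_sub_estimator, norm_sub_estimator_sq, Finset.mul_sum, Finset.sum_sub_distrib]

lemma Part.one_le_card {n : ℕ} (hn : 2 ≤ n) (m : Part n) : (1 : ℝ) ≤ m.parts.card := by
  have : m.parts.Nonempty := ⟨_, m.part_mem_parts ⟨0, by omega⟩⟩
  exact_mod_cast this.card_pos

lemma IndepNoise.measurable_inner {Ω : Type*} [MeasurableSpace Ω] {P : Measure Ω} {n : ℕ}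
    {X : Fin n → Ω → ℝ} {σ c : ℝ} (h : IndepNoise P X σ c)
    (g : EuclideanSpace ℝ (Fin n)) :
    Measurable fun ω => inner ℝ g (noiseVec X ω) := by
  simp only [inner_eq_sum, noiseVec_apply]
  exact Finset.measurable_fun_sum _ fun i _ => (h.measurable i).const_mul _

variable {Ω : Type*} [MeasurableSpace Ω] {P : Measure Ω} [IsProbabilityMeasure P] {n : ℕ}
  {X : Fin n → Ω → ℝ} {σ c : ℝ}

lemma IndepNoise.integrable_inner (h : IndepNoise P X σ c) (hc : 0 ≤ c)
    (g : EuclideanSpace ℝ (Fin n)) : Integrable (fun ω => inner ℝ g (noiseVec X ω)) P := by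
  simp only [inner_eq_sum, noiseVec_apply]
  exact h.integrable_sum_mul hc _ _

lemma IndepNoise.integral_inner (h : IndepNoise P X σ c) (hc : 0 ≤ c)
    (g : EuclideanSpace ℝ (Fin n)) : ∫ ω, inner ℝ g (noiseVec X ω) ∂P = 0 := by
  simp only [inner_eq_sum, noiseVec_apply]
  exact h.integral_sum_mul hc _ _

lemma IndepNoise.measurable_norm_estimator_sq (h : IndepNoise P X σ c) (m : Part n) :
    Measurable fun ω => ‖estimator m (noiseVec X ω)‖ ^ 2 := by
  simp only [norm_estimator_noiseVec_sq]
  exact Finset.measurable_fun_sum _ fun I _ => (h.measurable_normSum I).pow_const 2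

lemma IndepNoise.integrable_norm_estimator_sq (h : IndepNoise P X σ c) (hc : 0 ≤ c)
    (m : Part n) : Integrable (fun ω => ‖estimator m (noiseVec X ω)‖ ^ 2) P :=
  (integrable_of_lintegral_ofReal_le (h.measurable_norm_estimator_sq m)
    (fun _ => sq_nonneg _) (by positivity) (h.lintegral_norm_estimator_sq_le hc m)).1

lemma IndepNoise.exists_bad_energy (h : IndepNoise P X σ c) (hσ : 0 < σ) (hc : 0 ≤ c)
    {a b : ℝ} (ha : 0 < a) (hb : 0 < b) (hn : 2 ≤ n) {m : Part n}
    (hcell : ∀ I ∈ m.parts, a ^ 2 * Real.log n ^ 2 ≤ (I.card : ℝ)) :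
    ∃ Z : Ω → ℝ, Integrable Z P ∧ (∀ ω, 0 ≤ Z ω) ∧
      (∀ ω, ω ∉ goodEvent m X ((σ + c) * (b + 2) / a) →
        ‖estimator m (noiseVec X ω)‖ ^ 2 ≤ Z ω) ∧
      ∫ ω, Z ω ∂P ≤ penFactor σ c a b / 10 := by
  set S := goodEvent m X ((σ + c) * (b + 2) / a) with hS
  have hSm : MeasurableSet Sᶜ := (h.measurableSet_goodEvent m _).compl
  have hV : 0 ≤ penFactor σ c a b := by rw [penFactor_eq σ c b ha]; positivity
  set Z := Sᶜ.indicator fun ω => ‖estimator m (noiseVec X ω)‖ ^ 2 with hZ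
  have hZ0 : ∀ ω, 0 ≤ Z ω := fun ω => Set.indicator_nonneg (fun _ _ => sq_nonneg _) ω
  have hb := h.lintegral_bad_le_penFactor hσ hc ha hb hn hcell
  rw [← lintegral_indicator hSm] at hb
  have e : ∀ ω, Sᶜ.indicator (fun ω => ENNReal.ofReal (‖estimator m (noiseVec X ω)‖ ^ 2)) ω =
      ENNReal.ofReal (Z ω) := fun ω => by
    by_cases hω : ω ∈ Sᶜ
    · rw [hZ, Set.indicator_of_mem hω, Set.indicator_of_mem hω]
    · rw [hZ, Set.indicator_of_notMem hω, Set.indicator_of_notMem hω, ENNReal.ofReal_zero]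
  rw [lintegral_congr e] at hb
  obtain ⟨h1, h2⟩ := integrable_of_lintegral_ofReal_le
    ((h.measurable_norm_estimator_sq m).indicator hSm) hZ0 (by positivity) hb
  exact ⟨Z, h1, hZ0, fun ω hω => le_of_eq
    (Set.indicator_of_mem (s := Sᶜ) hω fun ω => ‖estimator m (noiseVec X ω)‖ ^ 2).symm, h2⟩

/-- Each cell contributes a factor 3 to the exponential moment, and 3 ≤ e^{9/8}; the constant 3/8
bounds e^{-1}. -/
lemma three_pow_mul_exp_le {p : ℕ} {Δ k : ℝ} (hΔ : 0 ≤ Δ) (hk : 9 / 8 ≤ k) :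
    3 ^ p * Real.exp (-(k * (p + Δ)) - 1) ≤ 3 / 8 * Real.exp (-Δ) := by
  have he : (3 : ℝ) ≤ Real.exp (9 / 8) := by
    have h1 := Real.quadratic_le_exp_of_nonneg (x := 1 / 8) (by norm_num)
    have h2 := Real.exp_one_gt_d9
    have : Real.exp (9 / 8) = Real.exp 1 * Real.exp (1 / 8) := by rw [← Real.exp_add]; norm_num
    nlinarith
  have h3 : (3 : ℝ) ^ p ≤ Real.exp (9 / 8 * p) := by
    rw [mul_comm, Real.exp_nat_mul]
    exact pow_le_pow_left₀ (by norm_num) he p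
  have h4 : Real.exp (-1) ≤ 3 / 8 := by
    rw [Real.exp_neg, inv_le_comm₀ (Real.exp_pos 1) (by norm_num)]
    linarith [Real.exp_one_gt_d9]
  calc 3 ^ p * Real.exp (-(k * (p + Δ)) - 1)
      ≤ Real.exp (9 / 8 * p) * Real.exp (-(9 / 8 * p) - Δ - 1) := by
        gcongr
        nlinarith [mul_nonneg (sub_nonneg.2 hk) (Nat.cast_nonneg (α := ℝ) p),
          mul_nonneg (sub_nonneg.2 hk) hΔ]
    _ = Real.exp (-1) * Real.exp (-Δ) := by rw [← Real.exp_add, ← Real.exp_add]; ring_nf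
    _ ≤ _ := by gcongr

/-- Uniform control of the variance terms. -/
lemma IndepNoise.exists_variance_excess (h : IndepNoise P X σ c) (hσ : 0 < σ) (hc : 0 ≤ c)
    {a b : ℝ} (ha : 0 < a) (hb : 0 < b) (hn : 2 ≤ n) {m₀ : Part n}
    (hcell : ∀ I ∈ m₀.parts, a ^ 2 * Real.log n ^ 2 ≤ (I.card : ℝ)) (M : Finset (Part n))
    (hM : ∀ m ∈ M, model m ≤ model m₀) (Δ : Part n → ℝ) (hΔ : ∀ m ∈ M, 0 ≤ Δ m) :
    ∃ Z : Ω → ℝ, Integrable Z P ∧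
      ∫ ω, Z ω ∂P ≤ penFactor σ c a b / 12 * ∑ m ∈ M, Real.exp (-Δ m) ∧
      ∀ ω, ∀ m ∈ M, 2 * ‖estimator m (noiseVec X ω)‖ ^ 2
        - penFactor σ c a b / 4 * (m.parts.card + Δ m) - penFactor σ c a b / 5 ≤ Z ω := by
  obtain ⟨Zb, hZbi, hZb0, hZb, hZbI⟩ := h.exists_bad_energy hσ hc ha hb hn hcell
  set V := penFactor σ c a b with hV
  set u := (σ + c) * (b + 2) / a with hu
  have hu0 : 0 ≤ u := by positivity
  have hVeq : V = 324 * σ ^ 2 + 36 * c * u := penFactor_eq σ c b ha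
  set W := σ ^ 2 + c * u with hW
  have hW0 : 0 < W := by positivity
  have hVW : 36 * W ≤ V := by rw [hVeq, hW]; nlinarith [sq_nonneg σ]
  have hVpos : 0 < V := by linarith
  have hex : ∀ m ∈ M, ∃ Z : Ω → ℝ, Integrable Z P ∧ (∀ ω, 0 ≤ Z ω) ∧
      (∀ ω ∈ goodEvent m₀ X u, 2 * ‖estimator m (noiseVec X ω)‖ ^ 2
        - V / 4 * (m.parts.card + Δ m) ≤ Z ω) ∧ ∫ ω, Z ω ∂P ≤ V / 12 * Real.exp (-Δ m) := by
    intro m hm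
    have hle : m₀ ≤ m := le_of_model_le (hM m hm)
    have h1 := h.lintegral_exp_norm_estimator_sq hσ hc hu0 m
    have h2 : ∫⁻ ω in goodEvent m₀ X u, ENNReal.ofReal
        (Real.exp (1 / (8 * W) * (2 * ‖estimator m (noiseVec X ω)‖ ^ 2))) ∂P ≤
        ENNReal.ofReal (3 ^ m.parts.card) := by
      refine le_trans (lintegral_mono_set (goodEvent_mono hle u)) (le_trans (le_of_eq ?_) h1)
      refine lintegral_congr fun ω => ?_
      congr 2
      rw [hW]
      field_simp
      ring
    obtain ⟨Z, hZi, hZ0, hZ, hZI⟩ := exists_excess (h.measurableSet_goodEvent m₀ u)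
      ((h.measurable_norm_estimator_sq m).const_mul 2) (by positivity) (by positivity) h2
      (V / 4 * (m.parts.card + Δ m))
    refine ⟨Z, hZi, hZ0, hZ, hZI.trans ?_⟩
    -- At the rate 1/(8W), the level V/4 per unit amounts to V/(32W), which is at least 36/32 = 9/8.
    have h3 := three_pow_mul_exp_le (p := m.parts.card) (hΔ m hm)
      (k := 1 / (8 * W) * (V / 4)) (by
        rw [one_div_mul_eq_div, le_div_iff₀ (by positivity)]; linarith)
    calc 3 ^ m.parts.card / (1 / (8 * W)) *
          Real.exp (-(1 / (8 * W) * (V / 4 * (m.parts.card + Δ m))) - 1)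
        = 8 * W * (3 ^ m.parts.card *
            Real.exp (-(1 / (8 * W) * (V / 4) * (m.parts.card + Δ m)) - 1)) := by
          rw [mul_assoc (1 / (8 * W)) (V / 4)]
          field_simp
      _ ≤ 8 * W * (3 / 8 * Real.exp (-Δ m)) := by gcongr
      _ ≤ V / 12 * Real.exp (-Δ m) := by
          have := Real.exp_pos (-Δ m)
          nlinarith
  choose! Z hZi hZ0 hZ hZI using hex
  have hsum : Integrable (fun ω => ∑ m ∈ M, Z m ω) P := integrable_finsetSum _ fun m hm => hZi m hm
  have h2b : Integrable (fun ω => 2 * Zb ω) P := hZbi.const_mul 2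
  have hadd : Integrable (fun ω => ∑ m ∈ M, Z m ω + 2 * Zb ω) P := hsum.add h2b
  -- Subtracting V/5 compensates the mean of the bad-event energy; the same V/5 is deducted on the
  -- left side and will be paid by the penalty, as |m| ≥ 1.
  refine ⟨fun ω => ∑ m ∈ M, Z m ω + 2 * Zb ω - V / 5, hadd.sub (integrable_const _), ?_, ?_⟩
  · rw [integral_sub hadd (integrable_const _), integral_add hsum h2b, integral_const_mul]
    rw [integral_finsetSum]; swap
    · exact fun m hm => hZi m hm
    have := Finset.sum_le_sum hZI
    rw [← Finset.mul_sum] at this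
    simp only [integral_const, probReal_univ, one_smul]
    linarith
  · intro ω m hm
    have hn1 := m.one_le_card hn
    have hsum0 : 0 ≤ ∑ m ∈ M, Z m ω := Finset.sum_nonneg fun m hm => hZ0 m hm ω
    have hbud : 0 ≤ V / 4 * (m.parts.card + Δ m) := by
      have := hΔ m hm
      positivity
    by_cases hω : ω ∈ goodEvent m₀ X u
    · have h1 := hZ m hm ω hω
      have h2 := Finset.single_le_sum (f := fun m => Z m ω) (fun m hm => hZ0 m hm ω) hm
      linarith [hZb0 ω]
    · have h1 := hZb ω hω
      have h2 := norm_estimator_sq_le (hM m hm) (noiseVec X ω)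
      linarith

end Histogram
end

/-! ### Uniform control of the linear terms -/

noncomputable section
namespace Histogram

/-- The component of h orthogonal to the largest model contributes a linear term that does not
depend on m and is centred. Only a vector of the largest model, to which the good event applies,
remains. -/
lemma inner_residual_le {n : ℕ} {m m₀ : Part n} (hm : model m ≤ model m₀)
    (h x : EuclideanSpace ℝ (Fin n)) :
    2 * inner ℝ (h - estimator m h) x - ‖h - estimator m h‖ ^ 2 ≤
      2 * inner ℝ (estimator m₀ h - estimator m (estimator m₀ h)) x
        - ‖estimator m₀ h - estimator m (estimator m₀ h)‖ ^ 2
        + 2 * inner ℝ (h - estimator m₀ h) x := by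
  obtain ⟨h1, h2⟩ := residual_project hm h x
  rw [h1, h2]
  linarith [sq_nonneg ‖h - estimator m₀ h‖]

variable {Ω : Type*} [MeasurableSpace Ω] {P : Measure Ω} [IsProbabilityMeasure P] {n : ℕ}
  {X : Fin n → Ω → ℝ} {σ c : ℝ}

/-- Excess of the functional attached to a vector of the largest model over a level. -/
lemma IndepNoise.exists_inner_excess (h : IndepNoise P X σ c) (hσ : 0 < σ) (hc : 0 ≤ c)
    {u V : ℝ} (hu : 0 ≤ u) (hV : 36 * (σ ^ 2 + c * u) ≤ V) {m : Part n}
    {g : EuclideanSpace ℝ (Fin n)} (hg : g ∈ model m) {s : ℝ} (hs : 0 ≤ s) :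
    ∃ Z : Ω → ℝ, Integrable Z P ∧ (∀ ω, 0 ≤ Z ω) ∧
      (∀ ω ∈ goodEvent m X u, 2 * inner ℝ g (noiseVec X ω) - ‖g‖ ^ 2 - s * V ≤ Z ω) ∧
      ∫ ω, Z ω ∂P ≤ V / 18 * Real.exp (-(18 * s) - 1) := by
  have hW0 : 0 < σ ^ 2 + c * u := by positivity
  have hV0 : 0 < V := by linarith
  set D := 2 * σ ^ 2 + 2 * c * u with hD
  have hD0 : 0 < D := by positivity
  have hDV : 18 * D ≤ V := by linarith
  obtain ⟨Z, h1, h2, h3, h4⟩ := exists_excess (h.measurableSet_goodEvent m u)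
    (((h.measurable_inner g).const_mul 2).sub_const (‖g‖ ^ 2)) (by positivity) zero_le_one
    (h.lintegral_exp_two_inner hσ hc hu hg) (s * V)
  refine ⟨Z, h1, h2, h3, h4.trans ?_⟩
  rw [one_div_one_div]
  have h5 : 18 * s ≤ 1 / D * (s * V) := by
    rw [one_div_mul_eq_div, le_div_iff₀ hD0]
    nlinarith
  gcongr
  linarith

section Linear

variable (h : IndepNoise P X σ c) (hσ : 0 < σ) (hc : 0 ≤ c)
    {a b : ℝ} (ha : 0 < a) (hb : 0 < b) (hn : 2 ≤ n) {m₀ : Part n}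
    (hcell : ∀ I ∈ m₀.parts, a ^ 2 * Real.log n ^ 2 ≤ (I.card : ℝ)) (M : Finset (Part n))
    (hM : ∀ m ∈ M, model m ≤ model m₀)
include h hσ hc ha hb hn hcell hM

/-- Uniform control of the linear terms, with weights. -/
lemma IndepNoise.exists_linear_excess_weights (Δ : Part n → ℝ) (hΔ : ∀ m ∈ M, 0 ≤ Δ m)
    {β : ℝ} (hβ : 11 / 20 ≤ β) (g : EuclideanSpace ℝ (Fin n)) :
    ∃ Z : Ω → ℝ, Integrable Z P ∧
      ∫ ω, Z ω ∂P ≤ penFactor σ c a b / 10000 * ∑ m ∈ M, Real.exp (-Δ m) ∧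
      ∀ ω, ∀ m ∈ M, 2 * inner ℝ (g - estimator m g) (noiseVec X ω) - ‖g - estimator m g‖ ^ 2
        - β * penFactor σ c a b * (m.parts.card + Δ m) ≤ Z ω := by
  obtain ⟨Zb, hZbi, hZb0, hZb, hZbI⟩ := h.exists_bad_energy hσ hc ha hb hn hcell
  set V := penFactor σ c a b with hV
  set u := (σ + c) * (b + 2) / a with hu
  have hu0 : 0 ≤ u := by positivity
  have hVeq : V = 324 * σ ^ 2 + 36 * c * u := penFactor_eq σ c b ha
  have hVW : 36 * (σ ^ 2 + c * u) ≤ V := by rw [hVeq]; nlinarith [sq_nonneg σ]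
  have hVpos : 0 < V := by
    have : 0 < σ ^ 2 + c * u := by positivity
    linarith
  set g₀ := estimator m₀ g with hg₀
  have hmem : ∀ m ∈ M, g₀ - estimator m g₀ ∈ model m₀ := fun m hm =>
    (model m₀).sub_mem (estimator_mem m₀ g) (hM m hm (estimator_mem m g₀))
  have hex : ∀ m ∈ M, ∃ Z : Ω → ℝ, Integrable Z P ∧ (∀ ω, 0 ≤ Z ω) ∧
      (∀ ω ∈ goodEvent m₀ X u, 2 * inner ℝ (g₀ - estimator m g₀) (noiseVec X ω)
        - ‖g₀ - estimator m g₀‖ ^ 2 - 9 / 20 * (m.parts.card + Δ m) * V ≤ Z ω) ∧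
      ∫ ω, Z ω ∂P ≤ V / 10000 * Real.exp (-Δ m) := by
    intro m hm
    have hΔm := hΔ m hm
    obtain ⟨Z, h1, h2, h3, h4⟩ := h.exists_inner_excess hσ hc hu0 hVW (hmem m hm)
      (s := 9 / 20 * (m.parts.card + Δ m)) (by positivity)
    refine ⟨Z, h1, h2, h3, h4.trans ?_⟩
    have he : Real.exp (-9) ≤ 1 / 1000 := by
      have h5 : Real.exp (-9) = (Real.exp 1 ^ 9)⁻¹ := by
        rw [← Real.exp_nat_mul, ← Real.exp_neg]; norm_num
      rw [h5, one_div]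
      gcongr
      calc (1000 : ℝ) ≤ 2.7 ^ 9 := by norm_num
        _ ≤ Real.exp 1 ^ 9 := by gcongr; linarith [Real.exp_one_gt_d9]
    -- 18·9/20 = 8.1, so the exponent is at most -9.1 - Δ_m because |m| ≥ 1. The 1/10 between 9/20
    -- and 11/20 is reserved for the bad-event energy.
    calc V / 18 * Real.exp (-(18 * (9 / 20 * (m.parts.card + Δ m))) - 1)
        ≤ V / 18 * Real.exp (-9 + -Δ m) := by
          gcongr
          linarith [m.one_le_card hn]
      _ = V / 18 * (Real.exp (-9) * Real.exp (-Δ m)) := by rw [Real.exp_add]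
      _ ≤ V / 18 * (1 / 1000 * Real.exp (-Δ m)) := by gcongr
      _ ≤ V / 10000 * Real.exp (-Δ m) := by
          have := mul_pos hVpos (Real.exp_pos (-Δ m))
          linarith
  choose! Z hZi hZ0 hZ hZI using hex
  have hsum : Integrable (fun ω => ∑ m ∈ M, Z m ω) P := integrable_finsetSum _ fun m hm => hZi m hm
  have hcomb := integral_combination (P := P) hsum hZbi hZbi
    (h.integrable_inner hc (g - g₀)) 1 0 2 (V / 10)
  refine ⟨_, hcomb.1, ?_, ?_⟩
  · rw [hcomb.2, h.integral_inner hc]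
    rw [integral_finsetSum]; swap
    · exact fun m hm => hZi m hm
    have := Finset.sum_le_sum hZI
    rw [← Finset.mul_sum] at this
    linarith
  · intro ω m hm
    have hn1 := m.one_le_card hn
    have hΔm := hΔ m hm
    have hsum0 : 0 ≤ ∑ m ∈ M, Z m ω := Finset.sum_nonneg fun m hm => hZ0 m hm ω
    have h0 := inner_residual_le (hM m hm) g (noiseVec X ω)
    have hbud : 11 / 20 * V * (m.parts.card + Δ m) ≤ β * V * (m.parts.card + Δ m) := by
      gcongr
    have hbud2 : V ≤ V * (m.parts.card + Δ m) := le_mul_of_one_le_right hVpos.le (by linarith)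
    by_cases hω : ω ∈ goodEvent m₀ X u
    · have h1 := hZ m hm ω hω
      have h2 := Finset.single_le_sum (f := fun m => Z m ω) (fun m hm => hZ0 m hm ω) hm
      linarith [hZb0 ω]
    · have h1 := hZb ω hω
      have h2 := two_inner_sub_norm_sq_le (hmem m hm) (noiseVec X ω)
      linarith

/-- Uniform control of the linear terms by a union bound over all cells. -/
lemma IndepNoise.exists_linear_excess_cells (hcons : ∀ m ∈ M, Consecutive m)
    (hlog : Real.log n ≤ 32) (g : EuclideanSpace ℝ (Fin n)) :
    ∃ Z : Ω → ℝ, Integrable Z P ∧ ∫ ω, Z ω ∂P ≤ 0 ∧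
      ∀ ω, ∀ m ∈ M, 2 * inner ℝ (g - estimator m g) (noiseVec X ω) - ‖g - estimator m g‖ ^ 2
        - 398 / 100 * penFactor σ c a b * m.parts.card ≤ Z ω := by
  classical
  obtain ⟨Zb, hZbi, hZb0, hZb, hZbI⟩ := h.exists_bad_energy hσ hc ha hb hn hcell
  set V := penFactor σ c a b with hV
  set u := (σ + c) * (b + 2) / a with hu
  have hu0 : 0 ≤ u := by positivity
  have hVeq : V = 324 * σ ^ 2 + 36 * c * u := penFactor_eq σ c b ha
  have hVW : 36 * (σ ^ 2 + c * u) ≤ V := by rw [hVeq]; nlinarith [sq_nonneg σ]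
  have hVpos : 0 < V := by
    have : 0 < σ ^ 2 + c * u := by positivity
    linarith
  set g₀ := estimator m₀ g with hg₀
  set 𝓘 : Finset (Finset (Fin n)) := M.biUnion fun m => m.parts with h𝓘
  have hex : ∀ I ∈ 𝓘, ∃ Z : Ω → ℝ, Integrable Z P ∧ (∀ ω, 0 ≤ Z ω) ∧
      (∀ ω ∈ goodEvent m₀ X u, 2 * inner ℝ (centredOn g₀ I) (noiseVec X ω)
        - ‖centredOn g₀ I‖ ^ 2 - 368 / 100 * V ≤ Z ω) ∧
      ∫ ω, Z ω ∂P ≤ V / 18 * Real.exp (-67) := by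
    intro I hI
    obtain ⟨m, hm, hIm⟩ := Finset.mem_biUnion.1 hI
    -- The level 3.68V gives an exponent 18·3.68 + 1 > 67, beyond the logarithm, at most 64, of the
    -- number of intervals. The rest 0.30V of the budget 3.98V absorbs the union bound and the
    -- bad-event energy and makes the mean nonpositive.
    obtain ⟨Z, h1, h2, h3, h4⟩ := h.exists_inner_excess hσ hc hu0 hVW
      (restrict_mem_model (le_of_model_le (hM m hm)) hIm (estimator_mem m₀ g) (avg I g₀))
      (s := 368 / 100) (by positivity)
    refine ⟨Z, h1, h2, h3, h4.trans ?_⟩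
    gcongr
    norm_num
  choose! Z hZi hZ0 hZ hZI using hex
  have hcard : (𝓘.card : ℝ) ≤ Real.exp 64 := by
    have h1 : 𝓘.card ≤ n ^ 2 := card_le_of_ordConnected fun I hI => by
      obtain ⟨m, hm, hIm⟩ := Finset.mem_biUnion.1 hI
      exact ⟨m.nonempty_of_mem_parts hIm, hcons m hm I hIm⟩
    have h2 : (n : ℝ) ≤ Real.exp 32 := by
      rwa [← Real.log_le_iff_le_exp (by positivity)]
    calc (𝓘.card : ℝ) ≤ (n : ℝ) ^ 2 := by exact_mod_cast h1
      _ ≤ Real.exp 32 ^ 2 := by gcongr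
      _ = Real.exp 64 := by rw [← Real.exp_nat_mul]; norm_num
  have hsum : Integrable (fun ω => ∑ I ∈ 𝓘, Z I ω) P :=
    integrable_finsetSum _ fun m hm => hZi m hm
  have hcomb := integral_combination (P := P) hsum hZbi hZbi
    (h.integrable_inner hc (g - g₀)) 1 0 2 (3 / 10 * V)
  refine ⟨_, hcomb.1, ?_, ?_⟩
  · rw [hcomb.2, h.integral_inner hc]
    rw [integral_finsetSum]; swap
    · exact fun m hm => hZi m hm
    have h1 := Finset.sum_le_sum hZI
    rw [Finset.sum_const, nsmul_eq_mul] at h1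
    have h2 : (𝓘.card : ℝ) * (V / 18 * Real.exp (-67)) ≤ V / 18 := by
      calc (𝓘.card : ℝ) * (V / 18 * Real.exp (-67))
          ≤ Real.exp 64 * (V / 18 * Real.exp (-67)) := by gcongr
        _ = V / 18 * Real.exp (-3) := by
            rw [mul_left_comm, ← Real.exp_add]; norm_num
        _ ≤ V / 18 * 1 := by
            gcongr
            exact Real.exp_le_one_iff.2 (by norm_num)
        _ = V / 18 := mul_one _
    linarith
  · intro ω m hm
    have hn1 := m.one_le_card hn
    have hsum0 : 0 ≤ ∑ I ∈ 𝓘, Z I ω := Finset.sum_nonneg fun m hm => hZ0 m hm ω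
    have h0 := inner_residual_le (hM m hm) g (noiseVec X ω)
    have hbud : V ≤ V * m.parts.card := le_mul_of_one_le_right hVpos.le hn1
    have hmem : g₀ - estimator m g₀ ∈ model m₀ :=
      (model m₀).sub_mem (estimator_mem m₀ g) (hM m hm (estimator_mem m g₀))
    have hsub : m.parts ⊆ 𝓘 := Finset.subset_biUnion_of_mem (fun m : Part n => m.parts) hm
    by_cases hω : ω ∈ goodEvent m₀ X u
    · have h1 : 2 * inner ℝ (g₀ - estimator m g₀) (noiseVec X ω) - ‖g₀ - estimator m g₀‖ ^ 2
          - 368 / 100 * V * m.parts.card ≤ ∑ I ∈ 𝓘, Z I ω := by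
        rw [two_inner_sub_norm_sq_residual]
        have h2 := Finset.sum_le_sum fun I hI => hZ I (hsub hI) ω hω
        rw [Finset.sum_sub_distrib, Finset.sum_const, nsmul_eq_mul] at h2
        have h3 := Finset.sum_le_sum_of_subset_of_nonneg hsub fun I hI _ => hZ0 I hI ω
        linarith
      linarith [hZb0 ω]
    · have h1 := hZb ω hω
      have h2 := two_inner_sub_norm_sq_le hmem (noiseVec X ω)
      linarith

-- For large n a union bound over intervals exceeds the budget. The maximal inequality costs 1280(σ²
-- + 7c²/w) per cell, and 1280 < 3.98·324; the term in c² is tamed by the minimal cell size, which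
-- is large when log n is.
omit hM hn in
lemma IndepNoise.exists_linear_excess_segmentation (hM : ∀ m ∈ M, model m ≤ model m₀)
    (hcons : ∀ m ∈ M, Consecutive m) (hm₀ : Consecutive m₀)
    (hlog : 32 ≤ Real.log n) (g : EuclideanSpace ℝ (Fin n)) :
    ∃ Z : Ω → ℝ, Integrable Z P ∧ ∫ ω, Z ω ∂P ≤ 0 ∧
      ∀ ω, ∀ m ∈ M, 2 * inner ℝ (g - estimator m g) (noiseVec X ω) - ‖g - estimator m g‖ ^ 2
        - 398 / 100 * penFactor σ c a b * m.parts.card ≤ Z ω := by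
  set L := Real.log n with hL
  -- Cells are nonempty, so 1 is a valid lower bound; with it aL ≤ w holds both for aL ≤ 1 and for
  -- aL ≥ 1.
  set w := max 1 (a ^ 2 * L ^ 2) with hw
  have hw0 : 0 < w := lt_max_of_lt_left one_pos
  have hwc : ∀ i, w ≤ ((cell m₀.label (m₀.label i)).card : ℝ) := fun i => by
    have hI := m₀.part_mem_parts i
    have : cell m₀.label (m₀.label i) = m₀.part i := hm₀.cell_label hI
    rw [this]
    exact max_le (by exact_mod_cast (m₀.nonempty_of_mem_parts hI).card_pos) (hcell _ hI)
  obtain ⟨Z, hZi, hZI, hZ⟩ := h.segmentation_bound hσ hc m₀.label hw0 hwc rfl g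
  refine ⟨Z, hZi, hZI, fun ω m hm => ?_⟩
  have hlab := (hcons m hm).isLabeling hm₀ (le_of_model_le (hM m hm))
  have h1 := hZ ω _ _ hlab
  rw [(hcons m hm).sum_range_label fun I => 2 * ∑ i ∈ I, (g i - avg I g) * X i ω
    - ∑ i ∈ I, (g i - avg I g) ^ 2 - 1280 * (σ ^ 2 + 7 * c ^ 2 / w), Finset.sum_sub_distrib,
    Finset.sum_const, nsmul_eq_mul] at h1
  have h2 := two_inner_sub_norm_sq_residual m g (noiseVec X ω)
  simp only [two_inner_sub_norm_sq_centredOn, noiseVec_apply] at h2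
  rw [h2]
  have hV : 1280 * (σ ^ 2 + 7 * c ^ 2 / w) ≤ 398 / 100 * penFactor σ c a b := by
    rw [penFactor_eq σ c b ha]
    set u := (σ + c) * (b + 2) / a with hu
    have hL0 : 0 < L := by linarith
    have h3 : L / w ≤ 1 / a := by
      rw [div_le_div_iff₀ hw0 ha, one_mul]
      have h4 : a * L ≤ w := by
        rcases le_total (a * L) 1 with h5 | h5
        · exact h5.trans (le_max_left _ _)
        · refine le_trans ?_ (le_max_right _ _)
          nlinarith
      linarith
    have h5 : 2 * c ^ 2 / a ≤ c * u := by
      rw [hu, div_le_iff₀ ha]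
      have e : c * ((σ + c) * (b + 2) / a) * a = c * (σ + c) * (b + 2) := by field_simp
      rw [e]
      nlinarith [mul_nonneg hc hc, mul_nonneg hc hσ.le, mul_nonneg (mul_nonneg hc hc) hb.le,
        mul_nonneg (mul_nonneg hc hσ.le) hb.le]
    -- Here log n ≥ 32 enters: 1280·7·c²/w is then at most 140cu, within 3.98·36cu.
    have h6 : 2 * 32 * (c ^ 2 / w) ≤ c * u := by
      calc 2 * 32 * (c ^ 2 / w) ≤ 2 * L * (c ^ 2 / w) := by gcongr
        _ = 2 * c ^ 2 * (L / w) := by ring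
        _ ≤ 2 * c ^ 2 * (1 / a) := by gcongr
        _ = 2 * c ^ 2 / a := by ring
        _ ≤ c * u := h5
    have h7 : 7 * c ^ 2 / w = 7 * (c ^ 2 / w) := by ring
    have h9 : 0 ≤ c * u := by positivity
    rw [h7]
    nlinarith [sq_nonneg σ]
  have h8 := mul_le_mul_of_nonneg_left hV (Nat.cast_nonneg (α := ℝ) m.parts.card)
  linarith

end Linear

end Histogram
end

/-! ### From the stochastic bounds to the oracle inequality -/

noncomputable section
namespace Histogram

lemma ExpMomentBound.subGamma {Ω : Type*} [MeasurableSpace Ω] {P : Measure Ω} [NeZero P]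
    {X : Ω → ℝ} {σ c : ℝ} (h : ExpMomentBound P X σ c) : SubGamma P X (σ ^ 2) c := by
  intro l hl
  obtain ⟨h1, h2⟩ := h l hl
  rw [← ofReal_integral_eq_lintegral_ofReal h1
    (Filter.Eventually.of_forall fun ω => (Real.exp_pos _).le)]
  exact ENNReal.ofReal_le_ofReal ((Real.log_le_iff_le_exp (integral_exp_pos h1)).1 h2)

lemma indepNoise_sub_integral {Ω : Type*} [MeasurableSpace Ω] {P : Measure Ω}
    [IsProbabilityMeasure P] {n : ℕ} {Y : Ω → EuclideanSpace ℝ (Fin n)} (hY : Measurable Y)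
    (hYint : Integrable Y P) (hind : iIndepFun (fun (i : Fin n) (ω : Ω) => Y ω i) P)
    {f : EuclideanSpace ℝ (Fin n)} (hf : f = ∫ ω, Y ω ∂P) {σ c : ℝ}
    (h : ∀ i : Fin n, ExpMomentBound P (fun ω => Y ω i - f i) σ c) :
    IndepNoise P (fun i ω => Y ω i - f i) σ c where
  measurable i := ((EuclideanSpace.proj (𝕜 := ℝ) i).measurable.comp hY).sub_const _
  indep := hind.comp (fun i x => x - f i) fun i => measurable_id.sub_const _
  subGamma i := (h i).subGamma
  mean i := by
    have h1 := (EuclideanSpace.proj (𝕜 := ℝ) i).integral_comp_comm hYint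
    have h2 : Integrable (fun ω => Y ω i) P :=
      (EuclideanSpace.proj (𝕜 := ℝ) i).integrable_comp hYint
    rw [← hf] at h1
    rw [integral_sub h2 (integrable_const _)]
    simp only [integral_const, probReal_univ, one_smul]
    exact sub_eq_zero.2 h1

lemma oracleConst_pos {K : ℝ} (hK : 1 < K) : 0 < oracleConst K := by
  have : 0 < K ^ 2 + K - 1 := by nlinarith
  have h2 : 0 < K - 1 := by linarith
  rw [oracleConst]; positivity

/-- This product of K and the bias fraction ε lies between 1 and 4 and tends to 4 as K grows. The
lower bound, tight as K decreases to 1, makes the budget sufficient for small K; the limit 4 is what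
large K relies on. -/
lemma mul_one_sub_inv_oracleConst {K : ℝ} (hK : 1 < K) :
    K * (1 - (oracleConst K)⁻¹) = (2 * K - 1) ^ 2 / (K ^ 2 + K - 1) := by
  have h1 : 0 < K ^ 2 + K - 1 := by nlinarith
  have h2 : 0 < K - 1 := by linarith
  have h3 : 0 < K := by linarith
  rw [oracleConst, inv_div]
  generalize hq : K ^ 2 + K - 1 = q at h1 ⊢
  field_simp
  rw [← hq]
  ring

lemma one_le_mul_one_sub_inv_oracleConst {K : ℝ} (hK : 1 < K) :
    1 ≤ K * (1 - (oracleConst K)⁻¹) := by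
  rw [mul_one_sub_inv_oracleConst hK, le_div_iff₀ (by nlinarith)]
  nlinarith

lemma budget_of_large {K : ℝ} (hK : 1000 ≤ K) :
    398 / 100 ≤ (1 - (oracleConst K)⁻¹) * (K - 9 / 20) := by
  have h0 : 1 < K := by linarith
  have h1 : 0 < K ^ 2 + K - 1 := by nlinarith
  have h2 := mul_one_sub_inv_oracleConst h0
  have h3 : 399 / 100 ≤ K * (1 - (oracleConst K)⁻¹) := by
    rw [h2, le_div_iff₀ h1]
    nlinarith
  have h4 : K * (1 - (oracleConst K)⁻¹) ≤ 4 := by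
    rw [h2, div_le_iff₀ h1]
    nlinarith
  have h5 : 1 - (oracleConst K)⁻¹ ≤ 1 / 250 := by nlinarith
  linarith

section Oracle

variable {Ω : Type*} [MeasurableSpace Ω] {P : Measure Ω} [IsProbabilityMeasure P] {n : ℕ}
  {X : Fin n → Ω → ℝ} {σ c : ℝ} {a b : ℝ} {m₀ : Part n}

/-- The factor k will be 1/ε. When it is bounded, a small positive mean is affordable; otherwise the
larger budget β provides a variable of nonpositive mean, on which the size of k has no effect. -/
lemma IndepNoise.exists_linear_excess (h : IndepNoise P X σ c) (hσ : 0 < σ) (hc : 0 ≤ c)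
    (ha : 0 < a) (hb : 0 < b) (hn : 2 ≤ n)
    (hcell : ∀ I ∈ m₀.parts, a ^ 2 * Real.log n ^ 2 ≤ (I.card : ℝ)) (M : Finset (Part n))
    (hM : ∀ m ∈ M, model m ≤ model m₀) (hcons : ∀ m ∈ M, Consecutive m)
    (hm₀ : Consecutive m₀) (Δ : Part n → ℝ) (hΔ : ∀ m ∈ M, 0 ≤ Δ m)
    {β : ℝ} (hβ : 11 / 20 ≤ β) {k : ℝ} (hk : 0 ≤ k) (hβk : k ≤ 1000 ∨ 398 / 100 ≤ β)
    (g : EuclideanSpace ℝ (Fin n)) :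
    ∃ Z : Ω → ℝ, Integrable Z P ∧
      k * ∫ ω, Z ω ∂P ≤ penFactor σ c a b / 10 * ∑ m ∈ M, Real.exp (-Δ m) ∧
      ∀ ω, ∀ m ∈ M, 2 * inner ℝ (g - estimator m g) (noiseVec X ω) - ‖g - estimator m g‖ ^ 2
        - β * penFactor σ c a b * (m.parts.card + Δ m) ≤ Z ω := by
  have hV : 0 ≤ penFactor σ c a b := by rw [penFactor_eq σ c b ha]; positivity
  have hS : 0 ≤ ∑ m ∈ M, Real.exp (-Δ m) := by positivity
  rcases hβk with hk' | hβ'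
  · obtain ⟨Z, h1, h2, h3⟩ := h.exists_linear_excess_weights hσ hc ha hb hn hcell M hM Δ hΔ hβ g
    refine ⟨Z, h1, ?_, h3⟩
    calc k * ∫ ω, Z ω ∂P ≤ k * (penFactor σ c a b / 10000 * ∑ m ∈ M, Real.exp (-Δ m)) := by
          gcongr
      _ ≤ 1000 * (penFactor σ c a b / 10000 * ∑ m ∈ M, Real.exp (-Δ m)) := by gcongr
      _ = _ := by ring
  · have key : ∃ Z : Ω → ℝ, Integrable Z P ∧ ∫ ω, Z ω ∂P ≤ 0 ∧
        ∀ ω, ∀ m ∈ M, 2 * inner ℝ (g - estimator m g) (noiseVec X ω) - ‖g - estimator m g‖ ^ 2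
          - 398 / 100 * penFactor σ c a b * m.parts.card ≤ Z ω := by
      rcases le_total (Real.log n) 32 with hlog | hlog
      · exact h.exists_linear_excess_cells hσ hc ha hb hn hcell M hM hcons hlog g
      · exact h.exists_linear_excess_segmentation hσ hc ha hb hcell M hM hcons hm₀ hlog g
    obtain ⟨Z, h1, h2, h3⟩ := key
    refine ⟨Z, h1, (mul_nonpos_of_nonneg_of_nonpos hk h2).trans (by positivity),
      fun ω m hm => le_trans ?_ (h3 ω m hm)⟩
    have hΔm := hΔ m hm
    have : 398 / 100 * penFactor σ c a b * (m.parts.card + 0) ≤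
        β * penFactor σ c a b * (m.parts.card + Δ m) := by gcongr
    linarith

/-- Uniform control of the stochastic terms of the penalized criterion. -/
lemma IndepNoise.exists_excess_of_penalty (h : IndepNoise P X σ c) (hσ : 0 < σ) (hc : 0 ≤ c)
    (ha : 0 < a) (hb : 0 < b) (hn : 2 ≤ n)
    (hcell : ∀ I ∈ m₀.parts, a ^ 2 * Real.log n ^ 2 ≤ (I.card : ℝ)) (M : Finset (Part n))
    (hM : ∀ m ∈ M, model m ≤ model m₀) (hcons : ∀ m ∈ M, Consecutive m)
    (hm₀ : Consecutive m₀) (Δ : Part n → ℝ) (hΔ : ∀ m ∈ M, 0 ≤ Δ m)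
    {K : ℝ} (hK : 1 < K) {pen : Part n → ℝ}
    (hpen : ∀ m ∈ M, K * penFactor σ c a b * ((m.parts.card : ℝ) + Δ m) ≤ pen m)
    (f : EuclideanSpace ℝ (Fin n)) :
    ∃ Z : Ω → ℝ, Integrable Z P ∧
      ∫ ω, Z ω ∂P ≤ penFactor σ c a b * ∑ m ∈ M, Real.exp (-Δ m) ∧
      ∀ ω, ∀ m ∈ M, 2 * ‖estimator m (noiseVec X ω)‖ ^ 2
        - 2 * inner ℝ (f - estimator m f) (noiseVec X ω)
        - (1 - (oracleConst K)⁻¹) * ‖f - estimator m f‖ ^ 2 - pen m ≤ Z ω := by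
  set ε := 1 - (oracleConst K)⁻¹ with hε
  have hKε : 1 ≤ K * ε := one_le_mul_one_sub_inv_oracleConst hK
  have hε0 : 0 < ε := by
    by_contra hcon
    nlinarith
  have hεK : 1 / ε ≤ K := by rw [div_le_iff₀ hε0]; exact hKε
  have hV : 0 ≤ penFactor σ c a b := by rw [penFactor_eq σ c b ha]; positivity
  -- The left-over budget is (11/20)Kε + (9/20)ε(K - 1), where Kε ≥ 1; the 9/20 removed is V/4 + V/5
  -- from the variance terms.
  have hβ : 11 / 20 ≤ ε * (K - 9 / 20) := by nlinarith
  have hβk : 1 / ε ≤ 1000 ∨ 398 / 100 ≤ ε * (K - 9 / 20) := by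
    rcases le_total K 1000 with h1 | h1
    · exact Or.inl (hεK.trans h1)
    · exact Or.inr (budget_of_large h1)
  obtain ⟨Z₁, hZ₁i, hZ₁I, hZ₁⟩ := h.exists_variance_excess hσ hc ha hb hn hcell M hM Δ hΔ
  -- With g = -εf, the functional 2⟨g - Π_m g, ξ⟩ - |g - Π_m g|² is ε times the linear term with
  -- bias fraction ε, which is why Z₂ is divided by ε below.
  obtain ⟨Z₂, hZ₂i, hZ₂I, hZ₂⟩ := h.exists_linear_excess hσ hc ha hb hn hcell M hM hcons hm₀ Δ hΔ
    hβ (by positivity) hβk ((-ε) • f)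
  set V := penFactor σ c a b with hVdef
  have h2 : Integrable (fun ω => 1 / ε * Z₂ ω) P := hZ₂i.const_mul _
  refine ⟨fun ω => Z₁ ω + 1 / ε * Z₂ ω, hZ₁i.add h2, ?_, fun ω m hm => ?_⟩
  · rw [integral_add hZ₁i h2, integral_const_mul]
    have : 0 ≤ V * ∑ m ∈ M, Real.exp (-Δ m) := by positivity
    linarith
  · have h3 := hZ₁ ω m hm
    have h4 := hZ₂ ω m hm
    have h5 := hpen m hm
    have hp := m.one_le_card hn
    have hΔm := hΔ m hm
    rw [estimator_smul, ← smul_sub, real_inner_smul_left, norm_smul, mul_pow, Real.norm_eq_abs,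
      sq_abs, neg_sq] at h4
    have h6 : -2 * inner ℝ (f - estimator m f) (noiseVec X ω) - ε * ‖f - estimator m f‖ ^ 2
        - (K - 9 / 20) * V * (m.parts.card + Δ m) ≤ 1 / ε * Z₂ ω := by
      rw [one_div_mul_eq_div, le_div_iff₀ hε0]
      linarith
    have h7 : V ≤ V * (m.parts.card + Δ m) := le_mul_of_one_le_right hV (by linarith)
    linarith

/-- The noise energy |ξ|² cancels between the two criteria. Adding the bound by z leaves κ times the
bias plus the full variance of m', more than κ times its loss, and the variance of m enters with a
favourable sign. -/
lemma loss_le_of_crit_le {m m' : Part n} {pen : Part n → ℝ} {f x : EuclideanSpace ℝ (Fin n)}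
    {κ z : ℝ} (hκ : κ ≤ 1)
    (hcrit : crit pen (f + x) m' ≤ crit pen (f + x) m)
    (hz : 2 * ‖estimator m' x‖ ^ 2 - 2 * inner ℝ (f - estimator m' f) x
        - (1 - κ) * ‖f - estimator m' f‖ ^ 2 - pen m' ≤ z) :
    κ * ‖f - estimator m' (f + x)‖ ^ 2 ≤
      ‖f - estimator m (f + x)‖ ^ 2 + pen m + 2 * inner ℝ (f - estimator m f) x + z := by
  rw [crit, crit, residual_eq, residual_eq] at hcrit
  rw [loss_eq, loss_eq]
  nlinarith [sq_nonneg ‖estimator m x‖, mul_nonneg (sub_nonneg.2 hκ) (sq_nonneg ‖estimator m' x‖)]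

end Oracle

/-- The random index takes finitely many values, so the composition is a finite sum of restrictions
to measurable events. -/
lemma Part.integrable_comp_index {Ω : Type*} [MeasurableSpace Ω] {P : Measure Ω} {n : ℕ}
    {M : Finset (Part n)} {mhat : Ω → Part n} (hmeas : ∀ m, MeasurableSet {ω | mhat ω = m})
    (hmem : ∀ ω, mhat ω ∈ M) {F : Part n → Ω → ℝ} (hF : ∀ m ∈ M, Integrable (F m) P) :
    Integrable (fun ω => F (mhat ω) ω) P := by
  classical
  have h1 : (fun ω => F (mhat ω) ω) = fun ω => ∑ m ∈ M, {ω | mhat ω = m}.indicator (F m) ω := by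
    funext ω
    rw [Finset.sum_eq_single_of_mem (mhat ω) (hmem ω) fun m _ hne =>
      Set.indicator_of_notMem (s := {ω | mhat ω = m}) (fun hcon => hne hcon.symm) (F m)]
    exact (Set.indicator_of_mem (s := {ω' | mhat ω' = mhat ω}) rfl (F (mhat ω))).symm
  rw [h1]
  exact integrable_finsetSum _ fun m hm => (hF m hm).indicator (hmeas m)

end Histogram
end

theorem proposition3p1
    {Ω : Type*} [MeasurableSpace Ω] (P : Measure Ω) [IsProbabilityMeasure P]
    (n : ℕ) (hn : 2 ≤ n)
    -- the observed vector, with independent components; its mean is `f`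
    (Y : Ω → EuclideanSpace ℝ (Fin n)) (hYmeas : Measurable Y) (hYint : Integrable Y P)
    (hYindep : iIndepFun (fun (i : Fin n) (ω : Ω) => Y ω i) P)
    (f : EuclideanSpace ℝ (Fin n)) (hf : f = ∫ ω, Y ω ∂P)
    (σ c : ℝ) (hσ : 0 < σ) (hc : 0 ≤ c)
    (hnoise : ∀ i : Fin n, Histogram.ExpMomentBound P (fun ω => Y ω i - f i) σ c)
    -- the partition `m₀` and the collection `M` of partitions
    (m₀ : Histogram.Part n) (hm₀ : Histogram.Consecutive m₀)
    (M : Finset (Histogram.Part n))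
    (hMcons : ∀ m ∈ M, Histogram.Consecutive m)
    (hMsub : ∀ m ∈ M, Histogram.model m ≤ Histogram.model m₀)
    (Δ : Histogram.Part n → ℝ) (hΔ : ∀ m ∈ M, 0 ≤ Δ m)
    (a b K : ℝ) (ha : 0 < a) (hb : 0 < b) (hK : 1 < K)
    (hcell : ∀ I ∈ m₀.parts, a ^ 2 * Real.log (n : ℝ) ^ 2 ≤ (I.card : ℝ))
    (pen : Histogram.Part n → ℝ)
    (hpen : ∀ m ∈ M,
      K * Histogram.penFactor σ c a b * ((m.parts.card : ℝ) + Δ m) ≤ pen m)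
    -- the selected index: any (measurable) minimizer of the criterion over `M`
    (mhat : Ω → Histogram.Part n)
    (hmhat_meas : ∀ m, MeasurableSet {ω | mhat ω = m})
    (hmhat_mem : ∀ ω, mhat ω ∈ M)
    (hmhat_min : ∀ ω, ∀ m ∈ M,
      Histogram.crit pen (Y ω) (mhat ω) ≤ Histogram.crit pen (Y ω) m) :
    Integrable (fun ω => ‖f - Histogram.estimator (mhat ω) (Y ω)‖ ^ 2) P ∧
    (∀ m ∈ M, Integrable (fun ω => ‖f - Histogram.estimator m (Y ω)‖ ^ 2) P) ∧
    ∫ ω, ‖f - Histogram.estimator (mhat ω) (Y ω)‖ ^ 2 ∂P ≤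
      Histogram.oracleConst K *
        ((⨅ m : {m : Histogram.Part n // m ∈ M},
            ((∫ ω, ‖f - Histogram.estimator m.1 (Y ω)‖ ^ 2 ∂P) + pen m.1))
          + Histogram.remainder M Δ σ c a b) := by
  have hX := Histogram.indepNoise_sub_integral hYmeas hYint hYindep hf hnoise
  set X : Fin n → Ω → ℝ := fun i ω => Y ω i - f i with hXdef
  have hY : ∀ ω, Y ω = f + Histogram.noiseVec X ω := fun ω => by
    ext i
    simp [hXdef]
  have hloss : ∀ m : Histogram.Part n, Integrable
      (fun ω => ‖f - Histogram.estimator m (Y ω)‖ ^ 2) P := fun m => by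
    simp only [hY, Histogram.loss_eq]
    exact (integrable_const _).add (hX.integrable_norm_estimator_sq hc m)
  have hhat := Histogram.Part.integrable_comp_index hmhat_meas hmhat_mem fun m _ => hloss m
  refine ⟨hhat, fun m _ => hloss m, ?_⟩
  obtain ⟨Z, hZi, hZI, hZ⟩ := hX.exists_excess_of_penalty hσ hc ha hb hn hcell M hMsub hMcons hm₀
    Δ hΔ hK hpen f
  have hC := Histogram.oracleConst_pos hK
  set C := Histogram.oracleConst K with hCdef
  have hC1 : C⁻¹ ≤ 1 := by
    have := Histogram.one_le_mul_one_sub_inv_oracleConst hK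
    by_contra hcon
    push Not at hcon
    nlinarith
  -- Only the sign of the term in n^{-b} matters, since the bad-event energy has already been paid
  -- by the penalty.
  have hR : Histogram.penFactor σ c a b * ∑ m ∈ M, Real.exp (-Δ m) ≤
      Histogram.remainder M Δ σ c a b := by
    rw [Histogram.remainder, le_add_iff_nonneg_right]
    positivity
  -- Because m is deterministic here, the cross term 2⟨f - Π_m f, ξ⟩ integrates to zero; at the
  -- random index it had to be included in Z.
  have key : ∀ m ∈ M, C⁻¹ * ∫ ω, ‖f - Histogram.estimator (mhat ω) (Y ω)‖ ^ 2 ∂P ≤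
      (∫ ω, ‖f - Histogram.estimator m (Y ω)‖ ^ 2 ∂P) + pen m
        + Histogram.remainder M Δ σ c a b := by
    intro m hm
    have hin := (hX.integrable_inner hc (f - Histogram.estimator m f)).const_mul 2
    have h1 : Integrable (fun ω => ‖f - Histogram.estimator m (Y ω)‖ ^ 2 + pen m) P :=
      (hloss m).add (integrable_const _)
    have h2 : Integrable (fun ω => ‖f - Histogram.estimator m (Y ω)‖ ^ 2 + pen m
        + 2 * inner ℝ (f - Histogram.estimator m f) (Histogram.noiseVec X ω)) P := h1.add hin
    have h3 : Integrable (fun ω => ‖f - Histogram.estimator m (Y ω)‖ ^ 2 + pen m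
        + 2 * inner ℝ (f - Histogram.estimator m f) (Histogram.noiseVec X ω) + Z ω) P := h2.add hZi
    have h4 : ∫ ω, C⁻¹ * ‖f - Histogram.estimator (mhat ω) (Y ω)‖ ^ 2 ∂P ≤
        ∫ ω, (‖f - Histogram.estimator m (Y ω)‖ ^ 2 + pen m
        + 2 * inner ℝ (f - Histogram.estimator m f) (Histogram.noiseVec X ω) + Z ω) ∂P := by
      refine integral_mono (hhat.const_mul _) h3 fun ω => ?_
      have hmin := hmhat_min ω m hm
      simp only [hY] at hmin ⊢
      exact Histogram.loss_le_of_crit_le hC1 hmin (hZ ω _ (hmhat_mem ω))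
    rw [integral_const_mul, integral_add h2 hZi, integral_add h1 hin,
      integral_add (hloss m) (integrable_const _), integral_const_mul, hX.integral_inner hc] at h4
    simp only [integral_const, probReal_univ, one_smul] at h4
    linarith
  have : Nonempty Ω := P.nonempty_of_neZero
  have : Nonempty {m : Histogram.Part n // m ∈ M} :=
    ⟨⟨mhat (Classical.arbitrary Ω), hmhat_mem _⟩⟩
  rw [← inv_mul_le_iff₀ hC, ← sub_le_iff_le_add]
  refine le_ciInf fun m => ?_
  linarith [key m.1 m.2]
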